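/- Let $k$ be an algebraically closed field of characteristic $0$. For a finite abelian group $A$, a \emph{free central extension} of $A$ (a realization of $F^c(A)$, which is unique up to isoclinism) is a group $F$ with a surjective homomorphism $p\colon F\to A$ whose kernel $Z$ is central in $F$, such that the commutator pairing $(p(g),p(h))\mapsto ghg^{-1}h^{-1}$ induces an isomorphism $\wedge^2 A\cong Z$. For a finite-dimensional representation $V$ of a finite group $F$ over $k$, $V/F$ has function field $k(V)^F$; a variety with function field $L$ is \emph{rational} over $k$ if $L\cong k(s_1,\dots,s_m)$ over $k$ for some $m$, and \emph{stably rational} if $L(t_1,\dots,t_n)\cong k(s_1,\dots,s_m)$ over $k$ for some $n,m$. (1) Suppose that $A$ is cyclic, or $A\cong(\mathbb Z/\ell)^2$ for a prime $\ell$, or $A\cong(\mathbb Z/2)^3$. Then for every free central extension $F$ of $A$ and every faithful finite-dimensional representation $V$ of $F$ over $k$, the quotient $V/F$ is stably rational over $k$. (2) For every prime $\ell$, the Heisenberg group of upper unitriangular $3\times3$ matrices over $\mathbb Z/\ell$ is a free central extension of $(\mathbb Z/\ell)^2$. (3) Let $A\cong(\mathbb Z/2)^3$ with basis $e_1,e_2,e_3$,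 let $\pi_i\colon A\to(\mathbb Z/2)^2$ be surjective homomorphisms with $\pi_i(e_i)=0$ for $i=1,2,3$, and let $q_i\colon Q_8\to(\mathbb Z/2)^2$ be surjective homomorphisms from the quaternion group of order $8$. Let $F\subset Q_8\times Q_8\times Q_8$ be the subgroup of all $(g_1,g_2,g_3)$ for which there is $a\in A$ with $q_i(g_i)=\pi_i(a)$ for all $i$. Then there is a homomorphism $p\colon F\to A$ with $q_i(g_i)=\pi_i(p(g))$ for all $g\in F$ and all $i$, which makes $F$ a free central extension of $A$. Moreover, if $V_1,V_2,V_3$ are faithful $2$-dimensional representations of $Q_8$ over $k$ and $F$ acts on $W=V_1\oplus V_2\oplus V_3$ through its $i$-th coordinate on $V_i$, then $W$ is a faithful representation of $F$, and there are coordinates $x_i=y_i/z_i$ on $\mathbb P(V_i)$ ($y_i,z_i$ linearly independent linear forms on $V_i$) such that the action of $F$ on $k(W)$ induces, through $p$, a faithful action of $G=A$ on $k(x_1,x_2,x_3)$ that is monomial, $$\sigma(x_i)=c_{i,\sigma}\,x_i^{a_{i,\sigma}},\qquad c_{i,\sigma},a_{i,\sigma}\in\{\pm1\},\quad \sigma\in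 G;$$ there is an isomorphism $k(W)^F\cong k(x_1,x_2,x_3)^G(t_1,t_2,t_3)$ over $k$ with $t_1,t_2,t_3$ algebraically independent, i.e. $W/F$ is birational to $\bigl((\mathbb P^1)^3/G\bigr)\times(k^\times)^3$; and the field $k(x_1,x_2,x_3)^G$ is rational over $k$. -/

import Mathlib

universe u v w x

noncomputable section

namespace FreeCentral

/-! ### Rational and stably rational fields -/

/-- The field `L(t₁, …, tₙ)` of rational functions in `n` variables over a field `L`. -/
abbrev RatField (n : ℕ) (L : Type*) [Field L] : Type _ :=
  FractionRing (MvPolynomial (Fin n) L)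

/-- The variable `tᵢ` in `L(t₁, …, tₙ)`. -/
def ratVar {n : ℕ} (L : Type*) [Field L] (i : Fin n) : RatField n L :=
  algebraMap (MvPolynomial (Fin n) L) (RatField n L) (MvPolynomial.X i)

/-- An extension `L / k` (the function field of a `k`-variety) is rational if it is purely
transcendental of finite transcendence degree. -/
def IsRational (k : Type*) [Field k] (L : Type*) [Field L] [Algebra k L] : Prop :=
  ∃ n : ℕ, Nonempty (L ≃ₐ[k] RatField n k)

/-- An extension `L / k` (the function field of a `k`-variety `X`) is stably rational if
`L(t₁, …, tₙ)`, the function field of `X × 𝔸ⁿ`, is rational over `k` for some `n`. -/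
def IsStablyRational (k : Type*) [Field k] (L : Type*) [Field L] [Algebra k L] : Prop :=
  ∃ n : ℕ, IsRational k (RatField n L)

/-! ### The function field of a linear quotient `V / G` -/

section LinearQuotient

variable (k : Type*) [Field k]

/-- The function field `k(V)` of a vector space `V`, i.e. the fraction field of the ring
`k[V] = Sym(V*)` of polynomial functions on `V`. -/
abbrev FunField (V : Type*) [AddCommGroup V] [Module k V] : Type _ :=
  FractionRing (SymmetricAlgebra k (Module.Dual k V))

variable {k}
variable {V : Type*} [AddCommGroup V] [Module k V] {G : Type*} [Group G]

/-- A linear form on `V` as an element of `k(V)`. -/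
def linForm (f : Module.Dual k V) : FunField k V :=
  algebraMap (SymmetricAlgebra k (Module.Dual k V)) (FunField k V)
    (SymmetricAlgebra.ι k (Module.Dual k V) f)

/-- The action `(g • f)(x) = f(g⁻¹ x)` of `G` on the polynomial functions on `V`, by algebra
endomorphisms. -/
def polyAction (ρ : Representation k G V) :
    G →* (SymmetricAlgebra k (Module.Dual k V) →ₐ[k] SymmetricAlgebra k (Module.Dual k V)) where
  toFun g := SymmetricAlgebra.lift (SymmetricAlgebra.ι k (Module.Dual k V) ∘ₗ ρ.dual g)
  map_one' := by
    apply SymmetricAlgebra.algHom_ext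
    ext f
    simp only [map_one, SymmetricAlgebra.lift_comp_ι]
    rfl
  map_mul' g h := by
    apply SymmetricAlgebra.algHom_ext
    ext f
    simp only [map_mul, SymmetricAlgebra.lift_comp_ι]
    simp [SymmetricAlgebra.lift_ι_apply]

/-- The action of `G` on `k(V)` by `k`-automorphisms induced by a representation on `V`. -/
def funAction (ρ : Representation k G V) : G →* (FunField k V ≃ₐ[k] FunField k V) :=
  (IsFractionRing.fieldEquivOfAlgEquivHom k (FunField k V)).comp
    ((AlgEquiv.algHomUnitsEquiv k _).toMonoidHom.comp (polyAction ρ).toHomUnits)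

/-- The action of `G` on linear forms: `g • f = f ∘ g⁻¹`. -/
theorem funAction_linForm (ρ : Representation k G V) (g : G) (f : Module.Dual k V) :
    funAction ρ g (linForm f) = linForm (f ∘ₗ ρ g⁻¹) := by
  simp only [funAction, linForm, MonoidHom.comp_apply,
    IsFractionRing.fieldEquivOfAlgEquivHom_apply, IsFractionRing.fieldEquivOfAlgEquiv_algebraMap]
  congr 1
  change SymmetricAlgebra.lift (SymmetricAlgebra.ι k (Module.Dual k V) ∘ₗ ρ.dual g)
    (SymmetricAlgebra.ι k (Module.Dual k V) f) = _
  rw [SymmetricAlgebra.lift_ι_apply]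
  rfl

end LinearQuotient

/-- The field of invariants of a group acting by `k`-automorphisms on a field `K`. -/
abbrev Invariants {k K G : Type*} [Field k] [Field K] [Algebra k K] [Group G]
    (σ : G →* (K ≃ₐ[k] K)) : IntermediateField k K :=
  IntermediateField.fixedField σ.range

/-- The function field `k(V / G) = k(V)^G` of the quotient of a representation `V` of a
finite group `G`. -/
abbrev QuotFunField {k V G : Type*} [Field k] [AddCommGroup V] [Module k V] [Group G]
    (ρ : Representation k G V) : IntermediateField k (FunField k V) :=
  Invariants (funAction ρ)

/-! ### Free central extensions of abelian groups -/

/-- `π : F → A` is a free central extension of the abelian group `A`: it is surjective with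
central kernel `Z`, and the commutators of lifts of elements of `A` identify `Z` with `⋀² A`
(so they generate `Z`, and satisfy only the relations that hold in every central extension). -/
structure IsFreeCentralExtension {F A : Type*} [Group F] [AddCommGroup A]
    (π : F →* Multiplicative A) : Prop where
  surjective : Function.Surjective π
  central : π.ker ≤ Subgroup.center F
  commutator : ∃ c : ⋀[ℤ]^2 A ≃+ Additive π.ker, ∀ g h : F,
    ((c (exteriorPower.ιMulti ℤ 2 ![(π g).toAdd, (π h).toAdd])).toMul : F) = g * h * g⁻¹ * h⁻¹

/-! ### The Heisenberg group -/

/-- The Heisenberg group over `R`: upper triangular `3 × 3` matrices with `1` on the diagonal. -/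
def Heisenberg (R : Type*) [CommRing R] : Subgroup (Matrix.SpecialLinearGroup (Fin 3) R) where
  carrier := {M | (∀ i, M i i = 1) ∧ ∀ i j, j < i → M i j = 0}
  one_mem' := by
    refine ⟨fun i => by simp, fun i j h => ?_⟩
    simp [h.ne']
  mul_mem' := by
    rintro M N ⟨hM, hM'⟩ ⟨hN, hN'⟩
    have a1 := hM' 1 0 (by decide)
    have a2 := hM' 2 0 (by decide)
    have a3 := hM' 2 1 (by decide)
    have b1 := hN' 1 0 (by decide)
    have b2 := hN' 2 0 (by decide)
    have b3 := hN' 2 1 (by decide)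
    refine ⟨fun i => ?_, fun i j h => ?_⟩
    · fin_cases i <;> simp_all [Matrix.mul_apply, Fin.sum_univ_three]
    · fin_cases i <;> fin_cases j <;> simp_all [Matrix.mul_apply, Fin.sum_univ_three]
  inv_mem' := by
    rintro M ⟨hM, hM'⟩
    have a1 := hM' 1 0 (by decide)
    have a2 := hM' 2 0 (by decide)
    have a3 := hM' 2 1 (by decide)
    have c0 := hM 0
    have c1 := hM 1
    have c2 := hM 2
    refine ⟨fun i => ?_, fun i j h => ?_⟩
    · fin_cases i <;>
        simp_all [Matrix.SpecialLinearGroup.coe_inv, Matrix.adjugate_fin_three]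
    · fin_cases i <;> fin_cases j <;>
        simp_all [Matrix.SpecialLinearGroup.coe_inv, Matrix.adjugate_fin_three]

/-! ### The quaternion model of the free central extension of `(ℤ/2)³` -/

/-- The group `Q₈` of quaternions `{±1, ±i, ±j, ±k}`. -/
abbrev Q8 : Type := QuaternionGroup 2

/-- The Klein four group `(ℤ/2)²`. -/
abbrev V4 : Type := ZMod 2 × ZMod 2

/-- The subgroup of `Q₈ × Q₈ × Q₈` of all triples whose image in `((ℤ/2)²)³` under
`q₁ × q₂ × q₃` lies in the image of `A` under `(π₁, π₂, π₃)`. -/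
def quaternionModel {A : Type*} [AddCommGroup A] [Module (ZMod 2) A]
    (π : Fin 3 → A →ₗ[ZMod 2] V4) (q : Fin 3 → Q8 →* Multiplicative V4) :
    Subgroup (Fin 3 → Q8) where
  carrier := {g | ∃ a : A, ∀ i, q i (g i) = Multiplicative.ofAdd (π i a)}
  one_mem' := ⟨0, fun i => by simp⟩
  mul_mem' := by
    rintro g h ⟨a, ha⟩ ⟨b, hb⟩
    exact ⟨a + b, fun i => by simp [ha, hb, ofAdd_add]⟩
  inv_mem' := by
    rintro g ⟨a, ha⟩
    exact ⟨-a, fun i => by simp [ha]⟩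

/-- The direct sum `V₁ ⊕ V₂ ⊕ V₃` of representations of `Q₈`, restricted to a subgroup `F` of
`Q₈ × Q₈ × Q₈`, with the `i`-th factor acting on `Vᵢ`. -/
def sumRep {k : Type*} [Field k] {V : Fin 3 → Type*} [∀ i, AddCommGroup (V i)]
    [∀ i, Module k (V i)] (ρ : ∀ i, Representation k Q8 (V i)) (F : Subgroup (Fin 3 → Q8)) :
    Representation k F (∀ i, V i) where
  toFun g := LinearMap.pi fun i => ρ i ((g : Fin 3 → Q8) i) ∘ₗ LinearMap.proj i
  map_one' := by ext; simp
  map_mul' g h := by ext; simp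

end FreeCentral

end

noncomputable section

namespace FreeCentral

section

open Module Polynomial

/-! ### Degree bounds by adjoining one element at a time -/

section Degree

variable {E : Type*} [Field E]

/-! By the no-name lemma, if `V` and `W` are faithful representations of `F`, then `k(V)^F` and
`k(W)^F` both become `k(V × W)^F` after adjoining variables. So for stable rationality it is enough
to find, for each free central extension `F`, one faithful `W` with `k(W)^F` rational. The no-name
lemma rests on Speiser's lemma `exists_invariant_span`: a space with a semilinear action of a finite
group acting faithfully on the scalars is spanned by its invariants.

Every rationality proof has the same shape (`isRational_invariants_of_rank_le`). Write down as many
invariants `y` as the transcendence degree, and recover the whole field `E` from `k(y)` by adjoining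
successive roots of total degree at most `|F|`. Artin's theorem `[E : E^F] = |F|` then forces `k(y)
= E^F`.

For cyclic `A` the exterior square vanishes, so `F ≅ A` has a faithful character, and the invariants
are generated by a power of one coordinate. For `(ℤ/ℓ)²` the group `F` has order `ℓ³` and an
`ℓ`-dimensional representation with a diagonal generator `D` and a cyclic shift `S`. One extra
character with coordinate `t` makes the elements `x (i + 1) / x i * t` invariant under `D` and
cyclically permuted by `S`; a Fourier transform diagonalises `S`, and `ℓ + 1` invariants can be read
off (`isRational_invariants_heisenberg`).

For `(ℤ/2)³` the three sign characters of the kernel give three planes. On the `i`-th plane the lift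
of `e i` is scalar, while the other two lifts anticommute, so on the ratios `x i = y i / z i` the
group acts through `A` by an explicit monomial action, whose invariants are rational
(`isRational_invariants_monomial`). The fibre coordinates are obtained from `y i ^ 2 + z i ^ 2`,
corrected by semi-invariants in the `x i` (`nonempty_invariants_algEquiv_of_monomial`).

The extension enters only through its commutator pairing, written in coordinates as `2 × 2` minors.
Powers of lifts contribute roots of unity that are absorbed by semi-invariants, so all members of
the isoclinism class are treated at once. The quaternion model is one of them: its kernel over `A`
is `{±1}³`, and each commutator in `Q₈` is the determinant of the images in `(ℤ/2)²`. -/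

theorem rank_le_mul_of_aeval_eq_zero (A : Subfield E) (z : E) (p : A[X]) (hp : p ≠ 0)
    (hz : aeval z p = 0) {n N : ℕ} (hn : p.natDegree ≤ n)
    (h : Module.rank ↥(A ⊔ Subfield.closure {z}) E ≤ N) : Module.rank A E ≤ (n * N : ℕ) := by
  have hle : A ≤ A ⊔ Subfield.closure {z} := le_sup_left
  have hint : IsIntegral A z := by
    rw [← isAlgebraic_iff_isIntegral]; exact ⟨p, hp, hz⟩
  -- The compositum is the simple extension `A(z)`, whose degree is that of the minimal polynomial,
  -- a divisor of `p`; the tower law does the rest.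
  have hext : Subfield.extendScalars hle = IntermediateField.adjoin A {z} := by
    apply le_antisymm
    · intro y hy
      have hy' : y ∈ A ⊔ Subfield.closure {z} := hy
      have : A ⊔ Subfield.closure {z} ≤ (IntermediateField.adjoin A {z}).toSubfield := by
        refine sup_le (fun a ha => (IntermediateField.adjoin A {z}).algebraMap_mem ⟨a, ha⟩) ?_
        rw [Subfield.closure_le]
        exact IntermediateField.subset_adjoin A {z}
      exact this hy'
    · rw [IntermediateField.adjoin_le_iff]
      intro y hy
      exact (le_sup_right : _ ≤ A ⊔ Subfield.closure {z}) (Subfield.subset_closure hy)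
  rw [← Subfield.relrank_mul_rank_top hle, Subfield.relrank_eq_rank_of_le hle, hext]
  have := IntermediateField.adjoin.finiteDimensional hint
  rw [← finrank_eq_rank, IntermediateField.adjoin.finrank hint]
  push_cast
  gcongr
  exact (natDegree_le_of_dvd (minpoly.dvd A z hz) hp).trans hn

theorem rank_le_mul_of_pow_mem (A : Subfield E) (z : E) {n N : ℕ} (hn : n ≠ 0) (hz : z ^ n ∈ A)
    (h : ∀ A' : Subfield E, A ≤ A' → z ∈ A' → Module.rank A' E ≤ N) :
    Module.rank A E ≤ (n * N : ℕ) :=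
  rank_le_mul_of_aeval_eq_zero A z (X ^ n - C ⟨z ^ n, hz⟩) (X_pow_sub_C_ne_zero hn.bot_lt _)
    (by simp [sub_eq_zero]; rfl) (natDegree_X_pow_sub_C).le
    (h _ le_sup_left (le_sup_right (a := A) (Subfield.subset_closure rfl)))

theorem rank_le_one_of_top_le (A : Subfield E) (h : ⊤ ≤ A) : Module.rank A E ≤ (1 : ℕ) := by
  rw [top_le_iff] at h
  subst h
  rw [← Subfield.relrank_top_right, Subfield.relrank_self]; simp

theorem rank_le_of_le {A B : Subfield E} (h : A ≤ B) {N : ℕ} (hA : Module.rank A E ≤ N) :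
    Module.rank B E ≤ N := by
  refine le_trans ?_ hA
  rw [← Subfield.relrank_mul_rank_top h, Subfield.relrank_eq_rank_of_le h]
  exact le_mul_of_one_le_left' (Cardinal.one_le_iff_ne_zero.2 rank_pos.ne')

end Degree

theorem top_le_of_adjoin_eq_top {k E ι : Type*} [Field k] [Field E] [Algebra k E] {f : ι → E}
    (h : IntermediateField.adjoin k (Set.range f) = ⊤) (A : Subfield E)
    (hk : ∀ c : k, algebraMap k E c ∈ A) (hf : ∀ i, f i ∈ A) : ⊤ ≤ A := by
  have h1 : (⊤ : IntermediateField k E).toSubfield ≤ A := by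
    rw [← h]
    change Subfield.closure _ ≤ _
    rw [Subfield.closure_le]
    rintro _ (⟨b, rfl⟩ | ⟨i, rfl⟩)
    · exact hk b
    · exact hf i
  exact h1

/-! ### Artin's theorem and a rationality criterion -/

section Artin

variable {k : Type*} [Field k] {E : Type*} [Field E] [Algebra k E] {F : Type*} [Group F]
  (β : F →* (E ≃ₐ[k] E))

theorem mem_invariants_iff (y : E) : y ∈ Invariants β ↔ ∀ g, β g y = y := by
  simp [IntermediateField.mem_fixedField_iff]

theorem finrank_invariants [Finite F] (hβ : Function.Injective β) :
    Module.finrank (Invariants β) E = Nat.card F := by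
  have : Finite β.range := Finite.of_surjective _ β.rangeRestrict_surjective
  let _ : Fintype β.range := Fintype.ofFinite _
  have := FixedPoints.finrank_eq_card β.range E
  rw [← Nat.card_eq_fintype_card, ← Nat.card_congr (MonoidHom.ofInjective hβ).toEquiv] at this
  exact this

instance finiteDimensional_invariants [Finite F] :
    FiniteDimensional (Invariants β) E := by
  have : Finite β.range := Finite.of_surjective _ β.rangeRestrict_surjective
  let _ : Fintype β.range := Fintype.ofFinite _
  exact (inferInstance : FiniteDimensional (FixedPoints.subfield β.range E) E)

instance isSeparable_invariants [Finite F] :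
    Algebra.IsSeparable (Invariants β) E :=
  have : Finite β.range := Finite.of_surjective _ β.rangeRestrict_surjective
  (inferInstance : Algebra.IsSeparable (FixedPoints.subfield β.range E) E)

/-- By Artin the invariant field has codegree exactly `|F|`, so in the tower over `B` the lower step
has degree one. -/
theorem invariants_le_of_rank_le [Finite F] (hβ : Function.Injective β) (B : Subfield E)
    (hB : B ≤ (Invariants β).toSubfield) (h : Module.rank B E ≤ Nat.card F) :
    (Invariants β).toSubfield ≤ B := by
  rw [← Subfield.relrank_eq_one_iff]
  have h1 := Subfield.relrank_mul_rank_top hB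
  have h2 : Module.rank (Invariants β).toSubfield E = (Nat.card F : Cardinal) := by
    rw [← finrank_invariants β hβ]
    exact (finrank_eq_rank (Invariants β) E).symm
  rw [h2] at h1
  have hpos : 0 < Nat.card F := Nat.card_pos
  have h3 : B.relrank (Invariants β).toSubfield * Nat.card F ≤ 1 * Nat.card F := by
    rw [h1, one_mul]; exact h
  -- Cancelling `|F|` is legitimate only for finite cardinals; finiteness of the relative rank
  -- follows from `h3` itself.
  have h4 : B.relrank (Invariants β).toSubfield ≤ 1 := by
    rcases Cardinal.lt_aleph0.1 (lt_of_le_of_lt (le_trans (by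
      simpa using mul_le_mul_right (Cardinal.one_le_iff_pos.2 (by exact_mod_cast hpos))
        (B.relrank (Invariants β).toSubfield)) h3) (by simp)) with ⟨n, hn⟩
    rw [hn] at h3 ⊢
    exact_mod_cast Nat.le_of_mul_le_mul_right (by exact_mod_cast h3) hpos
  refine le_antisymm h4 (Cardinal.one_le_iff_ne_zero.2 fun h0 => ?_)
  rw [h0, zero_mul] at h1
  rw [← h1] at h
  have : (0 : Cardinal) < Module.rank B E := rank_pos
  exact absurd h1 this.ne

end Artin

section Rational

variable {k : Type*} [Field k] {E : Type*} [Field E] [Algebra k E]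

/-- A family over which `E` is algebraic contains a transcendence basis, and there is no room for a
proper subfamily. This spares all direct verification that explicit invariants are independent. -/
theorem algebraicIndependent_of_trdeg {n : ℕ} (y : Fin n → E)
    [Algebra.IsAlgebraic (IntermediateField.adjoin k (Set.range y)) E]
    (h : Algebra.trdeg k E = n) : AlgebraicIndependent k y := by
  have : Algebra.IsAlgebraic (Algebra.adjoin k (Set.range y)) E :=
    IntermediateField.isAlgebraic_adjoin_iff_top.1 ‹_›
  refine (Algebra.IsAlgebraic.isTranscendenceBasis_of_lift_le_trdeg_of_finite k y ?_).1
  simp [h]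

theorem isRational_of_adjoin_eq (L : IntermediateField k E) {n : ℕ} (y : Fin n → E)
    (hy : AlgebraicIndependent k y) (hL : IntermediateField.adjoin k (Set.range y) = L) :
    IsRational k L := by
  subst hL
  exact ⟨n, ⟨hy.aevalEquivField.symm⟩⟩

theorem isRational_congr {L M : Type*} [Field L] [Field M] [Algebra k L] [Algebra k M]
    (e : L ≃ₐ[k] M) (h : IsRational k L) : IsRational k M :=
  let ⟨n, ⟨f⟩⟩ := h
  ⟨n, ⟨e.symm.trans f⟩⟩

theorem isRational_invariants_of_rank_le {F ι : Type*} [Group F] [Finite F] [Fintype ι]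
    (β : F →* (E ≃ₐ[k] E)) (hβ : Function.Injective β)
    (hE : Algebra.trdeg k E = Fintype.card ι) (y : ι → E) (hy : ∀ g i, β g (y i) = y i)
    (h : Module.rank (IntermediateField.adjoin k (Set.range y)).toSubfield E ≤ Nat.card F) :
    IsRational k (Invariants β) := by
  have hle : IntermediateField.adjoin k (Set.range y) ≤ Invariants β := by
    rw [IntermediateField.adjoin_le_iff]
    rintro _ ⟨i, rfl⟩
    exact (mem_invariants_iff β _).2 fun g => hy g i
  have heq : IntermediateField.adjoin k (Set.range y) = Invariants β :=
    le_antisymm hle (invariants_le_of_rank_le β hβ _ hle h)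
  have hr : Set.range (y ∘ (Fintype.equivFin ι).symm) = Set.range y :=
    (Fintype.equivFin ι).symm.surjective.range_comp y
  rw [← hr] at heq
  have : FiniteDimensional
      (IntermediateField.adjoin k (Set.range (y ∘ (Fintype.equivFin ι).symm))) E := by
    rw [heq]; infer_instance
  exact isRational_of_adjoin_eq _ _ (algebraicIndependent_of_trdeg (y ∘ (Fintype.equivFin ι).symm) hE) heq

end Rational

end

section

open Module

/-! ### Descent of a purely transcendental extension to invariants -/

section Descent

variable {k K E : Type*} [Field k] [Field K] [Field E] [Algebra k K] [Algebra k E] [Algebra K E]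
  [IsScalarTower k K E]

/-- The candidate for `E^F` is `K^A(t)`. Its codegree in `E` is at most `[K : K^A] * [E : K(t)] ≤
|A| * N ≤ |F|`, so Artin's theorem identifies the two. The case `N = 1` gives the no-name lemma; a
larger `N` allows `F` to act on `K` through a proper quotient. -/
theorem nonempty_invariants_algEquiv_ratField {A F : Type*} [Group A] [Group F] [Finite A] [Finite F]
    (σ : A →* (K ≃ₐ[k] K)) (hσ : Function.Injective σ)
    (β : F →* (E ≃ₐ[k] E)) (hβ : Function.Injective β) (p : F →* A)
    (heq : ∀ g f, β g (algebraMap K E f) = algebraMap K E (σ (p g) f)) {m N : ℕ}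
    (htr : Algebra.trdeg K E = m) (t : Fin m → E) (ht : ∀ g i, β g (t i) = t i)
    (h : Module.rank (IntermediateField.adjoin K (Set.range t)).toSubfield E ≤ N)
    (hN : Nat.card A * N ≤ Nat.card F) :
    Nonempty (Invariants β ≃ₐ[k] RatField m (Invariants σ)) := by
  set K₀ := Invariants σ with hK₀
  have hK₀fin : FiniteDimensional K₀ K := finiteDimensional_invariants σ
  have hK₀sep : Algebra.IsSeparable K₀ K := isSeparable_invariants σ
  have hind : AlgebraicIndependent K t := by
    have : FiniteDimensional (IntermediateField.adjoin K (Set.range t)) E := by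
      refine Module.rank_lt_aleph0_iff.1 ?_
      exact h.trans_lt (by simp)
    exact algebraicIndependent_of_trdeg t htr
  have hind₀ : AlgebraicIndependent K₀ t := hind.restrictScalars (algebraMap K₀ K).injective
  set B : IntermediateField K₀ E := IntermediateField.adjoin K₀ (Set.range t) with hB
  have hBle : B.toSubfield ≤ (Invariants β).toSubfield := by
    rw [hB]
    change (Subfield.closure _) ≤ _
    rw [Subfield.closure_le]
    rintro _ (⟨⟨a, ha⟩, rfl⟩ | ⟨i, rfl⟩)
    · refine (mem_invariants_iff β _).2 fun g => ?_
      change β g (algebraMap K E a) = algebraMap K E a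
      rw [heq, (mem_invariants_iff σ _).1 ha]
    · exact (mem_invariants_iff β _).2 fun g => ht g i
  have hrank : Module.rank B.toSubfield E ≤ Nat.card F := by
    -- Adjoining a primitive element `θ` of `K / K^A` to `K^A(t)` already produces all of `K(t)`, so
    -- passing from one to the other costs at most `|A|`.
    obtain ⟨θ, hθ⟩ := Field.exists_primitive_element K₀ K
    have hdeg : (minpoly K₀ θ).natDegree = Nat.card A := by
      rw [← finrank_invariants σ hσ, ← IntermediateField.adjoin.finrank (.of_finite K₀ θ), hθ,
        IntermediateField.finrank_top']
    have hne : minpoly K₀ θ ≠ 0 := minpoly.ne_zero (.of_finite K₀ θ)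
    refine (rank_le_mul_of_aeval_eq_zero B.toSubfield (algebraMap K E θ)
      ((minpoly K₀ θ).map (algebraMap K₀ B)) ?_ ?_ (n := Nat.card A) (N := N) ?_ ?_).trans
      (by exact_mod_cast hN)
    · rwa [Polynomial.map_ne_zero_iff (algebraMap K₀ B).injective]
    · change Polynomial.aeval (R := B) _ _ = 0
      rw [Polynomial.aeval_map_algebraMap, Polynomial.aeval_algebraMap_apply, minpoly.aeval,
        map_zero]
    · rw [Polynomial.natDegree_map, hdeg]
    · refine rank_le_of_le ?_ h
      change Subfield.closure _ ≤ _
      rw [Subfield.closure_le]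
      rintro _ (⟨a, rfl⟩ | hi)
      · have h1 : (⊤ : IntermediateField K₀ K).toSubfield ≤
            (B.toSubfield ⊔ Subfield.closure {algebraMap K E θ}).comap (algebraMap K E) := by
          rw [← hθ]
          change Subfield.closure _ ≤ _
          rw [Subfield.closure_le]
          rintro _ (⟨b, rfl⟩ | hb)
          · exact (le_sup_left : B.toSubfield ≤ _) (B.algebraMap_mem b)
          · rw [Set.mem_singleton_iff] at hb
            subst hb
            exact (le_sup_right : _ ≤ B.toSubfield ⊔ _) (Subfield.subset_closure rfl)
        exact h1 (x := a) trivial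
      · exact (le_sup_left : B.toSubfield ≤ _) (IntermediateField.subset_adjoin K₀ _ hi)
  have hge := invariants_le_of_rank_le β hβ B.toSubfield hBle hrank
  have hBE : B.restrictScalars k = Invariants β :=
    le_antisymm (fun a ha => hBle ha) (fun a ha => hge ha)
  exact ⟨((IntermediateField.equivOfEq hBE.symm).trans
    (hind₀.aevalEquivField.restrictScalars k).symm)⟩

theorem adjoin_sumElim_eq_top {ι κ : Type*} (y : ι → K) (t : κ → E)
    (hy : IntermediateField.adjoin k (Set.range y) = ⊤)
    (ht : IntermediateField.adjoin K (Set.range t) = ⊤) :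
    IntermediateField.adjoin k (Set.range (Sum.elim t (algebraMap K E ∘ y))) = ⊤ := by
  set S := IntermediateField.adjoin k (Set.range (Sum.elim t (algebraMap K E ∘ y))) with hS
  have h1 : ∀ a : K, algebraMap K E a ∈ S := fun a => by
    have : (⊤ : IntermediateField k K) ≤ S.comap (IsScalarTower.toAlgHom k K E) := by
      rw [← hy, IntermediateField.adjoin_le_iff]
      rintro _ ⟨i, rfl⟩
      exact IntermediateField.subset_adjoin k _ ⟨Sum.inr i, rfl⟩
    exact this (x := a) trivial
  rw [eq_top_iff]
  have h2 : (⊤ : IntermediateField K E).toSubfield ≤ S.toSubfield := by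
    rw [← ht]
    change Subfield.closure _ ≤ _
    rw [Subfield.closure_le]
    rintro _ (⟨a, rfl⟩ | ⟨i, rfl⟩)
    · exact h1 a
    · exact IntermediateField.subset_adjoin k _ ⟨Sum.inl i, rfl⟩
  exact fun a ha => h2 trivial

end Descent

/-! ### Rational function fields -/

section RatField

variable {k : Type*} [Field k]

theorem algebraicIndependent_ratVar (L : Type*) [Field L] (n : ℕ) :
    AlgebraicIndependent L (ratVar (n := n) L) := by
  have h := (MvPolynomial.algebraicIndependent_X (Fin n) L).map' (f := IsScalarTower.toAlgHom L
    (MvPolynomial (Fin n) L) (RatField n L)) (IsFractionRing.injective _ _)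
  exact h

theorem adjoin_range_algebraMap_comp_X (L : Type*) [Field L] (ι : Type*) (R E : Type*)
    [CommRing R] [IsDomain R] [Field E] [Algebra L R] [Algebra R E] [Algebra L E]
    [IsScalarTower L R E]
    [IsFractionRing R E] (x : ι → R) (hx : Algebra.adjoin L (Set.range x) = ⊤) :
    IntermediateField.adjoin L (Set.range (algebraMap R E ∘ x)) = ⊤ := by
  set S := IntermediateField.adjoin L (Set.range (algebraMap R E ∘ x)) with hS
  have h1 : ∀ a : R, algebraMap R E a ∈ S := fun a => by
    have : (⊤ : Subalgebra L R) ≤ S.toSubalgebra.comap (IsScalarTower.toAlgHom L R E) := by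
      rw [← hx, Algebra.adjoin_le_iff]
      rintro _ ⟨i, rfl⟩
      exact IntermediateField.subset_adjoin L _ ⟨i, rfl⟩
    exact this (x := a) trivial
  rw [eq_top_iff]
  intro z _
  obtain ⟨a, b, -, rfl⟩ := IsFractionRing.div_surjective R z
  exact div_mem (h1 a) (h1 b)

theorem adjoin_ratVar (L : Type*) [Field L] (n : ℕ) :
    IntermediateField.adjoin L (Set.range (ratVar (n := n) L)) = ⊤ :=
  adjoin_range_algebraMap_comp_X L (Fin n) (MvPolynomial (Fin n) L) (RatField n L)
    MvPolynomial.X MvPolynomial.adjoin_range_X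

theorem isRational_ratField {L : Type*} [Field L] [Algebra k L] (hL : IsRational k L) (n : ℕ) :
    IsRational k (RatField n L) := by
  obtain ⟨m, ⟨e⟩⟩ := hL
  set y : Fin m → L := e.symm ∘ ratVar k with hy
  have h1 : AlgebraicIndependent k y :=
    (algebraicIndependent_ratVar k m).map' (f := e.symm.toAlgHom) e.symm.injective
  have h2 : IntermediateField.adjoin k (Set.range y) = ⊤ := by
    have := congrArg (IntermediateField.map e.symm.toAlgHom) (adjoin_ratVar k m)
    rw [IntermediateField.adjoin_map, ← Set.range_comp] at this
    rw [hy]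
    refine this.trans ?_
    rw [← AlgHom.fieldRange_eq_map, AlgHom.fieldRange_eq_top]
    exact e.symm.surjective
  have h3 := adjoin_sumElim_eq_top (k := k) y (ratVar L) h2 (adjoin_ratVar L n)
  have h4 : AlgebraicIndependent k
      (Sum.elim (ratVar (n := n) L) (algebraMap L (RatField n L) ∘ y)) :=
    h1.sumElim_comp (algebraicIndependent_ratVar L n)
  have h5 := h4.comp finSumFinEquiv.symm finSumFinEquiv.symm.injective
  have := isRational_of_adjoin_eq ⊤ _ h5 (by
    rw [← h3, Set.range_comp _ finSumFinEquiv.symm, finSumFinEquiv.symm.range_eq_univ,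
      Set.image_univ])
  exact isRational_congr IntermediateField.topEquiv this

theorem trdeg_eq_of_algebraicIndependent {L E : Type*} [Field L] [Field E] [Algebra L E]
    {ι : Type*} [Fintype ι] (t : ι → E) (h : AlgebraicIndependent L t)
    (ht : IntermediateField.adjoin L (Set.range t) = ⊤) : Algebra.trdeg L E = Fintype.card ι := by
  have : Algebra.IsAlgebraic (IntermediateField.adjoin L (Set.range t)) E := by
    rw [ht]
    exact ⟨fun a => isAlgebraic_algebraMap (⟨a, trivial⟩ : (⊤ : IntermediateField L E))⟩
  have := (h.isTranscendenceBasis_iff_isAlgebraic).2 (IntermediateField.isAlgebraic_adjoin_iff_top.1 this)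
  have := this.lift_cardinalMk_eq_trdeg
  simpa using this.symm

end RatField

end

/-! ### Function fields of representations and the no-name lemma -/

section

open Module

theorem exists_algHom_of_algebraicIndependent {k K E : Type*} [Field k] [Field K] [Field E] [Algebra k K]
    [Algebra k E] {ι : Type*} {x : ι → K} {y : ι → E} (hx : AlgebraicIndependent k x)
    (hxK : IntermediateField.adjoin k (Set.range x) = ⊤) (hy : AlgebraicIndependent k y) :
    ∃ φ : K →ₐ[k] E, ∀ i, φ (x i) = y i := by
  let e : K →ₐ[k] IntermediateField.adjoin k (Set.range x) :=
    (AlgHom.id k K).codRestrict (IntermediateField.adjoin k (Set.range x)).toSubalgebra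
      fun a => by
        change a ∈ IntermediateField.adjoin k (Set.range x)
        rw [hxK]; trivial
  refine ⟨(IntermediateField.val (IntermediateField.adjoin k (Set.range y))).comp
    ((hy.aevalEquivField : _ →ₐ[k] _).comp
      ((hx.aevalEquivField.symm : _ →ₐ[k] FractionRing (MvPolynomial ι k)).comp e)), fun i => ?_⟩
  have h : hx.aevalEquivField.symm (e (x i)) =
      algebraMap (MvPolynomial ι k) (FractionRing (MvPolynomial ι k)) (MvPolynomial.X i) := by
    rw [AlgEquiv.symm_apply_eq]
    apply Subtype.ext
    rw [AlgebraicIndependent.aevalEquivField_algebraMap_apply_coe, MvPolynomial.aeval_X]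
    rfl
  change ((hy.aevalEquivField (hx.aevalEquivField.symm (e (x i))) :
    IntermediateField.adjoin k (Set.range y)) : E) = y i
  rw [h, AlgebraicIndependent.aevalEquivField_algebraMap_apply_coe, MvPolynomial.aeval_X]

/-- `E` is the field of rational functions on `V`, in which the linear forms on `V` are embedded
by `l`. -/
structure IsFunField {k V E : Type*} [Field k] [AddCommGroup V] [Module k V] [Field E]
    [Algebra k E] (l : Dual k V →ₗ[k] E) : Prop where
  algebraicIndependent : ∀ {n : ℕ} (f : Fin n → Dual k V), LinearIndependent k f →
    AlgebraicIndependent k (fun i => l (f i))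
  adjoin_range : IntermediateField.adjoin k (Set.range l) = ⊤

section FunField

variable (k V E : Type*) [Field k] [AddCommGroup V] [Module k V] [Field E] [Algebra k E]
  [Algebra (SymmetricAlgebra k (Dual k V)) E] [IsScalarTower k (SymmetricAlgebra k (Dual k V)) E]

/-- The inclusion of the linear forms on `V` into an algebra over the polynomial functions. -/
def linFormMap : Dual k V →ₗ[k] E :=
  (IsScalarTower.toAlgHom k (SymmetricAlgebra k (Dual k V)) E).toLinearMap ∘ₗ
    SymmetricAlgebra.ι k (Dual k V)

variable [IsFractionRing (SymmetricAlgebra k (Dual k V)) E]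

theorem algebraicIndependent_linFormMap_basis {ι : Type*} (b : Basis ι k (Dual k V)) :
    AlgebraicIndependent k (fun i => linFormMap k V E (b i)) := by
  have h1 := (MvPolynomial.algebraicIndependent_X ι k).map'
    (f := (SymmetricAlgebra.equivMvPolynomial b).symm.toAlgHom)
    (SymmetricAlgebra.equivMvPolynomial b).symm.injective
  have h2 := h1.map' (f := IsScalarTower.toAlgHom k (SymmetricAlgebra k (Dual k V)) E)
    (IsFractionRing.injective _ _)
  convert h2 using 2 with i
  simp [linFormMap]

theorem isFunField_linFormMap : IsFunField (linFormMap k V E) where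
  algebraicIndependent f hf := by
    have h := algebraicIndependent_linFormMap_basis k V E (Basis.sumExtend hf)
    have := h.comp Sum.inl Sum.inl_injective
    convert this using 2 with i
    simp [Basis.sumExtend]
    rfl
  adjoin_range := by
    refine adjoin_range_algebraMap_comp_X k _ (SymmetricAlgebra k (Dual k V)) E
      (SymmetricAlgebra.ι k (Dual k V)) ?_
    rw [eq_top_iff]
    rintro a -
    induction a using SymmetricAlgebra.induction with
    | algebraMap r => exact Subalgebra.algebraMap_mem _ r
    | ι l => exact Algebra.subset_adjoin ⟨l, rfl⟩
    | mul a b ha hb => exact mul_mem ha hb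
    | add a b ha hb => exact add_mem ha hb

end FunField

theorem isFunField_funField (k V : Type*) [Field k] [AddCommGroup V] [Module k V] :
    IsFunField (linFormMap k V (FunField k V)) := isFunField_linFormMap k V (FunField k V)

namespace IsFunField

variable {k V E : Type*} [Field k] [AddCommGroup V] [Module k V] [Field E] [Algebra k E]
  {l : Dual k V →ₗ[k] E} (hl : IsFunField l)

include hl

theorem injective : Function.Injective l := by
  rw [injective_iff_map_eq_zero]
  intro f hf
  by_contra h0
  have h := hl.algebraicIndependent (n := 1) (fun _ => f)
    (LinearIndependent.of_subsingleton 0 h0)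
  exact h.ne_zero 0 hf

theorem adjoin_span {ι : Type*} {f : ι → Dual k V} (hf : Submodule.span k (Set.range f) = ⊤) :
    IntermediateField.adjoin k (Set.range fun i => l (f i)) = ⊤ := by
  rw [← hl.adjoin_range]
  refine le_antisymm (IntermediateField.adjoin.mono _ _ _ ?_) ?_
  · rintro _ ⟨i, rfl⟩
    exact ⟨f i, rfl⟩
  · rw [IntermediateField.adjoin_le_iff]
    rintro _ ⟨g, rfl⟩
    have : (⊤ : Submodule k (Dual k V)) ≤ (IntermediateField.adjoin k
        (Set.range fun i => l (f i))).toSubalgebra.toSubmodule.comap l := by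
      rw [← hf, Submodule.span_le]
      rintro _ ⟨i, rfl⟩
      exact IntermediateField.subset_adjoin _ _ ⟨i, rfl⟩
    exact this (x := g) trivial

theorem algHom_ext {E' : Type*} [Field E'] [Algebra k E'] {φ ψ : E →ₐ[k] E'}
    (h : ∀ f, φ (l f) = ψ (l f)) : φ = ψ := by
  have : (⊤ : IntermediateField k E).toSubalgebra ≤ AlgHom.equalizer φ ψ := by
    have h1 : (⊤ : IntermediateField k E) ≤
        { AlgHom.equalizer φ ψ with
          inv_mem' := fun x hx => by
            change φ x⁻¹ = ψ x⁻¹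
            rw [map_inv₀, map_inv₀, show φ x = ψ x from hx] } := by
      rw [← hl.adjoin_range, IntermediateField.adjoin_le_iff]
      rintro _ ⟨f, rfl⟩
      exact h f
    exact h1
  exact AlgHom.ext fun a => this (x := a) trivial

theorem trdeg_eq [FiniteDimensional k V] : Algebra.trdeg k E = finrank k V := by
  have b := finBasis k (Dual k V)
  rw [trdeg_eq_of_algebraicIndependent _ (hl.algebraicIndependent b b.linearIndependent)
    (hl.adjoin_span b.span_eq), Fintype.card_fin, Subspace.dual_finrank_eq]

/-- Linear forms embed in the function field and separate vectors, so a group element acting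
trivially on functions acts trivially on `V`. -/
theorem action_injective {G : Type*} [Group G] {ρ : Representation k G V}
    {β : G →* (E ≃ₐ[k] E)} (hβ : ∀ g f, β g (l f) = l (f ∘ₗ ρ g⁻¹))
    (hρ : Function.Injective ρ) : Function.Injective β := by
  rw [injective_iff_map_eq_one]
  intro g hg
  have h1 : ∀ f : Dual k V, f ∘ₗ ρ g⁻¹ = f := fun f => hl.injective (by
    rw [← hβ, hg]; rfl)
  have h2 : ρ g⁻¹ = 1 := by
    ext v
    rw [← sub_eq_zero, ← forall_dual_apply_eq_zero_iff k]
    intro f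
    rw [map_sub, sub_eq_zero]
    exact LinearMap.congr_fun (h1 f) v
  rw [← inv_eq_one]
  exact hρ (h2.trans (map_one ρ).symm)

theorem exists_algHom [FiniteDimensional k V] {V' E' : Type*} [AddCommGroup V'] [Module k V']
    [Field E'] [Algebra k E'] {l' : Dual k V' →ₗ[k] E'} (hl' : IsFunField l') (L : V' →ₗ[k] V)
    (hL : Function.Surjective L) :
    ∃ φ : E →ₐ[k] E', ∀ f, φ (l f) = l' (f ∘ₗ L) := by
  let b := finBasis k (Dual k V)
  have hinj : Function.Injective L.dualMap := LinearMap.dualMap_injective_of_surjective hL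
  have hli : LinearIndependent k fun i => b i ∘ₗ L :=
    b.linearIndependent.map' L.dualMap (LinearMap.ker_eq_bot.2 hinj)
  obtain ⟨φ, hφ⟩ := FreeCentral.exists_algHom_of_algebraicIndependent
    (hl.algebraicIndependent b b.linearIndependent) (hl.adjoin_span b.span_eq)
    (hl'.algebraicIndependent _ hli)
  refine ⟨φ, fun f => ?_⟩
  have h : φ.toLinearMap ∘ₗ l = l' ∘ₗ L.dualMap := b.ext hφ
  exact LinearMap.congr_fun h f

end IsFunField

section Span

variable {k K E : Type*} [Field k] [Field K] [Field E] [Algebra k K] [Algebra k E] [Algebra K E]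

/-- Speiser's lemma (Hilbert 90 for `GL m`). If the invariants did not span, a functional killing
all of them but not some `u` would kill the traces of all multiples `a • u`; linear independence of
the automorphisms `σ g` excludes this. -/
theorem exists_invariant_span {F : Type*} [Group F] [Finite F] (σ : F →* (K ≃ₐ[k] K))
    (hσ : Function.Injective σ) (β : F →* (E ≃ₐ[k] E))
    (heq : ∀ g f, β g (algebraMap K E f) = algebraMap K E (σ g f)) {m : ℕ} (w : Fin m → E)
    (hw : LinearIndependent K w) (hstab : ∀ g j, β g (w j) ∈ Submodule.span K (Set.range w)) :
    ∃ t : Fin m → E, (∀ g i, β g (t i) = t i) ∧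
      Submodule.span K (Set.range t) = Submodule.span K (Set.range w) := by
  have := Fintype.ofFinite F
  set U := Submodule.span K (Set.range w) with hU
  have hstab' : ∀ g, ∀ u ∈ U, β g u ∈ U := by
    intro g u hu
    induction hu using Submodule.span_induction with
    | mem x hx => obtain ⟨j, rfl⟩ := hx; exact hstab g j
    | zero => rw [map_zero]; exact zero_mem _
    | add x y _ _ hx hy => rw [map_add]; exact add_mem hx hy
    | smul a x _ hx => rw [Algebra.smul_def, map_mul, heq, ← Algebra.smul_def]
                       exact U.smul_mem _ hx
  set S : Set E := {u | u ∈ U ∧ ∀ g, β g u = u} with hS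
  have hspan : Submodule.span K S = U := by
    refine le_antisymm (Submodule.span_le.2 fun u hu => hu.1) fun u hu => ?_
    by_contra hcon
    obtain ⟨f, hfu, hf⟩ := Submodule.exists_le_ker_of_notMem hcon
    -- The orbit sum of `a • u` is invariant, hence killed by `f`; semilinearity turns this into a
    -- linear relation among the characters `σ g`.
    have htrace : ∀ a : K, ∑ g, f (β g u) * σ g a = 0 := by
      intro a
      have hmem : ∑ g, β g (a • u) ∈ S := by
        refine ⟨sum_mem fun g _ => hstab' g _ (U.smul_mem _ hu), fun h => ?_⟩
        rw [map_sum]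
        refine Fintype.sum_equiv (Equiv.mulLeft h) _ _ fun g => ?_
        simp [AlgEquiv.mul_apply]
      have h0 := hf (Submodule.subset_span hmem)
      rw [LinearMap.mem_ker, map_sum] at h0
      rw [← h0]
      refine Finset.sum_congr rfl fun g _ => ?_
      rw [Algebra.smul_def, map_mul, heq, ← Algebra.smul_def, map_smul, smul_eq_mul, mul_comm]
    have hli := (linearIndependent_monoidHom K K).comp
      (fun g : F => ((σ g : K ≃ₐ[k] K) : K →* K)) (fun g h hgh => hσ (by
        ext a; exact DFunLike.congr_fun hgh a))
    have h1 := Fintype.linearIndependent_iff.1 hli (fun g => f (β g u)) (by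
      ext a
      simpa [Finset.sum_apply] using htrace a) 1
    rw [map_one] at h1
    exact hfu h1
  -- A basis of the span is extracted from the invariant vectors themselves; it has `m` elements by
  -- dimension.
  obtain ⟨b, hbS, hbspan, hbli⟩ := exists_linearIndependent K S
  have hfin : FiniteDimensional K U := FiniteDimensional.span_of_finite K (Set.finite_range w)
  have hrank : finrank K U = m := by rw [hU, finrank_span_eq_card hw, Fintype.card_fin]
  rw [hspan] at hbspan
  let B : Basis b K U := (Basis.span hbli).map (LinearEquiv.ofEq _ _ (by simpa using hbspan))
  have : Fintype b := FiniteDimensional.fintypeBasisIndex B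
  let e : Fin m ≃ b := (Fintype.equivFinOfCardEq (by rw [← hrank, finrank_eq_card_basis B])).symm
  refine ⟨fun i => e i, fun g i => (hbS (e i).2).2 g, ?_⟩
  rw [← hbspan]
  congr 1
  change Set.range (Subtype.val ∘ e) = b
  rw [e.surjective.range_comp, Subtype.range_coe]

end Span

section NoName

variable {k : Type*} [Field k] {V W : Type*} [AddCommGroup V] [Module k V] [AddCommGroup W]
  [Module k W] [FiniteDimensional k V] [FiniteDimensional k W] {F : Type*} [Group F] [Finite F]

/-- The no-name lemma for a representation `V' = V ⊕ W`, with projections `L` and `M`. -/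
theorem IsFunField.nonempty_invariants_algEquiv_ratField {V' : Type*} [AddCommGroup V']
    [Module k V'] [FiniteDimensional k V'] (L : V' →ₗ[k] V) (hL : Function.Surjective L)
    (M : V' →ₗ[k] W) (hLM : Function.Bijective (L.prod M))
    (ρ : Representation k F V) (τ : Representation k F W) (ρ' : Representation k F V')
    (hρ : ∀ g, L ∘ₗ ρ' g = ρ g ∘ₗ L) (hτ : ∀ g, M ∘ₗ ρ' g = τ g ∘ₗ M)
    (hinj : Function.Injective ρ) (hinj' : Function.Injective ρ')
    {K E : Type*} [Field K] [Field E] [Algebra k K] [Algebra k E] {l : Dual k V →ₗ[k] K}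
    {l' : Dual k V' →ₗ[k] E} (hl : IsFunField l) (hl' : IsFunField l')
    (α : F →* (K ≃ₐ[k] K)) (β : F →* (E ≃ₐ[k] E)) (hα : ∀ g f, α g (l f) = l (f ∘ₗ ρ g⁻¹))
    (hβ : ∀ g f, β g (l' f) = l' (f ∘ₗ ρ' g⁻¹)) :
    Nonempty (Invariants β ≃ₐ[k] RatField (finrank k W) (Invariants α)) := by
  obtain ⟨φ, hφ⟩ := hl.exists_algHom hl' L hL
  let _ : Algebra K E := φ.toRingHom.toAlgebra
  have _ : IsScalarTower k K E := IsScalarTower.of_algebraMap_eq fun r => (φ.commutes r).symm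
  have b : Basis (Fin (finrank k W)) k (Dual k W) :=
    finBasisOfFinrankEq k (Dual k W) Subspace.dual_finrank_eq
  set w : Fin (finrank k W) → E := fun i => l' (b i ∘ₗ M) with hw
  have heq : ∀ g f, β g (algebraMap K E f) = algebraMap K E (α g f) := fun g f => by
    have : (β g : E →ₐ[k] E).comp φ = φ.comp (α g : K →ₐ[k] K) := by
      refine hl.algHom_ext fun f => ?_
      change β g (φ (l f)) = φ (α g (l f))
      rw [hφ, hα, hβ, hφ, LinearMap.comp_assoc, hρ, LinearMap.comp_assoc]
    exact DFunLike.congr_fun this f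
  have hfinrank : finrank k V' = finrank k V + finrank k W := by
    rw [(LinearEquiv.ofBijective _ hLM).finrank_eq, finrank_prod]
  have htr : Algebra.trdeg K E = finrank k W := by
    have h1 := lift_trdeg_add_eq k K E
    rw [hl.trdeg_eq, hl'.trdeg_eq, hfinrank] at h1
    simp only [Cardinal.lift_add, Cardinal.lift_natCast, Nat.cast_add] at h1
    have h2 := Cardinal.eq_of_add_eq_add_left h1 (Cardinal.natCast_lt_aleph0)
    simpa using h2
  have hspan : ∀ f : Dual k V', ∃ f₁ : Dual k V, ∃ f₂ : Dual k W, f = f₁ ∘ₗ L + f₂ ∘ₗ M := by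
    intro f
    let e := LinearEquiv.ofBijective _ hLM
    refine ⟨f ∘ₗ e.symm ∘ₗ LinearMap.inl k V W, f ∘ₗ e.symm ∘ₗ LinearMap.inr k V W, ?_⟩
    ext v
    have h2 : v = e.symm (L v, M v) := (e.symm_apply_apply v).symm
    conv_lhs => rw [h2]
    simp [← map_add]
  have hadj : IntermediateField.adjoin K (Set.range w) = ⊤ := by
    set S := IntermediateField.adjoin K (Set.range w) with hS
    have h1 : ∀ f : Dual k W, l' (f ∘ₗ M) ∈ S := fun f => by
      have : (⊤ : Submodule k (Dual k W)) ≤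
          (S.restrictScalars k).toSubalgebra.toSubmodule.comap (l' ∘ₗ M.dualMap) := by
        rw [← b.span_eq, Submodule.span_le]
        rintro _ ⟨i, rfl⟩
        exact IntermediateField.subset_adjoin _ _ ⟨i, rfl⟩
      exact this (x := f) trivial
    have h2 : (⊤ : IntermediateField k E) ≤ S.restrictScalars k := by
      rw [← hl'.adjoin_range, IntermediateField.adjoin_le_iff]
      rintro _ ⟨f, rfl⟩
      obtain ⟨f₁, f₂, rfl⟩ := hspan f
      change l' (f₁ ∘ₗ L + f₂ ∘ₗ M) ∈ S
      rw [map_add]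
      refine add_mem ?_ (h1 f₂)
      rw [← hφ]
      exact S.algebraMap_mem (l f₁)
    exact eq_top_iff.2 fun a _ => h2 (x := a) trivial
  have hw : AlgebraicIndependent K w := by
    have : Algebra.IsAlgebraic (IntermediateField.adjoin K (Set.range w))
        E := by
      rw [hadj]
      exact ⟨fun a => isAlgebraic_algebraMap
        (⟨a, trivial⟩ : (⊤ : IntermediateField K E))⟩
    exact algebraicIndependent_of_trdeg w htr
  -- The coordinates `w` on the complement are permuted up to `k`-linear combinations, so their
  -- `K`-span is stable and can be given an invariant basis `t`. Since `K(t) = K(w) = E`, descent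
  -- applies with `N = 1`.
  obtain ⟨t, ht, htw⟩ := exists_invariant_span α (hl.action_injective hα hinj)
    β heq w hw.linearIndependent (fun g j => by
      have h1 : β g (w j) = l' (M.dualMap (b j ∘ₗ τ g⁻¹)) := by
        rw [hβ, LinearMap.comp_assoc, hτ]; rfl
      rw [h1, ← b.sum_repr (b j ∘ₗ τ g⁻¹), map_sum, map_sum]
      refine sum_mem fun i _ => ?_
      rw [map_smul, map_smul, ← algebraMap_smul K]
      exact Submodule.smul_mem _ _ (Submodule.subset_span ⟨i, rfl⟩))
  refine FreeCentral.nonempty_invariants_algEquiv_ratField α (hl.action_injective hα hinj)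
    β (hl'.action_injective hβ hinj') (MonoidHom.id F) heq htr t ht (N := 1) ?_ (by simp)
  refine rank_le_one_of_top_le _ fun a _ => ?_
  have h3 : (⊤ : IntermediateField K E) ≤
      IntermediateField.adjoin K (Set.range t) := by
    rw [← hadj, IntermediateField.adjoin_le_iff]
    rintro _ ⟨i, rfl⟩
    have h4 : w i ∈ Submodule.span K (Set.range t) := by
      rw [htw]; exact Submodule.subset_span ⟨i, rfl⟩
    have h5 : Submodule.span K (Set.range t) ≤
        (IntermediateField.adjoin K (Set.range t)).toSubalgebra.toSubmodule :=
      Submodule.span_le.2 (IntermediateField.subset_adjoin _ _)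
    exact h5 h4
  exact h3 (x := a) trivial

/-- If some faithful representation has a rational quotient, then the quotient of every faithful
representation is stably rational. -/
theorem isStablyRational_quotFunField (ρ : Representation k F V) (τ : Representation k F W)
    (hρ : Function.Injective ρ) (hτ : Function.Injective τ)
    (hrat : IsRational k (QuotFunField τ)) : IsStablyRational k (QuotFunField ρ) := by
  have hinj : Function.Injective (ρ.prod τ) := fun g h hgh => hρ (by
    ext v
    have := congrArg Prod.fst (LinearMap.congr_fun hgh (v, 0))
    exact this)
  -- The invariants of `V × W` are computed twice, by projecting to `V` and to `W`.
  obtain ⟨e₁⟩ := IsFunField.nonempty_invariants_algEquiv_ratField (LinearMap.fst k V W)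
    LinearMap.fst_surjective (LinearMap.snd k V W)
    Function.bijective_id ρ τ (ρ.prod τ)
    (fun g => rfl) (fun g => rfl) hρ hinj (isFunField_funField k V)
    (isFunField_funField k (V × W)) (funAction ρ) (funAction (ρ.prod τ))
    (funAction_linForm ρ) (funAction_linForm (ρ.prod τ))
  obtain ⟨e₂⟩ := IsFunField.nonempty_invariants_algEquiv_ratField (LinearMap.snd k V W)
    LinearMap.snd_surjective (LinearMap.fst k V W)
    Prod.swap_bijective τ ρ (ρ.prod τ)
    (fun g => rfl) (fun g => rfl) hτ hinj (isFunField_funField k W)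
    (isFunField_funField k (V × W)) (funAction τ) (funAction (ρ.prod τ))
    (funAction_linForm τ) (funAction_linForm (ρ.prod τ))
  exact ⟨finrank k W, isRational_congr (e₂.symm.trans e₁) (isRational_ratField hrat _)⟩

end NoName

end

section

open Module

/-! ### The exterior square in coordinates -/

section ExteriorSquare

/-- The pairing `(a, b) ↦ f a * g b - f b * g a` as an alternating map. -/
def minorMap {A R : Type*} [AddCommGroup A] [CommRing R] (f g : A →+ R) :
    A [⋀^Fin 2]→ₗ[ℤ] R where
  toFun m := f (m 0) * g (m 1) - f (m 1) * g (m 0)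
  map_update_add' := by
    intro inst m i a b
    rw [Subsingleton.elim inst (instDecidableEqFin 2)]
    fin_cases i <;> simp <;> ring
  map_update_smul' := by
    intro inst m i c a
    rw [Subsingleton.elim inst (instDecidableEqFin 2)]
    fin_cases i <;> simp <;> ring
  map_eq_zero_of_eq' := by
    intro m i j h hij
    fin_cases i <;> fin_cases j <;> simp at hij h ⊢ <;> rw [h] <;> ring

theorem ιMulti_two_swap {A : Type*} [AddCommGroup A] (a b : A) :
    exteriorPower.ιMulti ℤ 2 ![a, b] = - exteriorPower.ιMulti ℤ 2 ![b, a] := by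
  have := (exteriorPower.ιMulti ℤ 2 (M := A)).map_swap ![b, a] (i := 0) (j := 1) (by decide)
  rw [← this]
  congr 1
  ext i
  fin_cases i <;> rfl

/-- The maps `s` and `t` choose an orientation of every two-element subset of `ι`, each occurring
once. Minors map out of the exterior square, wedges of basis vectors map back, and both are checked
on generators. Free orientations permit the cyclic order `(i + 1, i + 2)` in rank three. -/
theorem exists_exteriorSquare_addEquiv {ℓ : ℕ} {A : Type*} [AddCommGroup A] [Module (ZMod ℓ) A]
    {ι κ : Type*} [Finite ι] [LinearOrder ι] (b : Basis ι (ZMod ℓ) A) (s t : κ → ι)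
    (hst : Function.Injective fun a => s(s a, t a))
    (hne : ∀ a, s a ≠ t a) (hex : ∀ i j, i ≠ j → ∃ a, s(s a, t a) = s(i, j)) :
    ∃ Θ : ⋀[ℤ]^2 A ≃+ (κ → ZMod ℓ), ∀ x y a, Θ (exteriorPower.ιMulti ℤ 2 ![x, y]) a =
      b.repr x (s a) * b.repr y (t a) - b.repr y (s a) * b.repr x (t a) := by
  classical
  have := Fintype.ofFinite ι
  have : Finite κ := Finite.of_injective _ hst
  have := Fintype.ofFinite κ
  let co : ι → A →+ ZMod ℓ := fun i => (b.coord i).toAddMonoidHom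
  let Φ : ⋀[ℤ]^2 A →ₗ[ℤ] (κ → ZMod ℓ) := LinearMap.pi fun a =>
    exteriorPower.alternatingMapLinearEquiv (minorMap (co (s a)) (co (t a)))
  have hΦ : ∀ x y a, Φ (exteriorPower.ιMulti ℤ 2 ![x, y]) a =
      b.repr x (s a) * b.repr y (t a) - b.repr y (s a) * b.repr x (t a) := by
    intro x y a
    simp only [Φ, LinearMap.pi_apply, exteriorPower.alternatingMapLinearEquiv_apply_ιMulti]
    rfl
  have htors : ∀ x : A, (ℓ : ℤ) • x = 0 := fun x => by
    rw [← Int.cast_smul_eq_zsmul (ZMod ℓ)]; simp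
  let w : κ → ⋀[ℤ]^2 A := fun a => exteriorPower.ιMulti ℤ 2 ![b (s a), b (t a)]
  have hw : ∀ a, (ℓ : ℤ) • w a = 0 := fun a => by
    have h := (exteriorPower.ιMulti ℤ 2 (M := A)).map_update_smul ![b (s a), b (t a)] 0 (ℓ : ℤ)
      (b (s a))
    have h2 : Function.update ![b (s a), b (t a)] 0 (b (s a)) = ![b (s a), b (t a)] :=
      Function.update_eq_self _ _
    rw [h2, htors, AlternatingMap.map_update_zero] at h
    exact h.symm
  -- The exterior square is taken over `ℤ`, so a map out of `ZMod ℓ` exists only because `ℓ` kills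
  -- each wedge (`hw`).
  let Ψ : (κ → ZMod ℓ) →+ ⋀[ℤ]^2 A := ∑ a,
    (ZMod.lift ℓ ⟨(zmultiplesHom _ (w a)), by simpa using hw a⟩).comp (Pi.evalAddMonoidHom _ a)
  have hΨ : ∀ a, Ψ (Pi.single a 1) = w a := by
    intro a
    simp only [Ψ, AddMonoidHom.finsetSum_apply, AddMonoidHom.comp_apply, Pi.evalAddMonoidHom_apply]
    rw [Finset.sum_eq_single a]
    · have := ZMod.lift_coe ℓ (⟨(zmultiplesHom _ (w a)), by simpa using hw a⟩ :
        {f : ℤ →+ ⋀[ℤ]^2 A // f ℓ = 0}) 1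
      simpa using this
    · intro c _ hc
      rw [Pi.single_eq_of_ne hc, map_zero]
    · simp
  have hΦw : ∀ a, Φ (w a) = Pi.single a 1 := by
    intro a
    ext c
    rw [hΦ]
    by_cases hc : c = a
    · subst hc
      simp [hne c, (hne c).symm]
    · have h1 : s(s c, t c) ≠ s(s a, t a) := fun h => hc (hst h)
      rw [Ne, Sym2.eq_iff] at h1
      push Not at h1
      rw [Pi.single_eq_of_ne hc]
      simp only [Basis.repr_self, Finsupp.single_apply]
      split_ifs <;> simp_all
  have h1 : ∀ v, Φ (Ψ v) = v := by
    intro v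
    have : Φ.toAddMonoidHom.comp Ψ = AddMonoidHom.id _ := by
      refine AddMonoidHom.functions_ext _ _ _ fun a c => ?_
      obtain ⟨n, rfl⟩ := ZMod.intCast_surjective c
      have h3 : (Pi.single a (n : ZMod ℓ) : κ → ZMod ℓ) = n • Pi.single a 1 := by
        rw [← Pi.single_smul, zsmul_one]
      rw [h3, map_zsmul, map_zsmul]
      congr 1
      change Φ (Ψ _) = _
      rw [hΨ, hΦw]
      rfl
    exact DFunLike.congr_fun this v
  have hspan : Submodule.span ℤ (Set.range b) = ⊤ := by
    rw [eq_top_iff]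
    intro x _
    rw [← b.sum_repr x]
    refine sum_mem fun i _ => ?_
    obtain ⟨n, hn⟩ := ZMod.intCast_surjective (b.repr x i)
    rw [← hn, Int.cast_smul_eq_zsmul]
    exact Submodule.smul_mem _ _ (Submodule.subset_span ⟨i, rfl⟩)
  have h2 : ∀ x, ∃ v, Ψ v = x := by
    have h3 : (⊤ : Submodule ℤ (⋀[ℤ]^2 A)) ≤ Ψ.toIntLinearMap.range := by
      rw [← exteriorPower.ιMulti_span_of_span (R := ℤ) (n := 2) (M := A) hspan,
        Submodule.span_le]
      rintro _ ⟨m, hm, rfl⟩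
      obtain ⟨i, hi⟩ := hm ⟨0, rfl⟩
      obtain ⟨j, hj⟩ := hm ⟨1, rfl⟩
      have hm' : m = ![b i, b j] := by
        ext r; fin_cases r <;> simp [hi, hj]
      rw [hm']
      by_cases hij : i = j
      · subst hij
        rw [(exteriorPower.ιMulti ℤ 2 (M := A)).map_eq_zero_of_eq ![b i, b i] (i := 0) (j := 1)
          rfl (by decide)]
        exact zero_mem _
      · obtain ⟨a, ha⟩ := hex i j hij
        rcases Sym2.eq_iff.1 ha with ⟨rfl, rfl⟩ | ⟨rfl, rfl⟩
        · exact ⟨Pi.single a 1, hΨ a⟩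
        · rw [ιMulti_two_swap]
          exact neg_mem ⟨Pi.single a 1, hΨ a⟩
    exact fun x => h3 (x := x) trivial
  have h3 : Function.Bijective Φ.toAddMonoidHom := by
    refine ⟨fun x y hxy => ?_, fun v => ⟨Ψ v, h1 v⟩⟩
    obtain ⟨v, rfl⟩ := h2 x
    obtain ⟨v', rfl⟩ := h2 y
    have : Φ (Ψ v) = Φ (Ψ v') := hxy
    rw [h1, h1] at this
    rw [this]
  exact ⟨AddEquiv.ofBijective Φ.toAddMonoidHom h3, hΦ⟩

end ExteriorSquare

section FreeCentralExtension

variable {F A : Type*} [Group F] [AddCommGroup A] {π : F →* Multiplicative A}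

/-- Replaces the abstract exterior square by a concrete group `B` with an explicit pairing, the form
in which the definition is used and verified below. -/
theorem isFreeCentralExtension_iff {B : Type*} [AddCommGroup B] (Θ : ⋀[ℤ]^2 A ≃+ B)
    (ω : A → A → B) (hΘ : ∀ x y, Θ (exteriorPower.ιMulti ℤ 2 ![x, y]) = ω x y) :
    IsFreeCentralExtension π ↔ Function.Surjective π ∧ π.ker ≤ Subgroup.center F ∧
      ∃ κ : B ≃+ Additive π.ker, ∀ g h : F,
        ((κ (ω (π g).toAdd (π h).toAdd)).toMul : F) = g * h * g⁻¹ * h⁻¹ := by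
  constructor
  · rintro ⟨h1, h2, c, hc⟩
    refine ⟨h1, h2, Θ.symm.trans c, fun g h => ?_⟩
    rw [← hΘ, ← hc]
    simp
  · rintro ⟨h1, h2, κ, hκ⟩
    refine ⟨h1, h2, Θ.trans κ, fun g h => ?_⟩
    rw [← hκ, ← hΘ]
    rfl

theorem exists_exteriorSquare_addEquiv_two {ℓ : ℕ} {A : Type*} [AddCommGroup A]
    [Module (ZMod ℓ) A] (b : Basis (Fin 2) (ZMod ℓ) A) :
    ∃ Θ : ⋀[ℤ]^2 A ≃+ ZMod ℓ, ∀ x y, Θ (exteriorPower.ιMulti ℤ 2 ![x, y]) =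
      b.repr x 0 * b.repr y 1 - b.repr y 0 * b.repr x 1 := by
  obtain ⟨Θ, hΘ⟩ := exists_exteriorSquare_addEquiv b (κ := Unit) (fun _ => 0) (fun _ => 1)
    (fun _ _ _ => rfl) (fun _ => by decide) (fun i j hij => ⟨(), by revert i j; decide⟩)
  exact ⟨Θ.trans (AddEquiv.piUnique fun _ : Unit => ZMod ℓ), fun x y => hΘ x y ()⟩

theorem exists_exteriorSquare_addEquiv_three {A : Type*} [AddCommGroup A]
    [Module (ZMod 2) A] (b : Basis (Fin 3) (ZMod 2) A) :
    ∃ Θ : ⋀[ℤ]^2 A ≃+ (Fin 3 → ZMod 2), ∀ x y, Θ (exteriorPower.ιMulti ℤ 2 ![x, y]) =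
      fun i => b.repr x (i + 1) * b.repr y (i + 2) - b.repr y (i + 1) * b.repr x (i + 2) := by
  obtain ⟨Θ, hΘ⟩ := exists_exteriorSquare_addEquiv b (κ := Fin 3) (fun i => i + 1) (fun i => i + 2)
    (by decide) (by decide) (by decide)
  exact ⟨Θ, fun x y => funext fun i => hΘ x y i⟩

end FreeCentralExtension

/-! ### The Heisenberg group as a free central extension -/

section Heisenberg

/-- The unitriangular matrix with entries `a`, `b` above the diagonal and `c` in the corner. -/
def heisenbergMatrix {R : Type*} [CommRing R] (a b c : R) : Matrix.SpecialLinearGroup (Fin 3) R :=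
  ⟨!![1, a, c; 0, 1, b; 0, 0, 1], by simp [Matrix.det_fin_three]⟩

theorem exists_isFreeCentralExtension_heisenberg (ℓ : ℕ) :
    ∃ p : Heisenberg (ZMod ℓ) →* Multiplicative (ZMod ℓ × ZMod ℓ), IsFreeCentralExtension p := by
  have hz : ∀ (M : Heisenberg (ZMod ℓ)), M.1 0 0 = 1 ∧ M.1 1 1 = 1 ∧ M.1 2 2 = 1 ∧ M.1 1 0 = 0 ∧
      M.1 2 0 = 0 ∧ M.1 2 1 = 0 := fun M =>
    ⟨M.2.1 0, M.2.1 1, M.2.1 2, M.2.2 1 0 (by decide), M.2.2 2 0 (by decide), M.2.2 2 1 (by decide)⟩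
  have hmul : ∀ (M N : Heisenberg (ZMod ℓ)), (M * N).1 0 1 = M.1 0 1 + N.1 0 1 ∧
      (M * N).1 1 2 = M.1 1 2 + N.1 1 2 ∧
      (M * N).1 0 2 = M.1 0 2 + M.1 0 1 * N.1 1 2 + N.1 0 2 := by
    intro M N
    obtain ⟨a1, a2, a3, a4, a5, a6⟩ := hz M
    obtain ⟨b1, b2, b3, b4, b5, b6⟩ := hz N
    simp [Matrix.mul_apply, Fin.sum_univ_three, *]
    refine ⟨by ring, by ring, by ring⟩
  have hext : ∀ (M N : Heisenberg (ZMod ℓ)), M.1 0 1 = N.1 0 1 → M.1 1 2 = N.1 1 2 →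
      M.1 0 2 = N.1 0 2 → M = N := by
    intro M N h1 h2 h3
    obtain ⟨a1, a2, a3, a4, a5, a6⟩ := hz M
    obtain ⟨b1, b2, b3, b4, b5, b6⟩ := hz N
    ext i j
    fin_cases i <;> fin_cases j <;> simp_all
  let p : Heisenberg (ZMod ℓ) →* Multiplicative (ZMod ℓ × ZMod ℓ) :=
    MonoidHom.mk' (fun M => Multiplicative.ofAdd (M.1 0 1, M.1 1 2)) (fun M N => by
      rw [(hmul M N).1, (hmul M N).2.1]; rfl)
  let m : ZMod ℓ → ZMod ℓ → ZMod ℓ → Heisenberg (ZMod ℓ) := fun a b c =>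
    ⟨heisenbergMatrix a b c, by
      refine ⟨fun i => ?_, fun i j h => ?_⟩
      · fin_cases i <;> simp [heisenbergMatrix]
      · fin_cases i <;> fin_cases j <;> simp [heisenbergMatrix] at h ⊢⟩
  have hm : ∀ a b c, (m a b c).1 0 1 = a ∧ (m a b c).1 1 2 = b ∧ (m a b c).1 0 2 = c :=
    fun a b c => ⟨rfl, rfl, rfl⟩
  have hker : ∀ M : Heisenberg (ZMod ℓ), M ∈ p.ker ↔ M.1 0 1 = 0 ∧ M.1 1 2 = 0 := fun M => by
    rw [MonoidHom.mem_ker]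
    exact Prod.ext_iff
  obtain ⟨Θ, hΘ⟩ := exists_exteriorSquare_addEquiv_two (Basis.finTwoProd (ZMod ℓ))
  refine ⟨p, (isFreeCentralExtension_iff Θ _ hΘ).2 ⟨fun a => ⟨m a.toAdd.1 a.toAdd.2 0, rfl⟩, ?_, ?_⟩⟩
  · intro M hM
    rw [hker] at hM
    rw [Subgroup.mem_center_iff]
    intro N
    apply hext
    · rw [(hmul N M).1, (hmul M N).1, add_comm]
    · rw [(hmul N M).2.1, (hmul M N).2.1, add_comm]
    · rw [(hmul N M).2.2, (hmul M N).2.2, hM.1, hM.2]; ring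
  · let κ : ZMod ℓ ≃+ Additive p.ker :=
      { toFun := fun c => Additive.ofMul ⟨m 0 0 c, (hker _).2 ⟨rfl, rfl⟩⟩
        invFun := fun M => M.toMul.1.1 0 2
        left_inv := fun c => rfl
        right_inv := fun M => by
          obtain ⟨h1, h2⟩ := (hker M.toMul.1).1 M.toMul.2
          exact Additive.toMul.injective (Subtype.ext (hext _ _ h1.symm h2.symm rfl))
        map_add' := fun c d => by
          refine Additive.toMul.injective (Subtype.ext (hext _ _ ?_ ?_ ?_))
          · refine Eq.trans ?_ (hmul (m 0 0 c) (m 0 0 d)).1.symm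
            simp [hm]
          · refine Eq.trans ?_ (hmul (m 0 0 c) (m 0 0 d)).2.1.symm
            simp [hm]
          · refine Eq.trans ?_ (hmul (m 0 0 c) (m 0 0 d)).2.2.symm
            simp [hm] }
    refine ⟨κ, fun g h => ?_⟩
    -- In the form `κ * h * g = g * h` the commutator identity involves no inverse matrices and can
    -- be compared entry by entry.
    rw [eq_mul_inv_iff_mul_eq, eq_mul_inv_iff_mul_eq]
    have hκ : ∀ c, ((κ c).toMul : Heisenberg (ZMod ℓ)) = m 0 0 c := fun c => rfl
    have hp : ∀ g, (p g).toAdd = (g.1 0 1, g.1 1 2) := fun g => rfl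
    rw [hκ, hp, hp]
    apply hext
    · simp only [hmul, hm]; ring
    · simp only [hmul, hm]; ring
    · simp only [hmul, hm]
      simp
      ring

end Heisenberg

end

section

open Module

/-! ### Cyclic groups -/

section Cyclic

variable {k : Type*} [Field k]

/-- The one-dimensional representation given by a character. -/
def charRep {F : Type*} [Group F] (χ : F →* kˣ) : Representation k F k :=
  (algebraMap k (Module.End k k)).toMonoidHom.comp ((Units.coeHom k).comp χ)

theorem charRep_apply {F : Type*} [Group F] (χ : F →* kˣ) (g : F) (a : k) :
    charRep χ g a = χ g * a := by
  simp [charRep]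

/-- With `n = |F|`, the element `x ^ n` is invariant and `k(x)` has degree at most `n` over `k(x ^
n)`. -/
theorem isRational_charRep {F : Type*} [Group F] [Finite F] {E : Type*} [Field E]
    [Algebra k E] {l : Dual k k →ₗ[k] E} (hl : IsFunField l) (χ : F →* kˣ)
    (hχ : Function.Injective χ) (β : F →* (E ≃ₐ[k] E))
    (hβ : ∀ g f, β g (l f) = l (f ∘ₗ charRep χ g⁻¹)) : IsRational k (Invariants β) := by
  have hρ : Function.Injective (charRep χ) := fun g h hgh => hχ (Units.ext (by
    simpa [charRep_apply] using LinearMap.congr_fun hgh 1))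
  set x := l LinearMap.id with hx
  have hact : ∀ g, β g x = ((χ g)⁻¹ : kˣ) • x := fun g => by
    rw [hx, hβ, Units.smul_def, ← map_smul]
    congr 1
    ext
    simp [charRep_apply]
  refine isRational_invariants_of_rank_le (ι := Unit) β (hl.action_injective hβ hρ)
    (by rw [hl.trdeg_eq]; simp) (fun _ => x ^ Nat.card F) (fun g _ => ?_) ?_
  · rw [map_pow, hact, smul_pow, ← map_inv, ← map_pow, pow_card_eq_one', map_one, one_smul]
  · set B := IntermediateField.adjoin k (Set.range fun _ : Unit => x ^ Nat.card F) with hB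
    refine (rank_le_mul_of_pow_mem B.toSubfield x (Nat.card_pos (α := F)).ne' (N := 1)
      (IntermediateField.subset_adjoin k _ ⟨(), rfl⟩) fun A hA hx => ?_).trans (by simp)
    have h1 := hl.adjoin_span (f := fun _ : Unit => LinearMap.id) (by
      rw [Set.range_const, eq_top_iff]
      intro f _
      rw [Submodule.mem_span_singleton]
      exact ⟨f 1, by ext; simp⟩)
    exact rank_le_one_of_top_le _ (top_le_of_adjoin_eq_top h1 A
      (fun c => hA (B.algebraMap_mem c)) fun _ => hx)

theorem subsingleton_exteriorSquare_of_isAddCyclic (A : Type*) [AddCommGroup A]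
    [IsAddCyclic A] : Subsingleton (⋀[ℤ]^2 A) := by
  obtain ⟨g, hg⟩ := IsAddCyclic.exists_generator (α := A)
  have hspan : Submodule.span ℤ {g} = ⊤ := by
    rw [eq_top_iff]
    intro a _
    obtain ⟨n, rfl⟩ := AddSubgroup.mem_zmultiples_iff.1 (hg a)
    exact Submodule.smul_mem _ _ (Submodule.mem_span_singleton_self g)
  rw [← Submodule.subsingleton_iff ℤ, ← subsingleton_iff_bot_eq_top, eq_comm, eq_bot_iff,
    ← exteriorPower.ιMulti_span_of_span (R := ℤ) (n := 2) (M := A) hspan, Submodule.span_le]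
  rintro _ ⟨m, hm, rfl⟩
  have h0 : m 0 = g := hm ⟨0, rfl⟩
  have h1 : m 1 = g := hm ⟨1, rfl⟩
  exact (exteriorPower.ιMulti ℤ 2 (M := A)).map_eq_zero_of_eq m (i := 0) (j := 1)
    (h0.trans h1.symm) (by decide)

/-- The kernel is the exterior square of a cyclic group, hence trivial, so `F ≅ A` is cyclic and
embeds in the roots of unity of `k`. -/
theorem exists_rational_of_isAddCyclic (k : Type u) [Field k] [IsAlgClosed k] [CharZero k]
    {A : Type*} [AddCommGroup A] [Finite A] [IsAddCyclic A] {F : Type*} [Group F]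
    {p : F →* Multiplicative A} (hp : IsFreeCentralExtension p) :
    Finite F ∧ ∃ τ : Representation k F k, Function.Injective τ ∧
      IsRational k (QuotFunField τ) := by
  obtain ⟨c, -⟩ := hp.commutator
  have := subsingleton_exteriorSquare_of_isAddCyclic A
  have hker : Subsingleton p.ker := c.symm.toEquiv.subsingleton
  have hinj : Function.Injective p := by
    rw [← MonoidHom.ker_eq_bot_iff]
    exact Subgroup.eq_bot_of_subsingleton _
  let e : F ≃* Multiplicative A := MulEquiv.ofBijective p ⟨hinj, hp.surjective⟩
  have hF : Finite F := Finite.of_equiv _ e.symm.toEquiv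
  have hcyc : IsCyclic F := isCyclic_of_surjective e.symm e.symm.surjective
  have hn : NeZero (Nat.card F) := ⟨Nat.card_pos.ne'⟩
  have hn' : NeZero (Nat.card F : k) := ⟨by exact_mod_cast hn.out⟩
  let χ' : F ≃* rootsOfUnity (Nat.card F) k := mulEquivOfCyclicCardEq
    (HasEnoughRootsOfUnity.natCard_rootsOfUnity k (Nat.card F)).symm
  let χ : F →* kˣ := (rootsOfUnity (Nat.card F) k).subtype.comp χ'.toMonoidHom
  have hχ : Function.Injective χ := Subtype.val_injective.comp χ'.injective
  exact ⟨hF, charRep χ, fun g h hgh => hχ (Units.ext (by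
      simpa [charRep_apply] using LinearMap.congr_fun hgh 1)),
    isRational_charRep (isFunField_funField k k) χ hχ (funAction (charRep χ))
      (funAction_linForm (charRep χ))⟩

end Cyclic

end

section

open Module

theorem aeval_ne_zero_of_eval_ne_zero {k E ι : Type*} [Field k] [Field E] [Algebra k E] {x : ι → E}
    (hx : AlgebraicIndependent k x) (p : MvPolynomial ι k) (a : ι → k)
    (h : MvPolynomial.eval a p ≠ 0) : MvPolynomial.aeval x p ≠ 0 := fun h0 => by
  rw [hx.eq_zero_of_aeval_eq_zero p h0, map_zero] at h
  exact h rfl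

theorem fixed_of_closure_eq_top {k E F : Type*} [Field k] [Field E] [Algebra k E] [Group F]
    (β : F →* (E ≃ₐ[k] E)) {s : Set F} (hs : Subgroup.closure s = ⊤) (y : E)
    (h : ∀ g ∈ s, β g y = y) (g : F) : β g y = y := by
  have hg : g ∈ Subgroup.closure s := hs ▸ Subgroup.mem_top g
  induction hg using Subgroup.closure_induction with
  | mem g hg => exact h g hg
  | one => rw [map_one]; rfl
  | mul a b _ _ ha hb => rw [map_mul, AlgEquiv.mul_apply, hb, ha]
  | inv a _ ha =>
    rw [map_inv]
    exact (β a).symm_apply_eq.2 ha.symm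

/-! ### Rationality for a diagonal generator and a cyclic shift -/

section Heisenberg

theorem addChar_exists_pow_eq {k : Type*} [Field k] {ℓ : ℕ} [NeZero ℓ] (e : AddChar (ZMod ℓ) k)
    (he : IsPrimitiveRoot (e 1) ℓ) {c : k} (hc : c ^ ℓ = 1) : ∃ n : ℕ, c * e (-1) ^ n = 1 := by
  obtain ⟨n, -, hn⟩ := he.eq_pow_of_pow_eq_one hc
  refine ⟨n, ?_⟩
  rw [← hn, ← mul_pow, ← AddChar.map_add_eq_mul, add_neg_cancel, AddChar.map_zero_eq_one, one_pow]

/-- The degree `ℓ ^ 3` splits as three steps of degree at most `ℓ`, adjoining `R 1`, then `x 1 / x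
0`, then `x 0`. The scalars `c` and `d` are arbitrary up to `ℓ²`-th roots of unity because the
`ℓ`-th powers of lifts are not prescribed by the commutator pairing. -/
theorem isRational_invariants_heisenberg {k E F : Type*} [Field k] [CharZero k] [Field E]
    [Algebra k E] [Group F] [Finite F] {ℓ : ℕ} [Fact ℓ.Prime] (hF : Nat.card F = ℓ ^ 3)
    (β : F →* (E ≃ₐ[k] E)) (hβ : Function.Injective β) (x : ZMod ℓ → E) (t : E)
    (hind : AlgebraicIndependent k fun o : Option (ZMod ℓ) => o.elim t x)
    (hadj : IntermediateField.adjoin k (Set.range fun o : Option (ZMod ℓ) => o.elim t x) = ⊤)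
    (e : AddChar (ZMod ℓ) k) (he : IsPrimitiveRoot (e 1) ℓ) (D S : F) (Z : Set F)
    (hgen : Subgroup.closure (insert D (insert S Z)) = ⊤) (c d : k) (hc : (c ^ ℓ) ^ ℓ = 1)
    (hd : (d ^ ℓ) ^ ℓ = 1)
    (hDx : ∀ i, β D (x i) = algebraMap k E (c * e i) * x i)
    (hSx : ∀ i, β S (x i) = algebraMap k E d * x (i + 1))
    (hDt : β D t = algebraMap k E (e (-1)) * t) (hSt : β S t = t)
    (hZ : ∀ z ∈ Z, β z t = t ∧ ∃ b : k, b ^ ℓ = 1 ∧ ∀ i, β z (x i) = algebraMap k E b * x i) :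
    IsRational k (Invariants β) := by
  have hℓ : ℓ ≠ 0 := (Fact.out : ℓ.Prime).ne_zero
  have hc0 : c ≠ 0 := by rintro rfl; simp [hℓ] at hc
  have hd0 : d ≠ 0 := by rintro rfl; simp [hℓ] at hd
  have hx0 : ∀ i, x i ≠ 0 := fun i => hind.ne_zero (some i)
  have ht0 : t ≠ 0 := hind.ne_zero none
  have he0 : ∀ i, algebraMap k E (e i) ≠ 0 := fun i => by
    rw [map_ne_zero]
    refine left_ne_zero_of_mul_eq_one (b := e (-i)) ?_
    rw [← AddChar.map_add_eq_mul, add_neg_cancel, AddChar.map_zero_eq_one]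
  have hprim : e.IsPrimitive := AddChar.IsPrimitive.of_ne_one fun h => by
    have h1 := he
    rw [h, AddChar.one_apply] at h1
    exact (Fact.out : ℓ.Prime).ne_one (h1.unique IsPrimitiveRoot.one)
  -- The ratio `x (i + 1) / x i` has eigenvalue `e 1` under `D`, which `t` cancels. The Fourier
  -- transform `R j` of `r` is then an eigenvector of the shift `S` with eigenvalue `e (-j)`.
  set r : ZMod ℓ → E := fun i => x (i + 1) / x i * t with hr
  set R : ZMod ℓ → E := fun j => ∑ i, algebraMap k E (e (i * j)) * r i with hR
  have hr0 : ∀ i, r i ≠ 0 := fun i => mul_ne_zero (div_ne_zero (hx0 _) (hx0 _)) ht0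
  have hDr : ∀ i, β D (r i) = r i := fun i => by
    have h1 : algebraMap k E (e (-1)) * algebraMap k E (e 1) = 1 := by
      rw [← map_mul, ← AddChar.map_add_eq_mul, neg_add_cancel, AddChar.map_zero_eq_one, map_one]
    have h2 : algebraMap k E c ≠ 0 := by rwa [map_ne_zero]
    have h3 := he0 i
    have h4 := hx0 i
    simp only [hr, map_mul, map_div₀, hDx, hDt, AddChar.map_add_eq_mul]
    field_simp
    linear_combination (x (i + 1)) * h1
  have hSr : ∀ i, β S (r i) = r (i + 1) := fun i => by
    have h2 : algebraMap k E d ≠ 0 := by rwa [map_ne_zero]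
    simp only [hr, map_mul, map_div₀, hSx, hSt]
    field_simp
  have hZr : ∀ z ∈ Z, ∀ i, β z (r i) = r i := fun z hz i => by
    obtain ⟨h1, b, hb, h2⟩ := hZ z hz
    have h3 : algebraMap k E b ≠ 0 := by
      rw [map_ne_zero]; rintro rfl; simp [hℓ] at hb
    simp only [hr, map_mul, map_div₀, h2, h1]
    field_simp
  have hDR : ∀ j, β D (R j) = R j := fun j => by
    simp only [hR, map_sum, map_mul, AlgEquiv.commutes, hDr]
  have hZR : ∀ z ∈ Z, ∀ j, β z (R j) = R j := fun z hz j => by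
    simp only [hR, map_sum, map_mul, AlgEquiv.commutes, hZr z hz]
  have hSR : ∀ j, β S (R j) = algebraMap k E (e (-j)) * R j := fun j => by
    simp only [hR, map_sum, map_mul, AlgEquiv.commutes, hSr, Finset.mul_sum]
    refine Fintype.sum_equiv (Equiv.addRight 1) _ _ fun i => ?_
    have key : e (i * j) = e (-j) * e ((i + 1) * j) := by
      rw [← AddChar.map_add_eq_mul]; congr 1; ring
    rw [key, map_mul, mul_assoc]
    rfl
  -- After division by `t` and clearing denominators, the numerator is evaluated at the point with
  -- `x 0 = 0` and all other coordinates `1`; only the summand `i = 0` survives.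
  have hR1 : R 1 ≠ 0 := by
    have h1 := aeval_ne_zero_of_eval_ne_zero hind
      (∑ i : ZMod ℓ, MvPolynomial.C (e i) * (MvPolynomial.X (some (i + 1)) *
        ∏ j ∈ Finset.univ.erase i, MvPolynomial.X (some j)))
      (fun o => if o = some 0 then 0 else 1) (by
        simp only [map_sum, map_mul, map_prod, MvPolynomial.eval_C, MvPolynomial.eval_X]
        rw [Finset.sum_eq_single 0]
        · rw [Finset.prod_eq_one]
          · simp [AddChar.map_zero_eq_one]
          · intro j hj
            simpa using hj
        · intro i _ hi
          rw [Finset.prod_eq_zero (i := 0)] <;> simp [hi.symm]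
        · simp)
    simp only [map_sum, map_mul, map_prod, MvPolynomial.aeval_C, MvPolynomial.aeval_X,
      Option.elim_some] at h1
    intro h0
    refine h1 (mul_left_cancel₀ ht0 ?_)
    have h2 : R 1 * ∏ j, x j = 0 := by rw [h0, zero_mul]
    rw [mul_zero, ← h2, Finset.mul_sum]
    simp only [hR, Finset.sum_mul, mul_one]
    refine Finset.sum_congr rfl fun i _ => ?_
    rw [← Finset.mul_prod_erase _ _ (Finset.mem_univ i)]
    have := hx0 i
    simp only [hr]
    field_simp
  have hP : ∑ i, x i ^ ℓ ≠ 0 := by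
    have := aeval_ne_zero_of_eval_ne_zero hind
      (∑ i : ZMod ℓ, (MvPolynomial.X (some i)) ^ ℓ) (fun o => if o = some 0 then 1 else 0) (by
        simp [hℓ])
    simpa using this
  -- The sum of the `x i ^ ℓ` is multiplied by `c ^ ℓ` under `D` and by `d ^ ℓ` under `S`, both
  -- `ℓ`-th roots of unity. Powers of `t` (moved only by `D`) and of `R 1` (moved only by `S`)
  -- compensate these factors separately.
  obtain ⟨a, ha⟩ := addChar_exists_pow_eq e he hc
  obtain ⟨b, hb⟩ := addChar_exists_pow_eq e he hd
  set τ : E := (∑ i, x i ^ ℓ) * t ^ a * R 1 ^ b with hτ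
  set y : Option (ZMod ℓ) → E := fun o =>
    o.elim τ fun j => if j = 1 then R 1 ^ ℓ else R j / R 1 ^ j.val with hy
  have heℓ : ∀ i, e i ^ ℓ = 1 := fun i => by
    rw [← AddChar.map_nsmul_eq_pow]; simp
  have hinv : ∀ g o, β g (y o) = y o := by
    intro g o
    refine fixed_of_closure_eq_top β hgen _ ?_ g
    rintro g (rfl | rfl | hz)
    · cases o with
      | none =>
        simp only [hy, hτ, Option.elim_none, map_mul, map_sum, map_pow, hDx, hDt, hDR, mul_pow]
        simp only [← map_pow, heℓ, map_one, mul_one]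
        rw [← Finset.mul_sum]
        have := congrArg (algebraMap k E) ha
        rw [map_mul, map_one] at this
        linear_combination ((∑ i, x i ^ ℓ) * t ^ a * R 1 ^ b) * this
      | some j =>
        simp only [hy, Option.elim_some]
        split_ifs <;> simp [hDR]
    · cases o with
      | none =>
        simp only [hy, hτ, Option.elim_none, map_mul, map_sum, map_pow, hSx, hSt, hSR, mul_pow]
        rw [← Finset.mul_sum]
        have := congrArg (algebraMap k E) hb
        rw [map_mul, map_one, map_pow, map_pow] at this
        have h2 : ∑ i, x (i + 1) ^ ℓ = ∑ i, x i ^ ℓ :=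
          Fintype.sum_equiv (Equiv.addRight 1) _ _ fun i => rfl
        rw [h2]
        linear_combination ((∑ i, x i ^ ℓ) * t ^ a * R 1 ^ b) * this
      | some j =>
        simp only [hy, Option.elim_some]
        split_ifs
        · rw [map_pow, hSR, mul_pow, ← map_pow, heℓ, map_one, one_mul]
        · rw [map_div₀, map_pow, hSR, hSR, mul_pow, ← map_pow, ← AddChar.map_nsmul_eq_pow]
          have : j.val • (-1 : ZMod ℓ) = -j := by simp
          rw [this, mul_div_mul_left _ _ (he0 _)]
    · obtain ⟨h1, u, hu, h2⟩ := hZ g hz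
      cases o with
      | none =>
        simp only [hy, hτ, Option.elim_none, map_mul, map_sum, map_pow, h2, h1, hZR g hz, mul_pow]
        simp only [← map_pow, hu, map_one, one_mul]
      | some j =>
        simp only [hy, Option.elim_some]
        split_ifs <;> simp [hZR g hz]
  have hcard : Algebra.trdeg k E = Fintype.card (Option (ZMod ℓ)) :=
    trdeg_eq_of_algebraicIndependent _ hind hadj
  refine isRational_invariants_of_rank_le β hβ hcard y hinv ?_
  set B := IntermediateField.adjoin k (Set.range y) with hB
  have hyB : ∀ o, y o ∈ B.toSubfield := fun o => IntermediateField.subset_adjoin k _ ⟨o, rfl⟩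
  have hkB : ∀ a, algebraMap k E a ∈ B.toSubfield := fun a => B.algebraMap_mem a
  refine (rank_le_mul_of_pow_mem B.toSubfield (R 1) (n := ℓ) (N := ℓ * (ℓ * 1)) hℓ ?_
    fun A₁ hA₁ hR₁ => ?_).trans (by rw [hF]; push_cast; exact le_of_eq (by ring))
  · simpa [hy] using hyB (some 1)
  have hRA : ∀ j, R j ∈ A₁ := fun j => by
    by_cases hj : j = 1
    · rwa [hj]
    · have h1 := hA₁ (hyB (some j))
      simp only [hy, Option.elim_some, if_neg hj] at h1
      rw [← div_mul_cancel₀ (R j) (pow_ne_zero j.val hR1)]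
      exact mul_mem h1 (pow_mem hR₁ _)
  -- Inverse Fourier transform; the factor `ℓ` is invertible in characteristic zero.
  have hrA : ∀ i, r i ∈ A₁ := fun i => by
    have h1 : ∑ j, algebraMap k E (e (-(i * j))) * R j = algebraMap k E ℓ * r i := by
      simp only [hR, Finset.mul_sum]
      rw [Finset.sum_comm, Finset.sum_eq_single i]
      · have h3 : ∀ j, algebraMap k E (e (-(i * j))) * (algebraMap k E (e (i * j)) * r i) = r i := by
          intro j
          rw [← mul_assoc, ← map_mul, ← AddChar.map_add_eq_mul, neg_add_cancel,
            AddChar.map_zero_eq_one, map_one, one_mul]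
        simp only [h3, Finset.sum_const, Finset.card_univ, ZMod.card, nsmul_eq_mul, map_natCast]
      · intro i' _ hi'
        have h3 : ∀ j, algebraMap k E (e (-(i * j))) * (algebraMap k E (e (i' * j)) * r i') =
            algebraMap k E (e (j * (i' - i))) * r i' := by
          intro j
          rw [← mul_assoc, ← map_mul, ← AddChar.map_add_eq_mul]
          congr 3; ring
        simp only [h3]
        rw [← Finset.sum_mul, ← map_sum, AddChar.sum_mulShift _ hprim, if_neg (sub_ne_zero.2 hi')]
        simp
      · simp
    have h2 : algebraMap k E ℓ ≠ 0 := by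
      rw [map_ne_zero]; exact_mod_cast hℓ
    rw [← mul_div_cancel_left₀ (r i) h2, ← h1]
    exact div_mem (sum_mem fun j _ => mul_mem (hA₁ (hkB _)) (hRA j)) (hA₁ (hkB _))
  refine rank_le_mul_of_pow_mem A₁ (x 1 / x 0) hℓ ?_ fun A₂ hA₂ hw => ?_
  -- Around the cycle the ratios telescope, so the product of the `r i` is `t ^ ℓ`.
  · have h1 : (x 1 / x 0) ^ ℓ = r 0 ^ ℓ / ∏ i, r i := by
      simp only [hr, Finset.prod_mul_distrib, Finset.prod_div_distrib, Finset.prod_const]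
      rw [Finset.card_univ, ZMod.card, Fintype.prod_equiv (Equiv.addRight 1) (fun i => x (i + 1)) x
        fun i => rfl, div_self (Finset.prod_ne_zero_iff.2 fun i _ => hx0 i), one_mul, mul_pow,
        mul_div_assoc, div_self (pow_ne_zero _ ht0), mul_one, zero_add]
    rw [h1]
    exact div_mem (pow_mem (hrA 0) _) (prod_mem fun i _ => hrA i)
  have htA : t ∈ A₂ := by
    have h1 : t = r 0 / (x 1 / x 0) := by
      have := hx0 0
      have := hx0 1
      simp only [hr, zero_add]
      field_simp
    rw [h1]
    exact div_mem (hA₂ (hrA 0)) hw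
  have hwA : ∀ i, x (i + 1) / x i ∈ A₂ := fun i => by
    rw [← mul_div_cancel_right₀ (x (i + 1) / x i) ht0]
    exact div_mem (hA₂ (hrA i)) htA
  have hqA : ∀ n : ℕ, x n / x 0 ∈ A₂ := fun n => by
    induction n with
    | zero => simp [hx0]
    | succ n ih =>
      have : x (n + 1 : ℕ) / x 0 = x ((n : ZMod ℓ) + 1) / x n * (x n / x 0) := by
        have := hx0 n
        push_cast
        field_simp
      rw [this]
      exact mul_mem (hwA _) ih
  have hqA' : ∀ i, x i / x 0 ∈ A₂ := fun i => by
    have := hqA i.val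
    rwa [ZMod.natCast_zmod_val] at this
  refine rank_le_mul_of_pow_mem A₂ (x 0) hℓ ?_ fun A₃ hA₃ hx₃ => ?_
  -- All ratios `x i / x 0` being available, the invariant `τ` determines `x 0 ^ ℓ`.
  · have h1 : ∑ i, x i ^ ℓ = x 0 ^ ℓ * ∑ i, (x i / x 0) ^ ℓ := by
      rw [Finset.mul_sum]
      refine Finset.sum_congr rfl fun i _ => ?_
      rw [← mul_pow, mul_div_cancel₀ _ (hx0 0)]
    have h2 : ∑ i, (x i / x 0) ^ ℓ ≠ 0 := fun h => hP (by rw [h1, h, mul_zero])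
    have h3 : x 0 ^ ℓ = τ / (t ^ a * R 1 ^ b * ∑ i, (x i / x 0) ^ ℓ) := by
      rw [hτ, h1]
      field_simp
    rw [h3]
    refine div_mem (hA₂ (hA₁ (hyB none))) (mul_mem (mul_mem (pow_mem htA _)
      (pow_mem (hA₂ hR₁) _)) (sum_mem fun i _ => pow_mem (hqA' i) _))
  · refine rank_le_one_of_top_le _ (top_le_of_adjoin_eq_top hadj A₃
      (fun c => hA₃ (hA₂ (hA₁ (hkB c)))) fun o => ?_)
    cases o with
    | none => exact hA₃ htA
    | some i =>
      have := mul_mem (hA₃ (hqA' i)) hx₃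
      rwa [div_mul_cancel₀ _ (hx0 0)] at this

end Heisenberg

end

section

open Module

/-! ### Irreducible pieces with a prescribed central character -/

section Eigenvector

theorem exists_eigenvector_mem {k R : Type*} [Field k] [IsAlgClosed k] [AddCommGroup R] [Module k R]
    [FiniteDimensional k R] (P : Submodule k R) (hP : P ≠ ⊥) (f : Module.End k R)
    (hf : ∀ v ∈ P, f v ∈ P) : ∃ v ∈ P, v ≠ 0 ∧ ∃ c : k, f v = c • v := by
  have : Nontrivial P := Submodule.nontrivial_iff_ne_bot.2 hP
  obtain ⟨c, hc⟩ := Module.End.exists_eigenvalue (f.restrict hf)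
  obtain ⟨v, hv⟩ := hc.exists_hasEigenvector
  exact ⟨v, v.2, fun h => hv.2 (Subtype.ext h), c, congrArg Subtype.val hv.apply_eq_smul⟩

/-- The representation of `F` on functions on `F` by right translation. -/
def translationRep (k F : Type*) [Field k] [Group F] : Representation k F (F → k) where
  toFun g := LinearMap.funLeft k k (· * g)
  map_one' := by ext; simp [LinearMap.funLeft]
  map_mul' g h := by ext; simp [LinearMap.funLeft, mul_assoc]

theorem translationRep_apply {k F : Type*} [Field k] [Group F] (g : F) (f : F → k) (h : F) :
    translationRep k F g f h = f (h * g) := rfl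

variable {k F : Type*} [Field k] [IsAlgClosed k] [Group F] [Finite F]

/-- Inside the regular representation, the `χ`-eigenspace of the central subgroup `N` is stable
under `F`, and on it `D` and `E` commute because their commutator lies in the kernel of `χ`. -/
theorem exists_common_eigenvector (N : Subgroup F) (hN : N ≤ Subgroup.center F) (χ : N →* kˣ)
    (D E : F) (z : N) (hz : χ z = 1) (hDE : D * E = z * E * D) :
    ∃ v : F → k, v ≠ 0 ∧ (∀ z : N, translationRep k F z v = χ z • v) ∧
      (∃ c : k, translationRep k F D v = c • v) ∧ ∃ c : k, translationRep k F E v = c • v := by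
  classical
  set ρ := translationRep k F with hρ
  have hcomm : ∀ (z : N) (g : F), (z : F) * g = g * z := fun z g =>
    (Subgroup.mem_center_iff.1 (hN z.2) g).symm
  let P : Submodule k (F → k) :=
    { carrier := {v | ∀ z : N, ρ z v = χ z • v}
      zero_mem' := fun z => by simp
      add_mem' := fun {v w} hv hw z => by rw [map_add, hv z, hw z, smul_add]
      smul_mem' := fun c v hv z => by rw [map_smul, hv z, smul_comm] }
  -- The extension of `χ` by zero outside `N` is a nonzero element.
  have hP : P ≠ ⊥ := by
    rw [Submodule.ne_bot_iff]
    refine ⟨fun h => if hh : h ∈ N then (χ ⟨h, hh⟩ : k) else 0, fun z => ?_, fun h => ?_⟩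
    · ext h
      rw [hρ, translationRep_apply, Pi.smul_apply, Units.smul_def, smul_eq_mul]
      by_cases hh : h ∈ N
      · rw [dif_pos (N.mul_mem hh z.2), dif_pos hh, ← Units.val_mul, ← map_mul]
        congr 2
        exact Subtype.ext (hcomm z h).symm
      · rw [dif_neg fun h' => hh ((Subgroup.mul_mem_cancel_right N z.2).1 h'), dif_neg hh, mul_zero]
    · have := congrFun h 1
      simp [N.one_mem] at this
  have hPg : ∀ g : F, ∀ v ∈ P, ρ g v ∈ P := fun g v hv z => by
    rw [← Module.End.mul_apply, ← map_mul, hcomm, map_mul, Module.End.mul_apply, hv z]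
    exact map_smul (ρ g) (χ z : k) v
  obtain ⟨v₀, hv₀, hv₀0, c, hc⟩ := exists_eigenvector_mem P hP (ρ D) (hPg D)
  let Q : Submodule k (F → k) := P ⊓ Module.End.eigenspace (ρ D) c
  have hQ : Q ≠ ⊥ := by
    rw [Submodule.ne_bot_iff]
    exact ⟨v₀, ⟨hv₀, Module.End.mem_eigenspace_iff.2 hc⟩, hv₀0⟩
  obtain ⟨v, hv, hv0, c', hc'⟩ := exists_eigenvector_mem Q hQ (ρ E) (fun v hv => by
    refine ⟨hPg E v hv.1, Module.End.mem_eigenspace_iff.2 ?_⟩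
    rw [← Module.End.mul_apply, ← map_mul, hDE, mul_assoc, map_mul, Module.End.mul_apply, map_mul,
      Module.End.mul_apply, Module.End.mem_eigenspace_iff.1 hv.2, map_smul, map_smul,
      hPg E v hv.1 z, hz, one_smul])
  exact ⟨v, hv0, hv.1, ⟨c, Module.End.mem_eigenspace_iff.1 hv.2⟩, c', hc'⟩

theorem addChar_injective {k : Type*} [Field k] {ℓ : ℕ} [NeZero ℓ] (e : AddChar (ZMod ℓ) k)
    (he : IsPrimitiveRoot (e 1) ℓ) : Function.Injective e := fun i j hij => by
  have h1 : ∀ i : ZMod ℓ, e i = e 1 ^ i.val := fun i => by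
    rw [← AddChar.map_nsmul_eq_pow]; simp
  rw [h1 i, h1 j] at hij
  exact ZMod.val_injective ℓ (he.pow_inj i.val_lt j.val_lt hij)

/-- Since `D * S = z₁ * S * D` with `χ z₁ = e 1`, applying `S` multiplies an eigenvalue of `D` by `e
1`, so the orbit of a common eigenvector under `S` consists of eigenvectors with distinct
eigenvalues. Modulo the kernel of `χ` the element `E` commutes with `D` and `S`; it is the third
generator when `A = (ℤ/2)³` and is taken to be `1` when `A = (ℤ/ℓ)²`. -/
theorem exists_cyclic_subrepresentation {ℓ : ℕ} [NeZero ℓ] (e : AddChar (ZMod ℓ) k)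
    (he : IsPrimitiveRoot (e 1) ℓ) (N : Subgroup F) (hN : N ≤ Subgroup.center F) (χ : N →* kˣ)
    (D S E : F) (z₁ z₂ z₃ : N) (h₁ : D * S = z₁ * S * D) (hχ₁ : (χ z₁ : k) = e 1)
    (h₂ : D * E = z₂ * E * D) (hχ₂ : χ z₂ = 1) (h₃ : E * S = z₃ * S * E) (hχ₃ : χ z₃ = 1)
    (hS : S ^ ℓ ∈ N) (hgen : Subgroup.closure (insert D (insert S (insert E (N : Set F)))) = ⊤) :
    ∃ (U : Subrepresentation (translationRep k F)) (b : Basis (ZMod ℓ) k U.toSubmodule) (c d : k),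
      (∀ i, U.toRepresentation D (b i) = (c * e i) • b i) ∧
      (∀ i, U.toRepresentation S (b i) = d • b (i + 1)) ∧
      ∀ (z : N) i, U.toRepresentation z (b i) = (χ z : k) • b i := by
  set ρ := translationRep k F with hρ
  have hcomm : ∀ (z : N) (g : F), (z : F) * g = g * z := fun z g =>
    (Subgroup.mem_center_iff.1 (hN z.2) g).symm
  obtain ⟨v, hv0, hvN, ⟨c, hc⟩, c', hc'⟩ := exists_common_eigenvector N hN χ D E z₂ hχ₂ h₂
  -- Dividing `S` by an `ℓ`-th root of the scalar `S ^ ℓ` makes the sequence `y` periodic, so that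
  -- it can be indexed by `ZMod ℓ`.
  obtain ⟨d, hd⟩ := IsAlgClosed.exists_pow_nat_eq (χ ⟨_, hS⟩ : k) (NeZero.pos ℓ)
  have hd0 : d ≠ 0 := by
    rintro rfl
    rw [zero_pow (NeZero.ne ℓ)] at hd
    exact (χ ⟨_, hS⟩).ne_zero hd.symm
  let y : ℕ → F → k := fun n => d⁻¹ ^ n • ρ (S ^ n) v
  have hmul : ∀ g h w, ρ (g * h) w = ρ g (ρ h w) := fun g h w => by rw [map_mul]; rfl
  have hyS : ∀ n, ρ S (y n) = d • y (n + 1) := fun n => by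
    simp only [y]
    rw [map_smul, smul_smul, pow_succ' S, hmul, pow_succ', mul_inv_cancel_left₀ hd0]
  have hyN : ∀ (z : N) n, ρ z (y n) = (χ z : k) • y n := fun z n => by
    simp only [y]
    rw [map_smul, ← hmul, hcomm, hmul, hvN, Units.smul_def, map_smul, smul_comm]
  have hperiod : Function.Periodic y ℓ := fun n => by
    simp only [y]
    have := hvN ⟨_, hS⟩
    rw [Units.smul_def, ← hd] at this
    rw [pow_add S, hmul, this, map_smul, smul_smul, pow_add, mul_assoc, ← mul_pow,
      inv_mul_cancel₀ hd0, one_pow, mul_one]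
  have hy' : ∀ n, y (n + 1) = d⁻¹ • ρ S (y n) := fun n => by
    rw [hyS, smul_smul, inv_mul_cancel₀ hd0, one_smul]
  have hyD : ∀ n : ℕ, ρ D (y n) = (c * e n) • y n := fun n => by
    induction n with
    | zero => simpa [y, AddChar.map_zero_eq_one] using hc
    | succ n ih =>
      rw [hy', map_smul, ← hmul, h₁, hmul, hmul, ih, map_smul, map_smul, hyS, map_smul, hyN, hχ₁]
      push_cast
      rw [AddChar.map_add_eq_mul]
      simp only [smul_smul]
      congr 1; ring
  have hyE : ∀ n : ℕ, ρ E (y n) = c' • y n := fun n => by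
    induction n with
    | zero => simpa [y] using hc'
    | succ n ih =>
      rw [hy', map_smul, ← hmul, h₃, hmul, hmul, ih, map_smul, map_smul, hyS, map_smul, hyN, hχ₃]
      simp only [smul_smul, Units.val_one]
      congr 1; ring
  have hy0 : ∀ n, y n ≠ 0 := fun n h => by
    have h1 : ρ (S ^ n) v = 0 := (smul_eq_zero.1 h).resolve_left (pow_ne_zero _ (inv_ne_zero hd0))
    have h2 : ρ (S ^ n)⁻¹ (ρ (S ^ n) v) = 0 := by rw [h1, map_zero]
    rw [← hmul, inv_mul_cancel, map_one] at h2
    exact hv0 h2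
  let b : ZMod ℓ → F → k := fun i => y i.val
  have hbn : ∀ n : ℕ, b n = y n := fun n => by
    simp only [b]
    rw [ZMod.val_natCast, hperiod.map_mod_nat]
  have hbD : ∀ i, ρ D (b i) = (c * e i) • b i := fun i => by
    simpa using hyD i.val
  have hbS : ∀ i, ρ S (b i) = d • b (i + 1) := fun i => by
    have := hyS i.val
    rw [← hbn (i.val + 1)] at this
    simpa using this
  have hc0 : c ≠ 0 := by
    rintro rfl
    have h1 : ρ D⁻¹ (ρ D v) = 0 := by rw [hc, zero_smul, map_zero]
    rw [← hmul, inv_mul_cancel, map_one] at h1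
    exact hv0 h1
  have heinj := addChar_injective e he
  have hli : LinearIndependent k b :=
    Module.End.eigenvectors_linearIndependent' (ρ D) (fun i => c * e i)
      (fun i j hij => heinj (mul_left_cancel₀ hc0 hij)) b
      fun i => ⟨Module.End.mem_eigenspace_iff.2 (hbD i), hy0 _⟩
  set P := Submodule.span k (Set.range b) with hP
  have hstab : ∀ g : F, P ≤ P.comap (ρ g) := by
    let M : Submonoid F :=
      { carrier := {g | P ≤ P.comap (ρ g)}
        one_mem' := by intro w hw; simpa using hw
        mul_mem' := fun {g h} hg hh w hw => by
          rw [Submodule.mem_comap, hmul]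
          exact hg (hh hw) }
    have hM : ∀ g : F, (∀ i, ρ g (b i) ∈ P) → g ∈ M := fun g hg => by
      change P ≤ _
      rw [hP, Submodule.span_le]
      rintro _ ⟨i, rfl⟩
      exact hg i
    have hbP : ∀ i, b i ∈ P := fun i => Submodule.subset_span ⟨i, rfl⟩
    have hgens : insert D (insert S (insert E (N : Set F))) ⊆ (M : Set F) := by
      rintro g (rfl | rfl | rfl | hg)
      · exact hM _ fun i => by rw [hbD]; exact P.smul_mem _ (hbP i)
      · exact hM _ fun i => by rw [hbS]; exact P.smul_mem _ (hbP _)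
      · exact hM _ fun i => by rw [hyE]; exact P.smul_mem _ (hbP i)
      · exact hM _ fun i => by
          have := hyN ⟨g, hg⟩ i.val
          exact this ▸ P.smul_mem _ (hbP i)
    intro g
    have hg : g ∈ Subgroup.closure (insert D (insert S (insert E (N : Set F)))) :=
      hgen ▸ Subgroup.mem_top g
    change g ∈ M
    induction hg using Subgroup.closure_induction with
    | mem g hg => exact hgens hg
    | one => exact M.one_mem
    | mul a b _ _ ha hb => exact M.mul_mem ha hb
    | inv a _ ha =>
      -- In a finite group the inverse is a positive power, so a stabilising submonoid is enough.
      have h1 : a⁻¹ ∈ Submonoid.powers a :=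
        mem_powers_iff_mem_zpowers.2 (inv_mem (Subgroup.mem_zpowers a))
      exact (Submonoid.powers_le.2 ha) h1
  let U : Subrepresentation ρ := ⟨P, fun g v hv => hstab g hv⟩
  let B : Basis (ZMod ℓ) k U.toSubmodule := Basis.span hli
  have hB : ∀ i, (B i : F → k) = b i := fun i => congrArg Subtype.val (Basis.span_apply hli i)
  refine ⟨U, B, c, d, fun i => Subtype.ext ?_, fun i => Subtype.ext ?_, fun z i => Subtype.ext ?_⟩
  · change ρ D (B i) = (c * e i) • (B i : F → k)
    rw [hB, hbD]
  · change ρ S (B i) = d • (B (i + 1) : F → k)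
    rw [hB, hB, hbS]
  · change ρ z (B i) = (χ z : k) • (B i : F → k)
    rw [hB]; exact hyN z _

end Eigenvector

end

/-! ### Coordinates on a dual representation, and generators from a basis of the quotient -/

section

open Module

namespace IsFunField

variable {k V E : Type*} [Field k] [AddCommGroup V] [Module k V] [Field E] [Algebra k E]

theorem algebraicIndependent_of_finite {l : Dual k V →ₗ[k] E} (hl : IsFunField l) {ι : Type*}
    [Finite ι] {f : ι → Dual k V} (hf : LinearIndependent k f) :
    AlgebraicIndependent k fun i => l (f i) := by
  obtain ⟨n, ⟨e⟩⟩ := Finite.exists_equiv_fin ι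
  have := (hl.algebraicIndependent (f ∘ e.symm) (hf.comp _ e.symm.injective)).comp e e.injective
  convert this using 2 with i
  simp

variable [FiniteDimensional k V] {l : Dual k (Dual k V) →ₗ[k] E} (hl : IsFunField l)

include hl

theorem algebraicIndependent_eval {ι : Type*} [Finite ι] (b : Basis ι k V) :
    AlgebraicIndependent k fun i => l (Dual.eval k V (b i)) :=
  hl.algebraicIndependent_of_finite (b.map (evalEquiv k V)).linearIndependent

theorem adjoin_eval {ι : Type*} (b : Basis ι k V) :
    IntermediateField.adjoin k (Set.range fun i => l (Dual.eval k V (b i))) = ⊤ :=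
  hl.adjoin_span (b.map (evalEquiv k V)).span_eq

omit hl [FiniteDimensional k V] in
-- The reason for taking `W` to be a dual space: linear forms on it are vectors of `V`, and `F` acts
-- on these coordinates by `τ` itself, without inverses.
theorem action_eval {F : Type*} [Group F] {τ : Representation k F V} {β : F →* (E ≃ₐ[k] E)}
    (hβ : ∀ g f, β g (l f) = l (f ∘ₗ τ.dual g⁻¹)) (g : F) (v : V) :
    β g (l (Dual.eval k V v)) = l (Dual.eval k V (τ g v)) := by
  rw [hβ]
  congr 1
  ext φ
  simp [Representation.dual_apply, Module.Dual.transpose_apply]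

end IsFunField

theorem dual_injective {k V F : Type*} [Field k] [AddCommGroup V] [Module k V] [Group F]
    {τ : Representation k F V} (hτ : ∀ g, τ g = 1 → g = 1) : Function.Injective τ.dual := by
  rw [injective_iff_map_eq_one]
  intro g hg
  rw [← inv_eq_one]
  refine hτ _ (LinearMap.ext fun v => ?_)
  rw [← sub_eq_zero, ← Module.forall_dual_apply_eq_zero_iff k]
  intro φ
  have := LinearMap.congr_fun (LinearMap.congr_fun hg φ) v
  rw [map_sub, sub_eq_zero]
  exact this

section Central

variable {F A : Type*} [Group F] [AddCommGroup A] {p : F →* Multiplicative A} {ℓ : ℕ}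

theorem closure_eq_top_of_basis [Module (ZMod ℓ) A] {ι : Type*} (b : Basis ι (ZMod ℓ) A)
    (T : Set F) (hT : ∀ i, ∃ g ∈ T, (p g).toAdd = b i) (hker : (p.ker : Set F) ⊆ T) :
    Subgroup.closure T = ⊤ := by
  set H := Subgroup.closure T with hH
  let S : AddSubgroup A :=
    { carrier := {a | ∃ h ∈ H, (p h).toAdd = a}
      zero_mem' := ⟨1, H.one_mem, by simp⟩
      add_mem' := by
        rintro _ _ ⟨g, hg, rfl⟩ ⟨h, hh, rfl⟩
        exact ⟨g * h, H.mul_mem hg hh, by simp⟩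
      neg_mem' := by
        rintro _ ⟨g, hg, rfl⟩
        exact ⟨g⁻¹, H.inv_mem hg, by simp⟩ }
  have hS : ⊤ ≤ AddSubgroup.toZModSubmodule ℓ S := by
    rw [← b.span_eq, Submodule.span_le]
    rintro _ ⟨i, rfl⟩
    obtain ⟨g, hg, h⟩ := hT i
    exact ⟨g, Subgroup.subset_closure hg, h⟩
  rw [eq_top_iff]
  intro f _
  obtain ⟨h, hh, hfh⟩ := hS (x := (p f).toAdd) trivial
  have hmem : f * h⁻¹ ∈ p.ker := by
    rw [MonoidHom.mem_ker, map_mul, map_inv, mul_inv_eq_one]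
    exact Multiplicative.toAdd.injective hfh.symm
  simpa using H.mul_mem (Subgroup.subset_closure (hker hmem)) hh

theorem card_eq_mul_card_ker (hp : Function.Surjective p) :
    Nat.card F = Nat.card A * Nat.card p.ker := by
  rw [Subgroup.card_eq_card_quotient_mul_card_subgroup p.ker,
    Nat.card_congr (QuotientGroup.quotientKerEquivOfSurjective p hp).toEquiv]
  rfl

theorem finite_of_finite_ker [Finite A] [Finite p.ker] (hp : Function.Surjective p) : Finite F :=
  Nat.finite_of_card_ne_zero (by
    rw [card_eq_mul_card_ker hp]
    exact mul_ne_zero Nat.card_pos.ne' Nat.card_pos.ne')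

/-- The character of a subgroup obtained from a homomorphism to `ZMod ℓ` and an additive
character of `ZMod ℓ`. -/
def subgroupChar {k : Type*} [Field k] (e : AddChar (ZMod ℓ) k) {N : Subgroup F}
    (f : Additive N →+ ZMod ℓ) : N →* kˣ :=
  MonoidHom.toHomUnits
    { toFun := fun z => e (f (Additive.ofMul z))
      map_one' := by simp
      map_mul' := fun z w => by rw [ofMul_mul, map_add, AddChar.map_add_eq_mul] }

theorem coe_subgroupChar {k : Type*} [Field k] (e : AddChar (ZMod ℓ) k) {N : Subgroup F}
    (f : Additive N →+ ZMod ℓ) (z : N) :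
    (subgroupChar e f z : k) = e (f (Additive.ofMul z)) := rfl

theorem exists_addChar_isPrimitiveRoot (k : Type*) [Field k] [IsAlgClosed k] [CharZero k] (ℓ : ℕ)
    [NeZero ℓ] : ∃ e : AddChar (ZMod ℓ) k, IsPrimitiveRoot (e 1) ℓ := by
  have : NeZero (ℓ : k) := ⟨by exact_mod_cast NeZero.ne ℓ⟩
  obtain ⟨ζ, hζ⟩ := HasEnoughRootsOfUnity.exists_primitiveRoot k ℓ
  refine ⟨AddChar.zmodChar ℓ hζ.pow_eq_one, ?_⟩
  have := AddChar.zmodChar_apply' hζ.pow_eq_one 1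
  rw [Nat.cast_one, pow_one] at this
  rwa [this]

end Central

/-! ### Free central extensions of `(ℤ/ℓ)²` -/

section HeisenbergCase

variable {k F : Type*} [Field k] [CharZero k] [Group F] [Finite F] {ℓ : ℕ}
  [Fact ℓ.Prime]

theorem isRational_invariants_dual_heisenberg {V E : Type*} [AddCommGroup V] [Module k V]
    [FiniteDimensional k V] [Field E] [Algebra k E] {l : Dual k (Dual k V) →ₗ[k] E}
    (hl : IsFunField l) (hF : Nat.card F = ℓ ^ 3) {τ : Representation k F V}
    (hτ : Function.Injective τ.dual) (β : F →* (E ≃ₐ[k] E))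
    (hβ : ∀ g f, β g (l f) = l (f ∘ₗ τ.dual g⁻¹)) (b : Basis (Option (ZMod ℓ)) k V)
    (e : AddChar (ZMod ℓ) k) (he : IsPrimitiveRoot (e 1) ℓ) (D S : F) (Z : Set F)
    (hgen : Subgroup.closure (insert D (insert S Z)) = ⊤) (c d : k)
    (hc : (c ^ ℓ) ^ ℓ = 1) (hd : (d ^ ℓ) ^ ℓ = 1)
    (hDx : ∀ i, τ D (b (some i)) = (c * e i) • b (some i))
    (hSx : ∀ i, τ S (b (some i)) = d • b (some (i + 1)))
    (hDt : τ D (b none) = e (-1) • b none) (hSt : τ S (b none) = b none)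
    (hZ : ∀ z ∈ Z, τ z (b none) = b none ∧
      ∃ a : k, a ^ ℓ = 1 ∧ ∀ i, τ z (b (some i)) = a • b (some i)) :
    IsRational k (Invariants β) := by
  have hfam : (fun o : Option (ZMod ℓ) => o.elim (l (Dual.eval k V (b none)))
      fun i => l (Dual.eval k V (b (some i)))) = fun o => l (Dual.eval k V (b o)) := by
    funext o; cases o <;> rfl
  have hact := IsFunField.action_eval hβ
  refine isRational_invariants_heisenberg hF β (hl.action_injective hβ hτ)
    (fun i => l (Dual.eval k V (b (some i)))) (l (Dual.eval k V (b none)))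
    (hfam ▸ hl.algebraicIndependent_eval b) (hfam ▸ hl.adjoin_eval b) e he D S Z hgen c d hc hd
    (fun i => ?_) (fun i => ?_) ?_ ?_ fun z hz => ?_
  · rw [hact, hDx, map_smul, map_smul, Algebra.smul_def]
  · rw [hact, hSx, map_smul, map_smul, Algebra.smul_def]
  · rw [hact, hDt, map_smul, map_smul, Algebra.smul_def]
  · rw [hact, hSt]
  · obtain ⟨h1, a, ha, h2⟩ := hZ z hz
    exact ⟨by rw [hact, h1], a, ha, fun i => by rw [hact, h2, map_smul, map_smul, Algebra.smul_def]⟩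

end HeisenbergCase

theorem exists_rational_of_basis_two (k : Type u) [Field k] [IsAlgClosed k] [CharZero k]
    {A : Type v} [AddCommGroup A] {ℓ : ℕ} [Fact ℓ.Prime] [Module (ZMod ℓ) A]
    (b : Basis (Fin 2) (ZMod ℓ) A) {F : Type x} [Group F]
    {p : F →* Multiplicative A} (hp : IsFreeCentralExtension p) :
    Finite F ∧ ∃ (W : Type (max u x)) (_ : AddCommGroup W) (_ : Module k W)
      (_ : FiniteDimensional k W) (τ : Representation k F W), Function.Injective τ ∧
      IsRational k (QuotFunField τ) := by
  obtain ⟨Θ, hΘ⟩ := exists_exteriorSquare_addEquiv_two b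
  obtain ⟨hsurj, hcen, κ, hκ⟩ := (isFreeCentralExtension_iff Θ _ hΘ).1 hp
  have hA : Finite A := Finite.of_equiv _ b.equivFun.symm.toEquiv
  have hA' : Nat.card A = ℓ ^ 2 := by
    rw [Nat.card_congr b.equivFun.toEquiv]; simp
  have hker : Nat.card p.ker = ℓ := by
    rw [← Nat.card_zmod ℓ, Nat.card_congr κ.toEquiv]; rfl
  have : Finite p.ker := Finite.of_equiv _ κ.toEquiv
  have hF := finite_of_finite_ker hsurj
  have hF3 : Nat.card F = ℓ ^ 3 := by
    rw [card_eq_mul_card_ker hsurj, hA', hker]; ring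
  refine ⟨hF, ?_⟩
  obtain ⟨e, he⟩ := exists_addChar_isPrimitiveRoot k ℓ
  have heℓ : ∀ i, e i ^ ℓ = 1 := fun i => by
    rw [← AddChar.map_nsmul_eq_pow]; simp
  set χ : p.ker →* kˣ := subgroupChar e κ.symm.toAddMonoidHom with hχ
  have hχℓ : ∀ z, (χ z : k) ^ ℓ = 1 := fun z => heℓ _
  have hχinj : ∀ z, (χ z : k) = 1 → z = 1 := fun z hz => by
    rw [hχ, coe_subgroupChar, ← e.map_zero_eq_one] at hz
    have := addChar_injective e he hz
    exact κ.symm.map_eq_zero_iff.1 this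
  obtain ⟨D, hD⟩ := hsurj (Multiplicative.ofAdd (b 0))
  obtain ⟨S, hS⟩ := hsurj (Multiplicative.ofAdd (b 1))
  have hpow : ∀ g : F, g ^ ℓ ∈ p.ker := fun g => by
    rw [MonoidHom.mem_ker, map_pow]
    refine Multiplicative.toAdd.injective ?_
    rw [toAdd_pow, ← Nat.cast_smul_eq_nsmul (ZMod ℓ)]
    simp
  have hcom : ∀ g h : F, g * h = ((κ (b.repr (p g).toAdd 0 * b.repr (p h).toAdd 1 -
      b.repr (p h).toAdd 0 * b.repr (p g).toAdd 1)).toMul : F) * h * g := fun g h => by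
    rw [hκ]; group
  have hχκ : ∀ a, (χ (κ a).toMul : k) = e a := fun a => by
    rw [hχ, coe_subgroupChar]; simp
  have hgen : Subgroup.closure (insert D (insert S (insert 1 (p.ker : Set F)))) = ⊤ :=
    closure_eq_top_of_basis (p := p) b _ (fun i => by
      fin_cases i
      · exact ⟨D, by simp, by rw [hD]; rfl⟩
      · exact ⟨S, by simp, by rw [hS]; rfl⟩) fun z hz => by simp [SetLike.mem_coe.1 hz]
  obtain ⟨U, B, c, d, hDB, hSB, hZB⟩ := exists_cyclic_subrepresentation e he p.ker hcen χ D S 1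
    (κ 1).toMul 1 1 (by
      have := hcom D S
      rw [hD, hS] at this
      simpa using this) (hχκ 1) (by simp) (map_one χ) (by simp) (map_one χ) (hpow S) hgen
  have hUF : FiniteDimensional k U.toSubmodule := .of_basis B
  -- The auxiliary character has value `e (-1)` on `D` and `1` on `S` and on the kernel; it carries
  -- the coordinate `t`.
  let f : F →* Multiplicative (ZMod ℓ) :=
    (AddMonoidHom.toMultiplicative (-(b.coord 0).toAddMonoidHom)).comp p
  let χ' : F →* kˣ := MonoidHom.toHomUnits (e.toMonoidHom.comp f)
  have hχ' : ∀ g, (χ' g : k) = e (-(b.repr (p g).toAdd 0)) := fun g => rfl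
  let τ := U.toRepresentation.prod (charRep χ')
  have hτ : ∀ g v a, τ g (v, a) = (U.toRepresentation g v, χ' g * a) := fun g v a => by
    rw [← charRep_apply]; rfl
  let B' : Basis (Option (ZMod ℓ)) k (U.toSubmodule × k) :=
    (B.prod (Basis.singleton PUnit.{1} k)).reindex (Equiv.optionEquivSumPUnit _).symm
  have hBn : B' none = (0, 1) := by simp [B', Basis.prod_apply]
  have hBs : ∀ i, B' (some i) = (B i, 0) := fun i => by simp [B', Basis.prod_apply]
  -- `D ^ ℓ` and `S ^ ℓ` are central and act on `U` by values of `χ`, so `c ^ ℓ` and `d ^ ℓ` are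
  -- `ℓ`-th roots of unity.
  have hDpow : c ^ ℓ = χ ⟨_, hpow D⟩ := by
    have h1 := hZB ⟨_, hpow D⟩ 0
    have h2 : ∀ n : ℕ, U.toRepresentation (D ^ n) (B 0) = c ^ n • B 0 := fun n => by
      induction n with
      | zero => simp
      | succ n ih =>
        rw [pow_succ, map_mul, Module.End.mul_apply, hDB, map_smul, ih, smul_smul, pow_succ,
          AddChar.map_zero_eq_one]
        congr 1; ring
    rw [h2] at h1
    exact smul_left_injective k (B.ne_zero 0) h1
  have hSpow : d ^ ℓ = χ ⟨_, hpow S⟩ := by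
    have h1 := hZB ⟨_, hpow S⟩ 0
    have h2 : ∀ n : ℕ, U.toRepresentation (S ^ n) (B 0) = d ^ n • B n := fun n => by
      induction n with
      | zero => simp
      | succ n ih =>
        rw [pow_succ', map_mul, Module.End.mul_apply, ih, map_smul, hSB, smul_smul, pow_succ]
        push_cast; rfl
    rw [h2] at h1
    simp only [CharP.cast_eq_zero] at h1
    exact smul_left_injective k (B.ne_zero 0) h1
  -- Already `U` is faithful. If `g` acts trivially on `U`, so do its commutators, which lie in the
  -- kernel of `p`, where `χ` is faithful. Hence `p g` is orthogonal to `p D` and `p S`, and `g`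
  -- itself lies in that kernel.
  have hfaith : ∀ g, τ g = 1 → g = 1 := fun g hg => by
    have h1 : U.toRepresentation g = 1 := LinearMap.ext fun v => by
      have := congrArg Prod.fst (LinearMap.congr_fun hg (v, 0))
      rwa [hτ] at this
    have h2 : ∀ z : p.ker, U.toRepresentation z = 1 → z = 1 := fun z hz => hχinj z (by
      have := hZB z 0
      rw [hz, Module.End.one_apply] at this
      have h3 : (1 : k) • B 0 = (χ z : k) • B 0 := by rwa [one_smul]
      exact (smul_left_injective k (B.ne_zero 0) h3).symm)
    have h3 : ∀ h, b.repr (p g).toAdd 0 * b.repr (p h).toAdd 1 -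
      b.repr (p h).toAdd 0 * b.repr (p g).toAdd 1 = 0 := fun h => by
      have h4 := h2 (κ (b.repr (p g).toAdd 0 * b.repr (p h).toAdd 1 -
        b.repr (p h).toAdd 0 * b.repr (p g).toAdd 1)).toMul (by
          have h5 : g ∈ U.toRepresentation.ker := h1
          rw [hκ, mul_assoc, mul_assoc, ← mul_assoc h]
          exact mul_mem h5 (MonoidHom.normal_ker _ |>.conj_mem _ (inv_mem h5) h))
      exact (map_eq_zero_iff κ κ.injective).1 h4
    have h5 : g ∈ p.ker := by
      rw [MonoidHom.mem_ker]
      refine Multiplicative.toAdd.injective (b.repr.injective (Finsupp.ext fun i => ?_))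
      have hD3 := h3 D
      have hS3 := h3 S
      rw [hD] at hD3
      rw [hS] at hS3
      fin_cases i
      · simpa using hS3
      · simpa using hD3
    exact congrArg Subtype.val (h2 ⟨g, h5⟩ h1)
  have hinj := dual_injective hfaith
  refine ⟨Dual k (U.toSubmodule × k), inferInstance, inferInstance, inferInstance, τ.dual, hinj, ?_⟩
  refine isRational_invariants_dual_heisenberg (isFunField_funField k _) hF3 hinj (funAction τ.dual)
    (funAction_linForm τ.dual) B' e he D S (insert 1 (p.ker : Set F)) hgen c d
    (by rw [hDpow, hχℓ]) (by rw [hSpow, hχℓ])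
    (fun i => ?_) (fun i => ?_) ?_ ?_ fun z hz => ?_
  · rw [hBs, hτ, hDB]; simp
  · rw [hBs, hBs, hτ, hSB]; simp
  · rw [hBn, hτ, hχ', hD]; simp
  · rw [hBn, hτ, hχ', hS]; simp
  · have hz' : z ∈ p.ker := by
      rcases hz with rfl | hz
      exacts [p.ker.one_mem, hz]
    refine ⟨?_, χ ⟨z, hz'⟩, hχℓ _, fun i => ?_⟩
    · rw [hBn, hτ, hχ', MonoidHom.mem_ker.1 hz']; simp
    · have := hZB ⟨z, hz'⟩ i
      rw [hBs, hτ, this]; simp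

end

section

open Module

/-! ### The monomial action of `(ℤ/2)³` -/

section Monomial

/-- The signs of the monomial action of the `j`-th basis vector of `(ℤ/2)³` on the `i`-th
coordinate. -/
def monomialSign : Fin 3 → Fin 3 → ℤˣ := ![![1, -1, -1], ![-1, 1, 1], ![1, 1, 1]]

/-- The exponents of the monomial action of the `j`-th basis vector of `(ℤ/2)³` on the `i`-th
coordinate. -/
def monomialExp : Fin 3 → Fin 3 → ℤˣ := ![![1, 1, 1], ![1, 1, -1], ![-1, -1, 1]]

/-- A function that changes sign under the `j`-th basis vector only. -/
def semiInvariant {K : Type*} [Field K] (x : Fin 3 → K) : Fin 3 → K :=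
  ![x 1 + (x 1)⁻¹, x 0 + (x 0)⁻¹, x 0 ^ 2 - (x 0 ^ 2)⁻¹]

variable {k K : Type*} [Field k] [CharZero k] [Field K] [Algebra k K] {x : Fin 3 → K}

theorem semiInvariant_ne_zero (hx : AlgebraicIndependent k x) (j : Fin 3) :
    semiInvariant x j ≠ 0 := by
  have h0 : ∀ i, x i ≠ 0 := fun i => hx.ne_zero i
  have h1 : ∀ i, x i ^ 2 + 1 ≠ 0 := fun i => by
    have := aeval_ne_zero_of_eval_ne_zero hx (MvPolynomial.X i ^ 2 + 1) 0 (by simp)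
    simpa using this
  have h2 : x 0 ^ 4 - 1 ≠ 0 := by
    have := aeval_ne_zero_of_eval_ne_zero hx (MvPolynomial.X 0 ^ 4 - 1) 0 (by simp)
    simpa using this
  fin_cases j
  · intro h
    change x 1 + (x 1)⁻¹ = 0 at h
    field_simp [h0 1] at h
    exact h1 1 (by simpa using h)
  · intro h
    change x 0 + (x 0)⁻¹ = 0 at h
    field_simp [h0 0] at h
    exact h1 0 (by simpa using h)
  · intro h
    change x 0 ^ 2 - (x 0 ^ 2)⁻¹ = 0 at h
    field_simp [h0 0] at h
    exact h2 (by linear_combination h)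

omit [CharZero k] in
theorem monomial_apply {G : Type*} [Group G] {σ : G →* (K ≃ₐ[k] K)} {g : Fin 3 → G}
    (h : ∀ j i, σ (g j) (x i) = ((monomialSign j i : ℤ) : K) * x i ^ (monomialExp j i : ℤ)) :
    (σ (g 0) (x 0) = x 0 ∧ σ (g 0) (x 1) = - x 1 ∧ σ (g 0) (x 2) = - x 2) ∧
    (σ (g 1) (x 0) = - x 0 ∧ σ (g 1) (x 1) = x 1 ∧ σ (g 1) (x 2) = (x 2)⁻¹) ∧
    (σ (g 2) (x 0) = (x 0)⁻¹ ∧ σ (g 2) (x 1) = (x 1)⁻¹ ∧ σ (g 2) (x 2) = x 2) := by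
  refine ⟨⟨?_, ?_, ?_⟩, ⟨?_, ?_, ?_⟩, ?_, ?_, ?_⟩ <;> rw [h] <;> simp [monomialSign, monomialExp]

omit [CharZero k] in
theorem apply_semiInvariant {G : Type*} [Group G] {σ : G →* (K ≃ₐ[k] K)} {g : Fin 3 → G}
    (h : ∀ j i, σ (g j) (x i) = ((monomialSign j i : ℤ) : K) * x i ^ (monomialExp j i : ℤ))
    (i j : Fin 3) : σ (g i) (semiInvariant x j) =
      (if i = j then -1 else 1 : k) • semiInvariant x j := by
  obtain ⟨⟨h00, h01, -⟩, ⟨h10, h11, -⟩, h20, h21, -⟩ := monomial_apply h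
  fin_cases i <;> fin_cases j <;>
    simp [semiInvariant, h00, h01, h10, h11, h20, h21, inv_neg] <;> ring

omit [CharZero k] in
theorem apply_eq_smul_of_closure {G : Type*} [Group G] (σ : G →* (K ≃ₐ[k] K)) (χ : G →* kˣ)
    {s : Set G} (hs : Subgroup.closure s = ⊤) (f : K) (h : ∀ g ∈ s, σ g f = (χ g : k) • f) (g : G) :
    σ g f = (χ g : k) • f := by
  have hg : g ∈ Subgroup.closure s := hs ▸ Subgroup.mem_top g
  induction hg using Subgroup.closure_induction with
  | mem g hg => exact h g hg
  | one => simp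
  | mul a b _ _ ha hb =>
    rw [map_mul, AlgEquiv.mul_apply, hb, map_smul, ha, map_mul, Units.val_mul, smul_smul, mul_comm]
  | inv a _ ha =>
    have h1 : σ a⁻¹ (σ a f) = f := by rw [← AlgEquiv.mul_apply, ← map_mul]; simp
    rw [ha, map_smul] at h1
    rw [map_inv χ, Units.val_inv_eq_inv_val, eq_inv_smul_iff₀ (χ a).ne_zero, h1]

theorem closure_range_basis_eq_top {A : Type*} [AddCommGroup A] [Module (ZMod 2) A]
    (e : Basis (Fin 3) (ZMod 2) A) :
    Subgroup.closure (insert 1 (Set.range fun j => Multiplicative.ofAdd (e j))) = ⊤ :=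
  closure_eq_top_of_basis (p := MonoidHom.id (Multiplicative A)) e _
    (fun i => ⟨_, Or.inr ⟨i, rfl⟩, rfl⟩) fun _ hz => Or.inl hz

/-- The three semi-invariants realise the three coordinate characters of `A`, so an element acting
trivially has all coordinates zero. -/
theorem monomialAction_injective {A : Type*} [AddCommGroup A] [Module (ZMod 2) A]
    (e : Basis (Fin 3) (ZMod 2) A) (hx : AlgebraicIndependent k x)
    (σ : Multiplicative A →* (K ≃ₐ[k] K))
    (h : ∀ j i, σ (Multiplicative.ofAdd (e j)) (x i) =
      ((monomialSign j i : ℤ) : K) * x i ^ (monomialExp j i : ℤ)) : Function.Injective σ := by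
  have hm1 : (-1 : k) ^ 2 = 1 := by norm_num
  let ε : AddChar (ZMod 2) k := AddChar.zmodChar 2 hm1
  have hε1 : ε 1 = -1 := by simpa using AddChar.zmodChar_apply' hm1 1
  rw [injective_iff_map_eq_one]
  intro a ha
  have key : ∀ j, e.repr a.toAdd j = 0 := fun j => by
    let χ : Multiplicative A →* kˣ := MonoidHom.toHomUnits
      (ε.toMonoidHom.comp (AddMonoidHom.toMultiplicative (e.coord j).toAddMonoidHom))
    have hχ : ∀ a, (χ a : k) = ε (e.repr a.toAdd j) := fun a => rfl
    have := apply_eq_smul_of_closure σ χ (closure_range_basis_eq_top e) (semiInvariant x j)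
      (by
        rintro _ (rfl | ⟨i, rfl⟩)
        · simp
        · rw [apply_semiInvariant (g := fun j => Multiplicative.ofAdd (e j)) h, hχ]
          congr 1
          simp only [toAdd_ofAdd, Basis.repr_self, Finsupp.single_apply]
          split_ifs
          · exact hε1.symm
          · exact ε.map_zero_eq_one.symm) a
    rw [ha, AlgEquiv.one_apply] at this
    have h1 : (1 : k) • semiInvariant x j = (χ a : k) • semiInvariant x j := by rwa [one_smul]
    have h2 := smul_left_injective k (semiInvariant_ne_zero hx j) h1
    rw [hχ] at h2
    by_contra h3
    have h4 : e.repr a.toAdd j = 1 := by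
      generalize e.repr a.toAdd j = b at h3
      revert b; decide
    rw [h4, hε1] at h2
    norm_num at h2
  exact Multiplicative.toAdd.injective (e.repr.injective (Finsupp.ext fun j => by simp [key j]))

/-- A Cayley transform turns inversion into a sign change, so the action becomes linear: on `P` and
`Q`, which come from `x 1 / x 2` and `x 1 * x 2`, it is a signed permutation, and on `Y`, which
comes from `x 0 ^ 2`, it is a sign. -/
theorem isRational_invariants_monomial {G : Type*} [Group G] [Finite G] (hG : 8 ≤ Nat.card G)
    (hx : AlgebraicIndependent k x) (hxK : IntermediateField.adjoin k (Set.range x) = ⊤)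
    (σ : G →* (K ≃ₐ[k] K)) (hσ : Function.Injective σ) (g : Fin 3 → G)
    (hg : Subgroup.closure (insert 1 (Set.range g)) = ⊤)
    (h : ∀ j i, σ (g j) (x i) = ((monomialSign j i : ℤ) : K) * x i ^ (monomialExp j i : ℤ)) :
    IsRational k (Invariants σ) := by
  obtain ⟨⟨h00, h01, h02⟩, ⟨h10, h11, h12⟩, h20, h21, h22⟩ := monomial_apply h
  have n0 : x 0 ≠ 0 := hx.ne_zero 0
  have n1 : x 1 ≠ 0 := hx.ne_zero 1
  have n2 : x 2 ≠ 0 := hx.ne_zero 2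
  have char : (2 : K) ≠ 0 := by
    have := (algebraMap k K).injective.ne (two_ne_zero (α := k))
    simpa only [map_ofNat, map_zero] using this
  have m1 : x 2 + x 1 ≠ 0 := by
    have := aeval_ne_zero_of_eval_ne_zero hx (MvPolynomial.X 2 + MvPolynomial.X 1) 1
      (by simp [one_add_one_eq_two])
    simpa using this
  have m2 : 1 + x 1 * x 2 ≠ 0 := by
    have := aeval_ne_zero_of_eval_ne_zero hx (1 + MvPolynomial.X 1 * MvPolynomial.X 2) 0 (by simp)
    simpa using this
  have m3 : 1 + x 0 ^ 2 ≠ 0 := by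
    have := aeval_ne_zero_of_eval_ne_zero hx (1 + MvPolynomial.X 0 ^ 2) 0 (by simp)
    simpa using this
  have m4 : 1 - x 0 ^ 2 ≠ 0 := by
    have := aeval_ne_zero_of_eval_ne_zero hx (1 - MvPolynomial.X 0 ^ 2) 0 (by simp)
    simpa using this
  set P := (x 2 - x 1) / (x 2 + x 1) with hP
  set Q := (1 - x 1 * x 2) / (1 + x 1 * x 2) with hQ
  set Y := (1 - x 0 ^ 2) / (1 + x 0 ^ 2) with hY
  set s := (1 + x 0 ^ 2) / x 0 with hs
  have m1' : x 1 + x 2 ≠ 0 := by rwa [add_comm]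
  have m2' : x 1 * x 2 + 1 ≠ 0 := by rwa [add_comm]
  have m3' : x 0 ^ 2 + 1 ≠ 0 := by rwa [add_comm]
  have hP0 : σ (g 0) P = P := by
    rw [hP]; simp only [map_div₀, map_sub, map_add, h01, h02]
    rw [← neg_add, neg_sub_neg, ← neg_sub (x 2), neg_div_neg_eq]
  have hQ0 : σ (g 0) Q = Q := by
    rw [hQ]; simp only [map_div₀, map_sub, map_add, map_one, map_mul, h01, h02]; ring
  have hY0 : σ (g 0) Y = Y := by
    rw [hY]; simp only [map_div₀, map_sub, map_add, map_one, map_pow, h00]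
  have hs0 : σ (g 0) s = s := by
    rw [hs]; simp only [map_div₀, map_add, map_one, map_pow, h00]
  have hP1 : σ (g 1) P = Q := by
    rw [hP, hQ]; simp only [map_div₀, map_sub, map_add, h11, h12]
    field_simp
  have hQ1 : σ (g 1) Q = P := by
    rw [hP, hQ]; simp only [map_div₀, map_sub, map_add, map_one, map_mul, h11, h12]
    field_simp
  have hY1 : σ (g 1) Y = Y := by
    rw [hY]; simp only [map_div₀, map_sub, map_add, map_one, map_pow, h10]; ring
  have hs1 : σ (g 1) s = - s := by
    rw [hs]; simp only [map_div₀, map_add, map_one, map_pow, h10]; rw [div_neg, neg_sq]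
  have hP2 : σ (g 2) P = - Q := by
    rw [hP, hQ]; simp only [map_div₀, map_sub, map_add, h21, h22]
    field_simp
    ring
  have hQ2 : σ (g 2) Q = - P := by
    rw [hP, hQ]; simp only [map_div₀, map_sub, map_add, map_one, map_mul, h21, h22]
    field_simp
    ring
  have hY2 : σ (g 2) Y = - Y := by
    rw [hY]; simp only [map_div₀, map_sub, map_add, map_one, map_pow, h20]
    field_simp
    ring
  have hs2 : σ (g 2) s = s := by
    rw [hs]; simp only [map_div₀, map_add, map_one, map_pow, h20]
    field_simp
    ring
  have hY0' : Y ≠ 0 := div_ne_zero m4 m3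
  have hs0' : s ≠ 0 := div_ne_zero m3 n0
  -- `P - Q` and `s` change sign only under `g 1`, while `P + Q` and `Y` change sign only under `g
  -- 2`.
  set y : Fin 3 → K := ![(P - Q) * s, (P + Q) * Y, Y ^ 2] with hy
  have hinv : ∀ g i, σ g (y i) = y i := fun a i =>
    fixed_of_closure_eq_top σ hg _ (by
      rintro _ (rfl | ⟨j, rfl⟩)
      · simp
      · fin_cases j <;> fin_cases i <;>
          simp only [hy, Fin.zero_eta, Fin.mk_one, Fin.reduceFinMk, Matrix.cons_val, map_mul,
            map_sub, map_add, map_pow, hP0, hQ0, hY0, hs0, hP1, hQ1, hY1, hs1, hP2, hQ2, hY2,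
            hs2] <;> ring) a
  refine isRational_invariants_of_rank_le σ hσ
    (trdeg_eq_of_algebraicIndependent x hx hxK) y hinv ?_
  set B := IntermediateField.adjoin k (Set.range y) with hB
  have hyB : ∀ i, y i ∈ B.toSubfield := fun i => IntermediateField.subset_adjoin k _ ⟨i, rfl⟩
  -- Square roots are adjoined for `Y`, then `x 0`, then `x 2`. The first two give back `P` and `Q`,
  -- hence `x 1 / x 2` and `x 1 * x 2`, whose quotient is `x 2 ^ 2`.
  have hrank : Module.rank B.toSubfield K ≤ (2 * (2 * (2 * 1)) : ℕ) := by
    refine rank_le_mul_of_pow_mem _ Y two_ne_zero (hyB 2) fun A₁ hA₁ hYA => ?_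
    have hX : x 0 ^ 2 = (1 - Y) / (1 + Y) := by
      have : 1 + Y ≠ 0 := by
        have : 1 + Y = 2 / (1 + x 0 ^ 2) := by rw [hY]; field_simp; ring
        rw [this]; exact div_ne_zero char m3
      rw [eq_div_iff this, hY]; field_simp; ring
    refine rank_le_mul_of_pow_mem A₁ (x 0) two_ne_zero (by
      rw [hX]; exact div_mem (sub_mem A₁.one_mem hYA) (add_mem A₁.one_mem hYA))
      fun A₂ hA₂ hx0 => ?_
    have hsA : s ∈ A₂ := div_mem (add_mem A₂.one_mem (pow_mem hx0 2)) hx0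
    have hb : P - Q ∈ A₂ := by
      have : P - Q = y 0 / s := (mul_div_cancel_right₀ _ hs0').symm
      rw [this]; exact div_mem (hA₂ (hA₁ (hyB 0))) hsA
    have ha : P + Q ∈ A₂ := by
      have : P + Q = y 1 / Y := (mul_div_cancel_right₀ _ hY0').symm
      rw [this]; exact div_mem (hA₂ (hA₁ (hyB 1))) (hA₂ hYA)
    have h2 : (2 : K) ∈ A₂ := by
      rw [← one_add_one_eq_two]; exact add_mem A₂.one_mem A₂.one_mem
    have hPA : P ∈ A₂ := by
      have : P = ((P + Q) + (P - Q)) / 2 := by field_simp; ring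
      rw [this]; exact div_mem (add_mem ha hb) h2
    have hQA : Q ∈ A₂ := by
      have : Q = ((P + Q) - (P - Q)) / 2 := by field_simp; ring
      rw [this]; exact div_mem (sub_mem ha hb) h2
    have hp : x 1 / x 2 = (1 - P) / (1 + P) := by
      have : 1 + P ≠ 0 := by
        have : 1 + P = 2 * x 2 / (x 2 + x 1) := by rw [hP]; field_simp; ring
        rw [this]; exact div_ne_zero (mul_ne_zero char n2) m1
      rw [div_eq_div_iff n2 this, hP]; field_simp; ring
    have hq : x 1 * x 2 = (1 - Q) / (1 + Q) := by
      have : 1 + Q ≠ 0 := by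
        have : 1 + Q = 2 / (1 + x 1 * x 2) := by rw [hQ]; field_simp; ring
        rw [this]; exact div_ne_zero char m2
      rw [eq_div_iff this, hQ]; field_simp; ring
    have hpA : x 1 / x 2 ∈ A₂ := by
      rw [hp]; exact div_mem (sub_mem A₂.one_mem hPA) (add_mem A₂.one_mem hPA)
    have hqA : x 1 * x 2 ∈ A₂ := by
      rw [hq]; exact div_mem (sub_mem A₂.one_mem hQA) (add_mem A₂.one_mem hQA)
    refine rank_le_mul_of_pow_mem A₂ (x 2) two_ne_zero (by
      have : x 2 ^ 2 = (x 1 * x 2) / (x 1 / x 2) := by field_simp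
      rw [this]; exact div_mem hqA hpA) fun A₃ hA₃ hx2 => ?_
    refine rank_le_one_of_top_le _ (top_le_of_adjoin_eq_top hxK A₃
      (fun c => hA₃ (hA₂ (hA₁ (B.algebraMap_mem c)))) fun i => ?_)
    fin_cases i
    · exact hA₃ hx0
    · have : x 1 = x 1 / x 2 * x 2 := by field_simp
      change x 1 ∈ A₃
      rw [this]; exact mul_mem (hA₃ hpA) hx2
    · exact hx2
  exact hrank.trans (by exact_mod_cast hG)

end Monomial

end

section

open Module

/-! ### From three planes to the monomial action -/

section Restrict

variable {k K E F : Type*} [Field k] [Field K] [Field E] [Algebra k K] [Algebra k E] [Group F]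

theorem exists_restrict (φ : K →ₐ[k] E) (β : F →* (E ≃ₐ[k] E))
    (h : ∀ g f, ∃ f', φ f' = β g (φ f)) :
    ∃ σ : F →* (K ≃ₐ[k] K), ∀ g f, φ (σ g f) = β g (φ f) := by
  choose r hr using h
  have hinj : Function.Injective φ := φ.injective
  let m : F →* (K →ₐ[k] K) :=
    { toFun := fun g =>
        { toFun := r g
          map_one' := hinj (by simp [hr])
          map_mul' := fun a b => hinj (by simp [hr])
          map_zero' := hinj (by simp [hr])
          map_add' := fun a b => hinj (by simp [hr])
          commutes' := fun c => hinj (by simp [hr]) }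
      map_one' := AlgHom.ext fun a => hinj (by
        change φ (r 1 a) = φ a
        simp [hr])
      map_mul' := fun g h => AlgHom.ext fun a => hinj (by
        change φ (r (g * h) a) = φ (r g (r h a))
        simp [hr]) }
  exact ⟨(AlgEquiv.algHomUnitsEquiv k K).toMonoidHom.comp m.toHomUnits, fun g f => hr g f⟩

theorem exists_monomial_of_closure (β : F →* (E ≃ₐ[k] E)) {s : Set F}
    (hs : Subgroup.closure s = ⊤) (x : E)
    (h : ∀ g ∈ s, ∃ c a : ℤˣ, β g x = ((c : ℤ) : E) * x ^ (a : ℤ)) (g : F) :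
    ∃ c a : ℤˣ, β g x = ((c : ℤ) : E) * x ^ (a : ℤ) := by
  have hg : g ∈ Subgroup.closure s := hs ▸ Subgroup.mem_top g
  induction hg using Subgroup.closure_induction with
  | mem g hg => exact h g hg
  | one => exact ⟨1, 1, by simp⟩
  | mul u v _ _ hu hv =>
    obtain ⟨c, a, h1⟩ := hu
    obtain ⟨d, b, h2⟩ := hv
    refine ⟨c * d, a * b, ?_⟩
    rw [map_mul, AlgEquiv.mul_apply, h2, map_mul, map_zpow₀, h1, map_intCast]
    rcases Int.units_eq_one_or c with rfl | rfl <;> rcases Int.units_eq_one_or d with rfl | rfl <;>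
      rcases Int.units_eq_one_or a with rfl | rfl <;>
      rcases Int.units_eq_one_or b with rfl | rfl <;> simp [inv_neg]
  | inv u _ hu =>
    obtain ⟨c, a, h1⟩ := hu
    -- Each substitution of `c * x ^ a` for `x` with `c, a = ±1` is an involution, so the inverse
    -- element acts by the same monomial.
    have h2 : ((c : ℤ) : E) * (((c : ℤ) : E) * x ^ (a : ℤ)) ^ (a : ℤ) = x := by
      rcases Int.units_eq_one_or c with rfl | rfl <;>
        rcases Int.units_eq_one_or a with rfl | rfl <;> simp [inv_neg]
    refine ⟨c, a, ?_⟩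
    have h3 : β u (((c : ℤ) : E) * x ^ (a : ℤ)) = x := by
      rw [map_mul, map_zpow₀, h1, map_intCast, h2]
    calc β u⁻¹ x = β u⁻¹ (β u (((c : ℤ) : E) * x ^ (a : ℤ))) := by rw [h3]
      _ = _ := by rw [← AlgEquiv.mul_apply, ← map_mul]; simp

end Restrict

section MonomialReduction

variable {k : Type*} [Field k] [CharZero k] {E : Type*} [Field E] [Algebra k E] {y z : Fin 3 → E}

omit [CharZero k] in
-- The six elements `y i / z i` and `z i` generate the same field of transcendence degree six.
theorem algebraicIndependent_div (hind : AlgebraicIndependent k (Sum.elim y z))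
    (hadj : IntermediateField.adjoin k (Set.range (Sum.elim y z)) = ⊤) :
    AlgebraicIndependent k fun i => y i / z i := by
  have hz : ∀ i, z i ≠ 0 := fun i => hind.ne_zero (Sum.inr i)
  let e := finSumFinEquiv (m := 3) (n := 3)
  set f : Fin (3 + 3) → E := Sum.elim (fun i => y i / z i) z ∘ e.symm with hf
  have htop : IntermediateField.adjoin k (Set.range f) = ⊤ := by
    rw [eq_top_iff, ← hadj, IntermediateField.adjoin_le_iff]
    have h1 : ∀ i, f (e i) ∈ IntermediateField.adjoin k (Set.range f) := fun i =>
      IntermediateField.subset_adjoin _ _ ⟨_, rfl⟩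
    rintro _ ⟨i | i, rfl⟩
    · have h2 := mul_mem (h1 (Sum.inl i)) (h1 (Sum.inr i))
      simpa [hf, div_mul_cancel₀ _ (hz i)] using h2
    · simpa [hf] using h1 (Sum.inr i)
  have halg : Algebra.IsAlgebraic (IntermediateField.adjoin k (Set.range f)) E := by
    rw [htop]
    exact ⟨fun a => isAlgebraic_algebraMap (⟨a, trivial⟩ : (⊤ : IntermediateField k E))⟩
  have h1 := algebraicIndependent_of_trdeg f (by
    rw [trdeg_eq_of_algebraicIndependent _ hind hadj]; simp)
  have h2 := (h1.comp e e.injective).comp Sum.inl Sum.inl_injective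
  convert h2 using 2 with i
  simp [hf]

variable {A : Type*} [AddCommGroup A] [Module (ZMod 2) A] (e : Basis (Fin 3) (ZMod 2) A)
  {F : Type*} [Group F] {p : F →* Multiplicative A} (β : F →* (E ≃ₐ[k] E)) (g : Fin 3 → F)

include e in
theorem exists_monomialAction (hp : Function.Surjective p)
    (hg : ∀ j, p (g j) = Multiplicative.ofAdd (e j)) {x : Fin 3 → E}
    (hx : AlgebraicIndependent k x)
    (hker : ∀ n ∈ p.ker, ∀ i, β n (x i) = x i)
    (hβ : ∀ j i, β (g j) (x i) = ((monomialSign j i : ℤ) : E) * x i ^ (monomialExp j i : ℤ)) :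
    ∃ (σ : Multiplicative A →* (RatField 3 k ≃ₐ[k] RatField 3 k)) (φ : RatField 3 k →ₐ[k] E)
      (c a : Fin 3 → Multiplicative A → ℤˣ), Function.Injective σ ∧
      (∀ g i, σ g (ratVar k i) =
        algebraMap k _ ((c i g : ℤ) : k) * ratVar k i ^ (a i g : ℤ)) ∧
      (∀ i, φ (ratVar k i) = x i) ∧ (∀ g f, φ (σ (p g) f) = β g (φ f)) ∧
      IsRational k (Invariants σ) := by
  obtain ⟨φ, hφ⟩ := exists_algHom_of_algebraicIndependent (algebraicIndependent_ratVar k 3)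
    (adjoin_ratVar k 3) hx
  have hinj : Function.Injective φ := φ.injective
  have hgen : Subgroup.closure (Set.range g ∪ p.ker) = ⊤ :=
    closure_eq_top_of_basis e _ (fun i => ⟨g i, Or.inl ⟨i, rfl⟩, by rw [hg]; rfl⟩)
      Set.subset_union_right
  have hmon : ∀ i h, ∃ c a : ℤˣ, β h (x i) = ((c : ℤ) : E) * x i ^ (a : ℤ) := fun i =>
    exists_monomial_of_closure β hgen (x i) (by
      rintro _ (⟨j, rfl⟩ | hn)
      · exact ⟨_, _, hβ j i⟩
      · exact ⟨1, 1, by simp [hker _ hn]⟩)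
  obtain ⟨σ', hσ'⟩ := exists_restrict φ β (fun h f => by
    have h1 : (⊤ : IntermediateField k (RatField 3 k)) ≤
        φ.fieldRange.comap ((β h : E →ₐ[k] E).comp φ) := by
      rw [← adjoin_ratVar k 3, IntermediateField.adjoin_le_iff]
      rintro _ ⟨i, rfl⟩
      obtain ⟨c, a, hca⟩ := hmon i h
      refine ⟨((c : ℤ) : RatField 3 k) * ratVar k i ^ (a : ℤ), ?_⟩
      change φ _ = β h (φ (ratVar k i))
      rw [hφ, hca, map_mul, map_zpow₀, hφ, map_intCast]
    exact h1 (x := f) trivial)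
  -- The kernel of `p` fixes the generators `x i`, so the action of `F` on `k(x)` descends to `A`.
  have hker' : p.ker ≤ σ'.ker := fun n hn => by
    rw [MonoidHom.mem_ker]
    have : ((σ' n : RatField 3 k ≃ₐ[k] RatField 3 k) : RatField 3 k →ₐ[k] RatField 3 k) =
        AlgHom.id k _ := by
      have h1 : (⊤ : Subalgebra k (RatField 3 k)) ≤ AlgHom.equalizer (φ.comp (σ' n :
          RatField 3 k →ₐ[k] RatField 3 k)) φ := by
        have h2 : (⊤ : IntermediateField k (RatField 3 k)) ≤
            { AlgHom.equalizer (φ.comp (σ' n : RatField 3 k →ₐ[k] RatField 3 k)) φ with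
              inv_mem' := fun x hx => by
                change φ (σ' n x⁻¹) = φ x⁻¹
                have : φ (σ' n x) = φ x := hx
                rw [map_inv₀, map_inv₀, map_inv₀, this] } := by
          rw [← adjoin_ratVar k 3, IntermediateField.adjoin_le_iff]
          rintro _ ⟨i, rfl⟩
          change φ (σ' n (ratVar k i)) = φ (ratVar k i)
          rw [hσ', hφ, hker n hn]
        exact h2
      exact AlgHom.ext fun a => hinj (h1 (x := a) trivial)
    exact AlgEquiv.ext fun a => DFunLike.congr_fun this a
  let σ := p.liftOfSurjective hp ⟨σ', hker'⟩
  have hσp : ∀ h, σ (p h) = σ' h := fun h =>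
    MonoidHom.liftOfRightInverse_comp_apply _ _ _ ⟨σ', hker'⟩ h
  have hσ : ∀ h f, φ (σ (p h) f) = β h (φ f) := fun h f => by rw [hσp, hσ']
  have hmonσ : ∀ i α, ∃ c a : ℤˣ, σ α (ratVar k i) =
      algebraMap k _ ((c : ℤ) : k) * ratVar k i ^ (a : ℤ) := fun i α => by
    obtain ⟨h, rfl⟩ := hp α
    obtain ⟨c, a, hca⟩ := hmon i h
    refine ⟨c, a, hinj ?_⟩
    rw [hσ, hφ, hca, map_mul, map_zpow₀, hφ, map_intCast, map_intCast]
  choose c a hca using hmonσ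
  have hσe : ∀ j i, σ (Multiplicative.ofAdd (e j)) (ratVar k i) =
      ((monomialSign j i : ℤ) : RatField 3 k) * ratVar k i ^ (monomialExp j i : ℤ) := fun j i => by
    refine hinj ?_
    rw [← hg, hσ, hφ, hβ, map_mul, map_zpow₀, hφ, map_intCast]
  have hσinj := monomialAction_injective e (algebraicIndependent_ratVar k 3) σ hσe
  have hA : Finite A := Finite.of_equiv _ e.equivFun.symm.toEquiv
  refine ⟨σ, φ, c, a, hσinj, fun g i => hca i g, hφ, hσ, ?_⟩
  have hA' : Finite (Multiplicative A) := hA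
  refine isRational_invariants_monomial (g := fun j => Multiplicative.ofAdd (e j)) ?_
    (algebraicIndependent_ratVar k 3) (adjoin_ratVar k 3) σ hσinj
    (closure_range_basis_eq_top e) hσe
  change 8 ≤ Nat.card A
  rw [Nat.card_congr e.equivFun.toEquiv]
  simp

include e in
-- The form `y i ^ 2 + z i ^ 2` is an eigenvector of each `g j`, with eigenvalue `±1`. Multiplying
-- it by an element of `k(x)` with the same signs gives invariants `t i`. Over `k(x)(t)` the field
-- is generated by the square roots `z i`, so the degree is at most `8`, and `8 * 8 = 64`.
theorem nonempty_invariants_algEquiv_of_monomial [Finite F] (hF : Nat.card F = 64)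
    (hβinj : Function.Injective β)
    (hg : ∀ j, p (g j) = Multiplicative.ofAdd (e j))
    (hind : AlgebraicIndependent k (Sum.elim y z))
    (hadj : IntermediateField.adjoin k (Set.range (Sum.elim y z)) = ⊤)
    (hker : ∀ n ∈ p.ker, ∀ i, ∃ s : k, s ^ 2 = 1 ∧ β n (y i) = s • y i ∧ β n (z i) = s • z i)
    (hβ : ∀ j i, β (g j) (y i / z i) =
      ((monomialSign j i : ℤ) : E) * (y i / z i) ^ (monomialExp j i : ℤ))
    (ε : Fin 3 → Fin 3 → ℤˣ)
    (hε : ∀ j i, β (g j) (y i ^ 2 + z i ^ 2) = ((ε j i : ℤ) : E) * (y i ^ 2 + z i ^ 2))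
    (σ : Multiplicative A →* (RatField 3 k ≃ₐ[k] RatField 3 k)) (φ : RatField 3 k →ₐ[k] E)
    (hσ : Function.Injective σ) (hφ : ∀ i, φ (ratVar k i) = y i / z i)
    (hφβ : ∀ g f, φ (σ (p g) f) = β g (φ f)) :
    Nonempty (Invariants β ≃ₐ[k] RatField 3 (Invariants σ)) := by
  have hx := algebraicIndependent_div hind hadj
  have hz : ∀ i, z i ≠ 0 := fun i => hind.ne_zero (Sum.inr i)
  set x : Fin 3 → E := fun i => y i / z i with hxdef
  -- The `j`-th semi-invariant changes sign under `g j` alone, so including it exactly when `ε j i =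
  -- -1` reproduces the signs of the quadratic form.
  let m : Fin 3 → E := fun i => ∏ j, if ε j i = 1 then 1 else semiInvariant x j
  have hm0 : ∀ i, m i ≠ 0 := fun i => Finset.prod_ne_zero_iff.2 fun j _ => by
    split_ifs
    exacts [one_ne_zero, semiInvariant_ne_zero hx j]
  have hmg : ∀ l i, β (g l) (m i) = ((ε l i : ℤ) : E) * m i := fun l i => by
    have h1 : ∀ j, β (g l) (if ε j i = 1 then 1 else semiInvariant x j) =
        (if l = j then ((ε j i : ℤ) : E) else 1) * if ε j i = 1 then 1 else semiInvariant x j := by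
      intro j
      rcases Int.units_eq_one_or (ε j i) with h | h
      · simp [h]
      · rw [h, if_neg (by decide), apply_semiInvariant (x := x) hβ]
        split_ifs <;> simp
    simp only [m, map_prod, h1, Finset.prod_mul_distrib]
    simp
  have hmn : ∀ n ∈ p.ker, ∀ i, β n (x i) = x i := fun n hn i => by
    obtain ⟨s, hs, h1, h2⟩ := hker n hn i
    have hs0 : s ≠ 0 := by rintro rfl; simp at hs
    rw [hxdef]
    simp only [map_div₀, h1, h2, Algebra.smul_def]
    exact mul_div_mul_left _ _ (by simpa using hs0)
  let t : Fin 3 → E := fun i => (y i ^ 2 + z i ^ 2) * m i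
  have hgen : Subgroup.closure (Set.range g ∪ p.ker) = ⊤ :=
    closure_eq_top_of_basis e _ (fun i => ⟨g i, Or.inl ⟨i, rfl⟩, by rw [hg]; rfl⟩)
      Set.subset_union_right
  have ht : ∀ h i, β h (t i) = t i := fun h i => fixed_of_closure_eq_top β hgen _ (by
    intro n hn
    rcases hn with ⟨j, rfl⟩ | hn
    · simp only [t]
      rw [map_mul, hε, hmg, mul_mul_mul_comm, ← Int.cast_mul, ← Units.val_mul,
        Int.units_mul_self]
      simp
    · obtain ⟨s, hs, h1, h2⟩ := hker _ hn i
      have h3 := hmn _ hn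
      have h4 : β n (m i) = m i := by
        simp only [m, map_prod]
        refine Finset.prod_congr rfl fun j _ => ?_
        split_ifs
        · exact map_one _
        · fin_cases j <;> simp [semiInvariant, h3]
      simp only [t]
      rw [map_mul, h4, map_add, map_pow, map_pow, h1, h2, smul_pow, smul_pow, hs, one_smul,
        one_smul]) h
  let _ : Algebra (RatField 3 k) E := φ.toRingHom.toAlgebra
  have _ : IsScalarTower k (RatField 3 k) E :=
    IsScalarTower.of_algebraMap_eq fun r => (φ.commutes r).symm
  have htr : Algebra.trdeg (RatField 3 k) E = (3 : ℕ) := by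
    have h1 := lift_trdeg_add_eq k (RatField 3 k) E
    rw [trdeg_eq_of_algebraicIndependent _ hind hadj,
      trdeg_eq_of_algebraicIndependent _ (algebraicIndependent_ratVar k 3) (adjoin_ratVar k 3)] at h1
    simp only [Fintype.card_fin, Fintype.card_sum, Nat.cast_add, Cardinal.lift_add,
      Cardinal.lift_natCast] at h1
    have h2 := Cardinal.eq_of_add_eq_add_left h1 (Cardinal.natCast_lt_aleph0)
    simpa using h2
  have hA : Finite (Multiplicative A) := Finite.of_equiv _ e.equivFun.symm.toEquiv
  have hA' : Nat.card (Multiplicative A) = 8 := by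
    change Nat.card A = 8
    rw [Nat.card_congr e.equivFun.toEquiv]
    simp
  refine nonempty_invariants_algEquiv_ratField σ hσ β hβinj p (fun h f => (hφβ h f).symm) htr t ht
    (N := 2 * (2 * (2 * 1))) ?_ (by rw [hA', hF])
  set B := (IntermediateField.adjoin (RatField 3 k) (Set.range t)).toSubfield with hB
  have hKB : ∀ f, φ f ∈ B := fun f => IntermediateField.algebraMap_mem _ f
  have hxB : ∀ i, x i ∈ B := fun i => by
    have := hKB (ratVar k i)
    rwa [hφ] at this
  have hmB : ∀ i, m i ∈ B := fun i => prod_mem fun j _ => by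
    split_ifs
    · exact B.one_mem
    · fin_cases j
      · exact add_mem (hxB 1) (inv_mem (hxB 1))
      · exact add_mem (hxB 0) (inv_mem (hxB 0))
      · exact sub_mem (pow_mem (hxB 0) 2) (inv_mem (pow_mem (hxB 0) 2))
  have hzB : ∀ i, z i ^ 2 ∈ B := fun i => by
    have h0 : x i ^ 2 + 1 ≠ 0 := by
      have := aeval_ne_zero_of_eval_ne_zero hx (MvPolynomial.X i ^ 2 + 1) 0 (by simp)
      simpa using this
    have h1 : z i ^ 2 = t i / m i / (x i ^ 2 + 1) := by
      have h2 : y i ^ 2 + z i ^ 2 = z i ^ 2 * (x i ^ 2 + 1) := by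
        have := hz i
        simp only [hxdef]; field_simp
      rw [show t i = (y i ^ 2 + z i ^ 2) * m i from rfl, mul_div_cancel_right₀ _ (hm0 i), h2,
        mul_div_cancel_right₀ _ h0]
    rw [h1]
    exact div_mem (div_mem (IntermediateField.subset_adjoin _ _ ⟨i, rfl⟩) (hmB i))
      (add_mem (pow_mem (hxB i) 2) B.one_mem)
  refine rank_le_mul_of_pow_mem B (z 0) two_ne_zero (hzB 0) fun A₁ hA₁ hz0 => ?_
  refine rank_le_mul_of_pow_mem A₁ (z 1) two_ne_zero (hA₁ (hzB 1)) fun A₂ hA₂ hz1 => ?_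
  refine rank_le_mul_of_pow_mem A₂ (z 2) two_ne_zero (hA₂ (hA₁ (hzB 2))) fun A₃ hA₃ hz2 => ?_
  have hB₃ : B ≤ A₃ := hA₁.trans (hA₂.trans hA₃)
  have hz3 : ∀ i, z i ∈ A₃ := fun i => by
    fin_cases i
    exacts [hA₃ (hA₂ hz0), hA₃ hz1, hz2]
  refine rank_le_one_of_top_le _ (top_le_of_adjoin_eq_top hadj A₃ (fun c => hB₃ ?_) ?_)
  · rw [← φ.commutes]; exact hKB _
  · rintro (i | i)
    · have : y i = x i * z i := (div_mul_cancel₀ _ (hz i)).symm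
      change y i ∈ A₃
      rw [this]
      exact mul_mem (hB₃ (hxB i)) (hz3 i)
    · exact hz3 i

end MonomialReduction

end

section

open Module

/-! ### Monomial coordinates on the three planes -/

section Eigenbasis

/-- An anticommuting pair on a plane acts like Pauli matrices up to scalars: `S` exchanges the two
eigenlines of `D`. Anything commuting with both preserves these lines and has the same eigenvalue on
them. -/
theorem exists_eigenbasis {k M : Type*} [Field k] [IsAlgClosed k] [CharZero k] [AddCommGroup M]
    [Module k M] (hdim : finrank k M = 2) (D S C : Module.End k M) (δ₁ δ₂ δ₃ : ℤˣ)
    (hD : D * D = ((δ₁ : ℤ) : k) • 1) (hS : S * S = ((δ₂ : ℤ) : k) • 1)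
    (hC : C * C = ((δ₃ : ℤ) : k) • 1) (hDS : D * S = -(S * D)) (hDC : D * C = C * D)
    (hSC : S * C = C * S) : ∃ (y z : M) (c d a : k), LinearIndependent k ![y, z] ∧
      (c ^ 2 = ((δ₁ : ℤ) : k) ∧ D y = c • y ∧ D z = -(c • z)) ∧
      (d ^ 2 = ((δ₂ : ℤ) : k) ∧ S y = d • z ∧ S z = d • y) ∧
      (a ^ 2 = ((δ₃ : ℤ) : k) ∧ C y = a • y ∧ C z = a • z) := by
  have hfd : FiniteDimensional k M := .of_finrank_eq_succ hdim
  have hnt : Nontrivial M := nontrivial_of_finrank_eq_succ hdim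
  have hδ : ∀ δ : ℤˣ, ((δ : ℤ) : k) ≠ 0 := fun δ => by exact_mod_cast δ.ne_zero
  obtain ⟨c, hc⟩ := Module.End.exists_eigenvalue D
  obtain ⟨y, hy⟩ := hc.exists_hasEigenvector
  have hDy : D y = c • y := hy.apply_eq_smul
  have hsq : ∀ (B : Module.End k M) (b δ : k), B * B = δ • 1 → B y = b • y → b ^ 2 = δ := by
    intro B b δ hB hb
    have h1 := LinearMap.congr_fun hB y
    rw [Module.End.mul_apply, hb, map_smul, hb, smul_smul, ← sq] at h1
    exact smul_left_injective k hy.2 h1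
  have hc2 := hsq D c _ hD hDy
  have hc0 : c ≠ 0 := by
    rintro rfl
    exact hδ δ₁ (by rw [← hc2]; simp)
  obtain ⟨d, hd⟩ := IsAlgClosed.exists_pow_nat_eq ((δ₂ : ℤ) : k) two_pos
  have hd0 : d ≠ 0 := by
    rintro rfl
    exact hδ δ₂ (by rw [← hd]; simp)
  set z := d⁻¹ • S y with hz
  have hSy : S y = d • z := by rw [hz, smul_smul, mul_inv_cancel₀ hd0, one_smul]
  have hSz : S z = d • y := by
    have h1 := LinearMap.congr_fun hS y
    rw [Module.End.mul_apply, LinearMap.smul_apply, Module.End.one_apply] at h1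
    rw [hz, map_smul, h1, ← hd, smul_smul, sq, inv_mul_cancel_left₀ hd0]
  have hz0 : z ≠ 0 := fun h => by
    rw [h, map_zero] at hSz
    exact hy.2 ((smul_eq_zero.1 hSz.symm).resolve_left hd0)
  have hDz : D z = (-c) • z := by
    have h1 := LinearMap.congr_fun hDS y
    rw [Module.End.mul_apply, LinearMap.neg_apply, Module.End.mul_apply, hDy, map_smul] at h1
    rw [hz, map_smul, h1, neg_smul, smul_neg, smul_comm]
  have hcc : c ≠ -c := fun h => hc0 (self_eq_neg.1 h)
  have hli : LinearIndependent k ![y, z] := by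
    refine Module.End.eigenvectors_linearIndependent' D ![c, -c] (fun i j hij => ?_) _ fun i => ?_
    · fin_cases i <;> fin_cases j <;> first | rfl | exact absurd hij hcc | exact absurd hij.symm hcc
    · fin_cases i
      · exact hy
      · exact ⟨Module.End.mem_eigenspace_iff.2 hDz, hz0⟩
  have hspan : C y ∈ Submodule.span k {y, z} := by
    have h1 := hli.span_eq_top_of_card_eq_finrank (by rw [hdim]; rfl)
    rw [Matrix.range_cons, Matrix.range_cons, Matrix.range_empty, Set.union_empty,
      Set.singleton_union] at h1
    rw [h1]; trivial
  obtain ⟨a, b, hab⟩ := Submodule.mem_span_pair.1 hspan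
  have hCy : C y = a • y := by
    have h1 := LinearMap.congr_fun hDC y
    rw [Module.End.mul_apply, Module.End.mul_apply, hDy, map_smul, ← hab, map_add, map_smul,
      map_smul, hDy, hDz, smul_add, smul_comm a c y, add_right_inj, neg_smul, smul_neg,
      smul_comm c b z, neg_eq_iff_add_eq_zero, ← two_smul k, smul_smul, smul_smul] at h1
    have h2 : b = 0 := by
      have := (smul_eq_zero.1 h1).resolve_right hz0
      simpa [hc0] using this
    rw [← hab, h2, zero_smul, add_zero]
  have hCz : C z = a • z := by
    have h1 := LinearMap.congr_fun hSC y
    rw [Module.End.mul_apply, Module.End.mul_apply, hCy, map_smul] at h1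
    rw [hz, map_smul, ← h1, smul_comm]
  exact ⟨y, z, c, d, a, hli, ⟨hc2, hDy, by rw [hDz, neg_smul]⟩, ⟨hd, hSy, hSz⟩,
    hsq C a _ hC hCy, hCy, hCz⟩

end Eigenbasis

section Product

variable {k : Type*} [Field k] {V : Fin 3 → Type*} [∀ i, AddCommGroup (V i)]
  [∀ i, Module k (V i)]

theorem linearIndependent_comp_proj (y z : ∀ i, Dual k (V i))
    (h : ∀ i, LinearIndependent k ![y i, z i]) :
    LinearIndependent k (Sum.elim (fun i => y i ∘ₗ LinearMap.proj i)
      (fun i => z i ∘ₗ LinearMap.proj i) : _ → Dual k (∀ i, V i)) := by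
  rw [Fintype.linearIndependent_iff]
  intro a ha
  have key : ∀ i, a (Sum.inl i) = 0 ∧ a (Sum.inr i) = 0 := fun i => by
    refine LinearIndependent.pair_iff.1 (h i) _ _ (LinearMap.ext fun v => ?_)
    have := LinearMap.congr_fun ha (Pi.single i v)
    rw [Fintype.sum_sum_type, LinearMap.add_apply, LinearMap.sum_apply, LinearMap.sum_apply,
      Finset.sum_eq_single i, Finset.sum_eq_single i] at this
    · simpa using this
    · intro j _ hj; simp [Pi.single_eq_of_ne hj]
    · simp
    · intro j _ hj; simp [Pi.single_eq_of_ne hj]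
    · simp
  rintro (i | i)
  exacts [(key i).1, (key i).2]

theorem span_comp_proj [∀ i, FiniteDimensional k (V i)] (hdim : ∀ i, finrank k (V i) = 2)
    (y z : ∀ i, Dual k (V i)) (h : ∀ i, LinearIndependent k ![y i, z i]) :
    Submodule.span k (Set.range (Sum.elim (fun i => y i ∘ₗ LinearMap.proj i)
      (fun i => z i ∘ₗ LinearMap.proj i) : _ → Dual k (∀ i, V i))) = ⊤ := by
  refine (linearIndependent_comp_proj y z h).span_eq_top_of_card_eq_finrank ?_
  rw [Subspace.dual_finrank_eq, finrank_pi_fintype]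
  simp [hdim]

end Product

section Reduction

variable {k : Type*} [Field k] [IsAlgClosed k] [CharZero k] {A : Type*} [AddCommGroup A]
  [Module (ZMod 2) A] (e : Basis (Fin 3) (ZMod 2) A) {F : Type*} [Group F]
  {p : F →* Multiplicative A} (κ : (Fin 3 → ZMod 2) ≃+ Additive p.ker)

/-- On the `i`-th plane a commutator acts by the sign of the `i`-th minor, which is nonzero only for
the two basis vectors other than `e i`. Those two lifts therefore anticommute, and the lift of `e i`
commutes with both. The smaller index is taken diagonal and the larger one as the exchange, which
produces the tables `monomialSign` and `monomialExp`. -/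
theorem exists_monomial_coordinates (hp : Function.Surjective p)
    (hκ : ∀ g h : F, ((κ fun i => e.repr (p g).toAdd (i + 1) * e.repr (p h).toAdd (i + 2) -
      e.repr (p h).toAdd (i + 1) * e.repr (p g).toAdd (i + 2)).toMul : F) = g * h * g⁻¹ * h⁻¹)
    {M : Fin 3 → Type*} [∀ i, AddCommGroup (M i)] [∀ i, Module k (M i)]
    (T : ∀ i, Representation k F (M i)) (hdim : ∀ i, finrank k (M i) = 2)
    (hT : ∀ v i, T i (κ v).toMul = (-1 : k) ^ (v i).val • 1) :
    ∃ (g : Fin 3 → F) (y z : ∀ i, M i) (c : Fin 3 → Fin 3 → k) (ε : Fin 3 → Fin 3 → ℤˣ),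
      (∀ j, p (g j) = Multiplicative.ofAdd (e j)) ∧ (∀ i, LinearIndependent k ![y i, z i]) ∧
      ∀ j i, c j i ^ 2 = ((ε j i : ℤ) : k) ∧
        ((monomialExp j i = 1 ∧ T i (g j) (y i) = c j i • y i ∧
          T i (g j) (z i) = (((monomialSign j i : ℤ) : k) * c j i) • z i) ∨
        (monomialExp j i = -1 ∧ monomialSign j i = 1 ∧ T i (g j) (y i) = c j i • z i ∧
          T i (g j) (z i) = c j i • y i)) := by
  choose g hg using fun j => hp (Multiplicative.ofAdd (e j))
  -- Squares of lifts lie in the kernel of `p`, hence act by signs; these signs depend on the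
  -- extension and stay unspecified.
  have hsq : ∀ j i, ∃ δ : ℤˣ, T i (g j) * T i (g j) = ((δ : ℤ) : k) • 1 := fun j i => by
    have h1 : g j * g j ∈ p.ker := by
      rw [MonoidHom.mem_ker, map_mul, hg, ← ofAdd_add, ← two_smul (ZMod 2),
        show (2 : ZMod 2) = 0 from rfl, zero_smul, ofAdd_zero]
    obtain ⟨v, hv⟩ := κ.surjective (Additive.ofMul ⟨_, h1⟩)
    refine ⟨(-1) ^ (v i).val, ?_⟩
    rw [← map_mul]
    have := hT v i
    rw [hv] at this
    rw [toMul_ofMul] at this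
    rw [this]
    push_cast
    rfl
  choose δ hδ using hsq
  have hcom : ∀ a b i, T i (g a) * T i (g b) = (-1 : k) ^ (e.repr (e a) (i + 1) *
      e.repr (e b) (i + 2) - e.repr (e b) (i + 1) * e.repr (e a) (i + 2)).val •
        (T i (g b) * T i (g a)) := fun a b i => by
    have h1 := hκ (g a) (g b)
    rw [eq_mul_inv_iff_mul_eq, eq_mul_inv_iff_mul_eq] at h1
    rw [← map_mul, ← h1, map_mul, map_mul, hT, hg, hg, smul_mul_assoc, one_mul, smul_mul_assoc]
    rfl
  have hrepr : ∀ a i, e.repr (e a) i = if a = i then 1 else 0 := fun a i => by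
    rw [e.repr_self, Finsupp.single_apply]
  simp only [hrepr] at hcom
  have hval : (1 : ZMod 2).val = 1 := rfl
  have hbasis : ∀ i, ∃ (y z : M i) (c : Fin 3 → k), LinearIndependent k ![y, z] ∧
      ∀ j, c j ^ 2 = ((δ j i : ℤ) : k) ∧
        ((monomialExp j i = 1 ∧ T i (g j) y = c j • y ∧
          T i (g j) z = (((monomialSign j i : ℤ) : k) * c j) • z) ∨
        (monomialExp j i = -1 ∧ monomialSign j i = 1 ∧ T i (g j) y = c j • z ∧
          T i (g j) z = c j • y)) := by
    intro i
    fin_cases i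
    · obtain ⟨y, z, c, d, a, h, ⟨h1, h2, h3⟩, ⟨h4, h5, h6⟩, h7, h8, h9⟩ :=
        exists_eigenbasis (hdim 0) (T 0 (g 1)) (T 0 (g 2)) (T 0 (g 0)) (δ 1 0) (δ 2 0) (δ 0 0)
        (hδ _ _) (hδ _ _) (hδ _ _) (by simpa [hval] using hcom 1 2 0) (by simpa using hcom 1 0 0)
        (by simpa using hcom 2 0 0)
      refine ⟨y, z, ![a, c, d], h, fun j => ?_⟩
      fin_cases j
      · exact ⟨h7, Or.inl ⟨rfl, h8, by simpa [monomialSign] using h9⟩⟩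
      · exact ⟨h1, Or.inl ⟨rfl, h2, by simpa [monomialSign] using h3⟩⟩
      · exact ⟨h4, Or.inr ⟨rfl, rfl, h5, h6⟩⟩
    · obtain ⟨y, z, c, d, a, h, ⟨h1, h2, h3⟩, ⟨h4, h5, h6⟩, h7, h8, h9⟩ :=
        exists_eigenbasis (hdim 1) (T 1 (g 0)) (T 1 (g 2)) (T 1 (g 1)) (δ 0 1) (δ 2 1) (δ 1 1)
        (hδ _ _) (hδ _ _) (hδ _ _) (by simpa [hval] using hcom 0 2 1) (by simpa using hcom 0 1 1)
        (by simpa using hcom 2 1 1)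
      refine ⟨y, z, ![c, a, d], h, fun j => ?_⟩
      fin_cases j
      · exact ⟨h1, Or.inl ⟨rfl, h2, by simpa [monomialSign] using h3⟩⟩
      · exact ⟨h7, Or.inl ⟨rfl, h8, by simpa [monomialSign] using h9⟩⟩
      · exact ⟨h4, Or.inr ⟨rfl, rfl, h5, h6⟩⟩
    · obtain ⟨y, z, c, d, a, h, ⟨h1, h2, h3⟩, ⟨h4, h5, h6⟩, h7, h8, h9⟩ :=
        exists_eigenbasis (hdim 2) (T 2 (g 0)) (T 2 (g 1)) (T 2 (g 2)) (δ 0 2) (δ 1 2) (δ 2 2)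
        (hδ _ _) (hδ _ _) (hδ _ _) (by simpa [hval] using hcom 0 1 2) (by simpa using hcom 0 2 2)
        (by simpa using hcom 1 2 2)
      refine ⟨y, z, ![c, d, a], h, fun j => ?_⟩
      fin_cases j
      · exact ⟨h1, Or.inl ⟨rfl, h2, by simpa [monomialSign] using h3⟩⟩
      · exact ⟨h4, Or.inr ⟨rfl, rfl, h5, h6⟩⟩
      · exact ⟨h7, Or.inl ⟨rfl, h8, by simpa [monomialSign] using h9⟩⟩
  choose y z c h1 h2 using hbasis
  exact ⟨g, y, z, fun j i => c i j, δ, hg, h1, fun j i => h2 i j⟩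

/-- A representation of a free central extension of `(ℤ/2)³` that is a sum of three planes, on the
`i`-th of which the `i`-th coordinate of the kernel acts by signs, is faithful, and its field of
invariants is a purely transcendental extension of the field of invariants of a faithful monomial
action of `(ℤ/2)³`, which is rational. -/
theorem exists_monomial_reduction (hp : Function.Surjective p)
    (hκ : ∀ g h : F, ((κ fun i => e.repr (p g).toAdd (i + 1) * e.repr (p h).toAdd (i + 2) -
      e.repr (p h).toAdd (i + 1) * e.repr (p g).toAdd (i + 2)).toMul : F) = g * h * g⁻¹ * h⁻¹)
    {V : Fin 3 → Type*} [∀ i, AddCommGroup (V i)] [∀ i, Module k (V i)]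
    (τ : ∀ i, Representation k F (V i)) (hdim : ∀ i, finrank k (V i) = 2)
    (hτ : ∀ v i, τ i (κ v).toMul = (-1 : k) ^ (v i).val • 1)
    (ρ : Representation k F (∀ i, V i)) (hρ : ∀ g v i, ρ g v i = τ i g (v i))
    {E : Type*} [Field E] [Algebra k E] {l : Dual k (∀ i, V i) →ₗ[k] E} (hl : IsFunField l)
    (β : F →* (E ≃ₐ[k] E)) (hβ : ∀ g f, β g (l f) = l (f ∘ₗ ρ g⁻¹)) :
    Function.Injective ρ ∧
    ∃ (σ : Multiplicative A →* (RatField 3 k ≃ₐ[k] RatField 3 k)) (φ : RatField 3 k →ₐ[k] E)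
      (y z : ∀ i, Dual k (V i)) (c a : Fin 3 → Multiplicative A → ℤˣ),
      Function.Injective σ ∧
      (∀ g i, σ g (ratVar k i) =
        algebraMap k _ ((c i g : ℤ) : k) * ratVar k i ^ (a i g : ℤ)) ∧
      (∀ i, LinearIndependent k ![y i, z i]) ∧
      (∀ i, φ (ratVar k i) = l (y i ∘ₗ LinearMap.proj i) / l (z i ∘ₗ LinearMap.proj i)) ∧
      (∀ g f, φ (σ (p g) f) = β g (φ f)) ∧
      Nonempty (Invariants β ≃ₐ[k] RatField 3 (Invariants σ)) ∧
      IsRational k (Invariants σ) := by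
  have hfd : ∀ i, FiniteDimensional k (V i) := fun i => .of_finrank_eq_succ (hdim i)
  -- The kernel has exponent two, so passing to the dual does not change its signs.
  have hdual : ∀ v i, (τ i).dual (κ v).toMul = (-1 : k) ^ (v i).val • 1 := fun v i => by
    refine LinearMap.ext fun f => LinearMap.ext fun w => ?_
    have h1 : (((κ v).toMul : F))⁻¹ = (κ v).toMul := by
      have h2 : -v = v := funext fun i => by
        have : ∀ a : ZMod 2, -a = a := by decide
        exact this _
      conv_rhs => rw [← h2, map_neg]
      rfl
    change f (τ i ((κ v).toMul : F)⁻¹ w) = _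
    rw [h1, hτ]
    simp
  obtain ⟨g, y, z, c, ε, hg, hli, hgyz⟩ := exists_monomial_coordinates e κ hp hκ
    (fun i => (τ i).dual) (fun i => by rw [Subspace.dual_finrank_eq, hdim]) hdual
  have hact : ∀ h i (f : Dual k (V i)),
      β h (l (f ∘ₗ LinearMap.proj i)) = l ((τ i).dual h f ∘ₗ LinearMap.proj i) := fun h i f => by
    rw [hβ]
    congr 1
    refine LinearMap.ext fun v => ?_
    change f (ρ h⁻¹ v i) = f (τ i h⁻¹ (v i))
    rw [hρ]
  have hsmul : ∀ i (f : Dual k (V i)) (a : k),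
      l ((a • f) ∘ₗ LinearMap.proj i) = a • l (f ∘ₗ LinearMap.proj i) := fun i f a => by
    rw [LinearMap.smul_comp, map_smul]
  set Y : Fin 3 → E := fun i => l (y i ∘ₗ LinearMap.proj i) with hY
  set Z : Fin 3 → E := fun i => l (z i ∘ₗ LinearMap.proj i) with hZ
  have helim : (fun s => l (Sum.elim (fun i => y i ∘ₗ LinearMap.proj i)
      (fun i => z i ∘ₗ LinearMap.proj i) s)) = Sum.elim Y Z := by
    funext s; cases s <;> rfl
  have hind : AlgebraicIndependent k (Sum.elim Y Z) :=
    helim ▸ hl.algebraicIndependent_of_finite (linearIndependent_comp_proj y z hli)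
  have hadj : IntermediateField.adjoin k (Set.range (Sum.elim Y Z)) = ⊤ :=
    helim ▸ hl.adjoin_span (span_comp_proj hdim y z hli)
  have hc0 : ∀ j i, c j i ≠ 0 := fun j i h => by
    have h1 := (hgyz j i).1
    rw [h, zero_pow two_ne_zero] at h1
    exact (ε j i).ne_zero (by exact_mod_cast h1.symm)
  have hgYZ : ∀ j i, (monomialExp j i = 1 ∧ β (g j) (Y i) = c j i • Y i ∧
      β (g j) (Z i) = (((monomialSign j i : ℤ) : k) * c j i) • Z i) ∨
      (monomialExp j i = -1 ∧ monomialSign j i = 1 ∧ β (g j) (Y i) = c j i • Z i ∧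
      β (g j) (Z i) = c j i • Y i) := fun j i => by
    simp only [hY, hZ, hact]
    rcases (hgyz j i).2 with ⟨h1, h2, h3⟩ | ⟨h1, h2, h3, h4⟩
    · exact Or.inl ⟨h1, by rw [h2, hsmul], by rw [h3, hsmul]⟩
    · exact Or.inr ⟨h1, h2, by rw [h3, hsmul], by rw [h4, hsmul]⟩
  have hZ0 : ∀ i, Z i ≠ 0 := fun i => hind.ne_zero (Sum.inr i)
  have hker : ∀ n ∈ p.ker, ∀ i, ∃ s : k, s ^ 2 = 1 ∧ β n (Y i) = s • Y i ∧ β n (Z i) = s • Z i := by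
    intro n hn i
    obtain ⟨v, hv⟩ := κ.surjective (Additive.ofMul ⟨n, hn⟩)
    have h1 := hdual v i
    rw [hv, toMul_ofMul] at h1
    change (τ i).dual n = _ at h1
    refine ⟨(-1) ^ (v i).val, by rw [← pow_mul, mul_comm, pow_mul]; norm_num, ?_, ?_⟩
    · simp only [hY, hact, h1, LinearMap.smul_apply, Module.End.one_apply, hsmul]
    · simp only [hZ, hact, h1, LinearMap.smul_apply, Module.End.one_apply, hsmul]
  have hx : ∀ j i, β (g j) (Y i / Z i) =
      ((monomialSign j i : ℤ) : E) * (Y i / Z i) ^ (monomialExp j i : ℤ) := fun j i => by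
    have hc : algebraMap k E (c j i) ≠ 0 := by simpa using hc0 j i
    rcases hgYZ j i with ⟨h1, h2, h3⟩ | ⟨h1, h2, h3, h4⟩
    · rw [map_div₀, h2, h3, h1, Algebra.smul_def, Algebra.smul_def, map_mul, map_intCast]
      rcases Int.units_eq_one_or (monomialSign j i) with h | h <;> rw [h]
      · simp [mul_div_mul_left _ _ hc]
      · simp [div_neg, mul_div_mul_left _ _ hc]
    · rw [map_div₀, h3, h4, h1, h2, Algebra.smul_def, Algebra.smul_def, mul_div_mul_left _ _ hc]
      simp
  have hε : ∀ j i, β (g j) (Y i ^ 2 + Z i ^ 2) = ((ε j i : ℤ) : E) * (Y i ^ 2 + Z i ^ 2) := by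
    intro j i
    have h0 : ((ε j i : ℤ) : E) = algebraMap k E (c j i ^ 2) := by rw [(hgyz j i).1, map_intCast]
    rw [h0, map_add, map_pow, map_pow]
    rcases hgYZ j i with ⟨h1, h2, h3⟩ | ⟨h1, h2, h3, h4⟩
    · rw [h2, h3, Algebra.smul_def, Algebra.smul_def, map_mul, map_intCast, map_pow]
      rcases Int.units_eq_one_or (monomialSign j i) with h | h <;> rw [h] <;> push_cast <;> ring
    · rw [h3, h4, Algebra.smul_def, Algebra.smul_def, map_pow]; ring
  have hxind := algebraicIndependent_div hind hadj
  obtain ⟨σ, φ, c', a, hσ, hmon, hφ, hφβ, hrat⟩ := exists_monomialAction e β g hp hg hxind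
    (fun n hn i => by
      obtain ⟨s, hs, h1, h2⟩ := hker n hn i
      have hs0 : algebraMap k E s ≠ 0 := by
        have : s ≠ 0 := by rintro rfl; simp at hs
        simpa using this
      rw [map_div₀, h1, h2, Algebra.smul_def, Algebra.smul_def, mul_div_mul_left _ _ hs0]) hx
  have hinj : Function.Injective ρ := by
    rw [injective_iff_map_eq_one]
    intro h hh
    have h1 : β h = 1 := by
      have h2 : ρ h⁻¹ = 1 := by
        have : ρ (h⁻¹ * h) = 1 := by simp
        rwa [map_mul, hh, mul_one] at this
      have h3 : ((β h : E ≃ₐ[k] E) : E →ₐ[k] E) = AlgHom.id k E := hl.algHom_ext fun f => by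
        change β h (l f) = l f
        rw [hβ, h2]
        rfl
      exact AlgEquiv.ext fun a => DFunLike.congr_fun h3 a
    -- Trivial action on `W` gives trivial action on the ratios `x i`, and the monomial action of
    -- `A` is faithful. What remains is a vector of signs acting trivially on each plane.
    have h2 : h ∈ p.ker := by
      rw [MonoidHom.mem_ker]
      refine hσ (AlgEquiv.ext fun f => φ.injective ?_)
      change φ _ = φ _
      rw [hφβ, h1, map_one, AlgEquiv.one_apply, AlgEquiv.one_apply]
    obtain ⟨v, hv⟩ := κ.surjective (Additive.ofMul ⟨h, h2⟩)
    have hv0 : v = 0 := funext fun i => by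
      have h3 := hτ v i
      rw [hv, toMul_ofMul] at h3
      have h4 : τ i h = 1 := LinearMap.ext fun w => by
        have := congrFun (LinearMap.congr_fun hh (Pi.single i w)) i
        rw [hρ] at this
        simpa using this
      change τ i h = _ at h3
      have hnt : Nontrivial (V i) := nontrivial_of_finrank_eq_succ (hdim i)
      obtain ⟨w, hw⟩ := exists_ne (0 : V i)
      have h5 := LinearMap.congr_fun (h4.symm.trans h3) w
      have h6 : (1 : k) • w = ((-1) ^ (v i).val : k) • w := by rw [one_smul]; exact h5
      have h7 := smul_left_injective k hw h6
      have h8 : ∀ b : ZMod 2, (1 : k) = (-1) ^ b.val → b = 0 := by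
        intro b hb
        fin_cases b
        · rfl
        · change (1 : k) = (-1) ^ 1 at hb
          norm_num at hb
      exact h8 _ h7
    rw [hv0, map_zero] at hv
    have := congrArg Additive.toMul hv
    exact (congrArg Subtype.val this).symm
  have hA : Finite A := Finite.of_equiv _ e.equivFun.symm.toEquiv
  have hA' : Nat.card A = 8 := by rw [Nat.card_congr e.equivFun.toEquiv]; simp
  have hkf : Finite p.ker := Finite.of_equiv _ κ.toEquiv
  have hF := finite_of_finite_ker hp
  have hcard : Nat.card F = 64 := by
    have h1 : Nat.card p.ker = 8 := by
      have := Nat.card_congr κ.toEquiv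
      rw [Nat.card_eq_fintype_card, Fintype.card_fun, ZMod.card, Fintype.card_fin] at this
      exact this.symm
    rw [card_eq_mul_card_ker hp, hA', h1]
  exact ⟨hinj, σ, φ, y, z, c', a, hσ, hmon, hli, hφ, hφβ,
    nonempty_invariants_algEquiv_of_monomial e β g hcard (hl.action_injective hβ hinj) hg hind hadj
      hker hx ε hε σ φ hσ hφ hφβ, hrat⟩

end Reduction

end

section

open Module

/-! ### Free central extensions of `(ℤ/2)³` -/

section ProductRepresentation

/-- The direct sum of three representations. -/
def prodRep {k F : Type*} [Field k] [Group F] {V : Fin 3 → Type*} [∀ i, AddCommGroup (V i)]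
    [∀ i, Module k (V i)] (τ : ∀ i, Representation k F (V i)) : Representation k F (∀ i, V i) where
  toFun g := LinearMap.pi fun i => τ i g ∘ₗ LinearMap.proj i
  map_one' := by ext; simp
  map_mul' g h := by ext; simp

theorem addChar_two_apply {k : Type*} [Field k] (ε : AddChar (ZMod 2) k)
    (h : ε 1 = -1) (b : ZMod 2) : ε b = (-1) ^ b.val := by
  have hb : ∀ b : ZMod 2, b = 0 ∨ b = 1 := by decide
  rcases hb b with rfl | rfl
  · rw [ε.map_zero_eq_one, ZMod.val_zero, pow_zero]
  · rw [h, show (1 : ZMod 2).val = 1 from rfl, pow_one]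

theorem exists_rational_of_basis_three (k : Type u) [Field k] [IsAlgClosed k] [CharZero k]
    {A : Type v} [AddCommGroup A] [Module (ZMod 2) A] (e : Basis (Fin 3) (ZMod 2) A)
    {F : Type x} [Group F] {p : F →* Multiplicative A} (hp : IsFreeCentralExtension p) :
    Finite F ∧ ∃ (W : Type (max u x)) (_ : AddCommGroup W) (_ : Module k W)
      (_ : FiniteDimensional k W) (τ : Representation k F W), Function.Injective τ ∧
      IsRational k (QuotFunField τ) := by
  obtain ⟨Θ, hΘ⟩ := exists_exteriorSquare_addEquiv_three e
  obtain ⟨hsurj, hcen, κ, hκ⟩ := (isFreeCentralExtension_iff Θ _ hΘ).1 hp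
  have hA : Finite A := Finite.of_equiv _ e.equivFun.symm.toEquiv
  have hkf : Finite p.ker := Finite.of_equiv _ κ.toEquiv
  have hF := finite_of_finite_ker hsurj
  refine ⟨hF, ?_⟩
  obtain ⟨ε, hε⟩ := exists_addChar_isPrimitiveRoot k 2
  have hε1 : ε 1 = -1 := hε.eq_neg_one_of_two_right
  choose g hg using fun j => hsurj (Multiplicative.ofAdd (e j))
  have hcom : ∀ a b, g a * g b = ((κ fun i => e.repr (e a) (i + 1) * e.repr (e b) (i + 2) -
      e.repr (e b) (i + 1) * e.repr (e a) (i + 2)).toMul : F) * g b * g a := fun a b => by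
    have h1 := hκ (g a) (g b)
    rw [hg, hg] at h1
    change ((κ fun i => e.repr (e a) (i + 1) * e.repr (e b) (i + 2) -
      e.repr (e b) (i + 1) * e.repr (e a) (i + 2)).toMul : F) = _ at h1
    rw [h1]; group
  -- One sign character of the kernel for each coordinate; `χ i` is nontrivial on the commutator of
  -- the lifts of `e (i + 1)` and `e (i + 2)` and trivial on the other two, which gives a plane for
  -- each `i`.
  let χ : Fin 3 → p.ker →* kˣ := fun i =>
    subgroupChar ε ((Pi.evalAddMonoidHom (fun _ => ZMod 2) i).comp κ.symm.toAddMonoidHom)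
  have hχ : ∀ v i, (χ i (κ v).toMul : k) = ε (v i) := fun v i => by
    simp only [χ, coe_subgroupChar]
    simp
  have hrepr : ∀ a i, e.repr (e a) i = if a = i then 1 else 0 := fun a i => by
    rw [e.repr_self, Finsupp.single_apply]
  simp only [hrepr] at hcom
  have hpow : ∀ h : F, h ^ 2 ∈ p.ker := fun h => by
    rw [MonoidHom.mem_ker, map_pow]
    refine Multiplicative.toAdd.injective ?_
    rw [toAdd_pow, ← Nat.cast_smul_eq_nsmul (ZMod 2)]
    rw [show ((2 : ℕ) : ZMod 2) = 0 from rfl, zero_smul]; rfl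
  have hU : ∀ i, ∃ (U : Subrepresentation (translationRep k F)) (b : Basis (ZMod 2) k U.toSubmodule),
      ∀ (z : p.ker) j, U.toRepresentation z (b j) = (χ i z : k) • b j := fun i => by
    obtain ⟨U, b, -, -, -, -, h⟩ := exists_cyclic_subrepresentation ε hε p.ker hcen (χ i)
      (g (i + 1)) (g (i + 2)) (g i) _ _ _ (hcom (i + 1) (i + 2))
      (by rw [hχ]; congr 1; fin_cases i <;> decide) (hcom (i + 1) i)
      (Units.ext (by rw [hχ, Units.val_one, ← ε.map_zero_eq_one]; congr 1; fin_cases i <;> decide))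
      (hcom i (i + 2))
      (Units.ext (by rw [hχ, Units.val_one, ← ε.map_zero_eq_one]; congr 1; fin_cases i <;> decide))
      (hpow _) (closure_eq_top_of_basis (p := p) e _ (fun j => by
        have hj : j = i + 1 ∨ j = i + 2 ∨ j = i := by revert i j; decide
        rcases hj with rfl | rfl | rfl
        · exact ⟨_, Or.inl rfl, by rw [hg]; rfl⟩
        · exact ⟨_, Or.inr (Or.inl rfl), by rw [hg]; rfl⟩
        · exact ⟨_, Or.inr (Or.inr (Or.inl rfl)), by rw [hg]; rfl⟩)
        fun _ hz => Or.inr (Or.inr (Or.inr hz)))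
    exact ⟨U, b, h⟩
  choose U b hUb using hU
  have hdim : ∀ i, finrank k (U i).toSubmodule = 2 := fun i => by
    rw [finrank_eq_card_basis (b i), ZMod.card]
  have hfd : ∀ i, FiniteDimensional k (U i).toSubmodule := fun i => .of_finrank_eq_succ (hdim i)
  have hτ : ∀ (v : Fin 3 → ZMod 2) i,
      (U i).toRepresentation (κ v).toMul = (-1 : k) ^ (v i).val • 1 := fun v i =>
    (b i).ext fun j => by
      rw [hUb, hχ, addChar_two_apply ε hε1]
      rfl
  obtain ⟨hinj, σ, -, -, -, -, -, -, -, -, -, -, ⟨E⟩, hrat⟩ := exists_monomial_reduction e κ hsurj hκ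
    (fun i => (U i).toRepresentation) hdim hτ (prodRep fun i => (U i).toRepresentation)
    (fun _ _ _ => rfl) (isFunField_funField k _) (funAction _) (funAction_linForm _)
  exact ⟨∀ i, (U i).toSubmodule, inferInstance, inferInstance, inferInstance,
    prodRep fun i => (U i).toRepresentation, hinj,
    isRational_congr E.symm (isRational_ratField hrat 3)⟩

end ProductRepresentation

/-! ### The quaternion model -/

section Quaternion

/-- The determinant pairing on `(ℤ/2)²`. -/
def detPairing (u v : V4) : ZMod 2 := u.1 * v.2 - v.1 * u.2

/-- The central element `±1` of `Q₈` with the given sign. -/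
def quaternionSign (b : ZMod 2) : Q8 := if b = 0 then 1 else QuaternionGroup.a 2

theorem quaternionSign_add (a b : ZMod 2) :
    quaternionSign (a + b) = quaternionSign a * quaternionSign b := by
  revert a b; unfold quaternionSign; decide

theorem quaternionSign_injective : Function.Injective quaternionSign := by
  intro a b; revert a b; unfold quaternionSign; decide

theorem quaternionSign_comm (b : ZMod 2) (x : Q8) :
    x * quaternionSign b = quaternionSign b * x := by
  revert b x; unfold quaternionSign; decide

/-- The element `-1` is a square, so it dies in a group of exponent two; counting leaves no room for
more. -/
theorem quaternion_ker {q : Q8 →* Multiplicative V4} (hq : Function.Surjective q) (x : Q8) :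
    q x = 1 ↔ ∃ b, x = quaternionSign b := by
  have hV : ∀ u : Multiplicative V4, u * u = 1 := by decide
  have hs : ∀ b, q (quaternionSign b) = 1 := fun b => by
    unfold quaternionSign
    split_ifs
    · exact map_one q
    · rw [show (QuaternionGroup.a 2 : Q8) = QuaternionGroup.a 1 * QuaternionGroup.a 1 by decide,
        map_mul, hV]
  constructor
  · intro hx
    have hcard : Nat.card q.ker = Nat.card (ZMod 2) := by
      have h1 := card_eq_mul_card_ker hq
      have h2 : Nat.card Q8 = 8 := by rw [Nat.card_eq_fintype_card]; decide
      have h3 : Nat.card V4 = 4 := by rw [Nat.card_eq_fintype_card]; decide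
      rw [h2, h3] at h1
      rw [Nat.card_zmod]
      omega
    let f : ZMod 2 → q.ker := fun b => ⟨quaternionSign b, hs b⟩
    have hf : Function.Bijective f := (Nat.bijective_iff_injective_and_card f).2
      ⟨fun a b h => quaternionSign_injective (congrArg Subtype.val h), hcard.symm⟩
    obtain ⟨b, hb⟩ := hf.2 ⟨x, hx⟩
    exact ⟨b, (congrArg Subtype.val hb).symm⟩
  · rintro ⟨b, rfl⟩
    exact hs b

/-- Two quaternions commute exactly when one is central or they agree up to sign, that is, when
their images are linearly dependent over the field with two elements. -/
theorem quaternion_commutator {q : Q8 →* Multiplicative V4} (hq : Function.Surjective q)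
    (x y : Q8) : x * y * x⁻¹ * y⁻¹ = quaternionSign (detPairing (q x).toAdd (q y).toAdd) := by
  have h1 : ∀ x y : Q8, x * y * x⁻¹ * y⁻¹ = quaternionSign 1 ∨
      (x * y * x⁻¹ * y⁻¹ = quaternionSign 0 ∧ ((∃ b, x = quaternionSign b) ∨
        (∃ b, y = quaternionSign b) ∨ ∃ b, x * y⁻¹ = quaternionSign b)) := by
    unfold quaternionSign; decide
  have h2 : ∀ x y : Q8, ((∃ b, x = quaternionSign b) ∨
        (∃ b, y = quaternionSign b) ∨ ∃ b, x * y⁻¹ = quaternionSign b) →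
      x * y * x⁻¹ * y⁻¹ = quaternionSign 0 := by
    unfold quaternionSign; decide
  have h3 : ∀ u v : V4, detPairing u v = 0 ↔ u = 0 ∨ v = 0 ∨ u = v := by
    unfold detPairing; decide
  have h4 : detPairing (q x).toAdd (q y).toAdd = 0 ↔ (∃ b, x = quaternionSign b) ∨
        (∃ b, y = quaternionSign b) ∨ ∃ b, x * y⁻¹ = quaternionSign b := by
    rw [h3, ← quaternion_ker hq, ← quaternion_ker hq, ← quaternion_ker hq, map_mul, map_inv,
      mul_inv_eq_one]
    exact Iff.rfl
  have h5 : ∀ b : ZMod 2, b ≠ 0 → b = 1 := by decide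
  by_cases h : detPairing (q x).toAdd (q y).toAdd = 0
  · rw [h, h2 x y (h4.1 h)]
  · rw [h5 _ h]
    exact (h1 x y).resolve_right fun h' => h (h4.2 h'.2)

/-- The `-1`-eigenspace of the central involution is invariant and nonzero by faithfulness. It is
not a line, since there the anticommuting generators would act by commuting invertible scalars. -/
theorem quaternion_apply_sign {k V : Type*} [Field k] [CharZero k] [AddCommGroup V] [Module k V]
    (hdim : finrank k V = 2) (ρ : Representation k Q8 V) (hρ : Function.Injective ρ) (b : ZMod 2) :
    ρ (quaternionSign b) = (-1 : k) ^ b.val • 1 := by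
  have hfd : FiniteDimensional k V := .of_finrank_eq_succ hdim
  set P := ρ (quaternionSign 1) with hP
  have hmul : ∀ g h v, ρ (g * h) v = ρ g (ρ h v) := fun g h v => by rw [map_mul]; rfl
  have hPP : ∀ v, P (P v) = v := fun v => by
    rw [hP, ← hmul, show quaternionSign 1 * quaternionSign 1 = 1 by unfold quaternionSign; decide,
      map_one, Module.End.one_apply]
  let M := Module.End.eigenspace P (-1)
  have hM : ∀ v, v ∈ M ↔ P v = -v := fun v => by
    rw [Module.End.mem_eigenspace_iff, neg_smul, one_smul]
  have hstab : ∀ g, ∀ v ∈ M, ρ g v ∈ M := fun g v hv => by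
    rw [hM, hP, ← hmul, ← quaternionSign_comm, hmul, (hM v).1 hv, map_neg]
  have hP1 : P ≠ 1 := fun h => by
    have h1 := hρ (h.trans (map_one ρ).symm)
    exact absurd h1 (by unfold quaternionSign; decide)
  obtain ⟨v, hv⟩ : ∃ v, P v ≠ v := by
    by_contra! h
    exact hP1 (LinearMap.ext h)
  have hw : P v - v ∈ M := by rw [hM, map_sub, hPP, neg_sub]
  have hw0 : (⟨P v - v, hw⟩ : M) ≠ 0 := fun h => hv (sub_eq_zero.1 (congrArg Subtype.val h))
  have hle : finrank k M ≤ 2 := hdim ▸ Submodule.finrank_le M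
  have hpos : 0 < finrank k M := finrank_pos_iff_exists_ne_zero.2 ⟨_, hw0⟩
  have hne : finrank k M ≠ 1 := fun h1 => by
    have hscal := (finrank_eq_one_iff_of_nonzero' _ hw0).1 h1
    have h2 : ∀ g, ∃ c : k, ρ g (P v - v) = c • (P v - v) := fun g => by
      obtain ⟨c, hc⟩ := hscal ⟨_, hstab g _ hw⟩
      exact ⟨c, (congrArg Subtype.val hc).symm⟩
    obtain ⟨c, hc⟩ := h2 (QuaternionGroup.a 1)
    obtain ⟨d, hd⟩ := h2 (QuaternionGroup.xa 0)
    have h3 := hmul (QuaternionGroup.a 1) (QuaternionGroup.xa 0) (P v - v)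
    rw [show (QuaternionGroup.a 1 * QuaternionGroup.xa 0 : Q8) = quaternionSign 1 *
      (QuaternionGroup.xa 0 * QuaternionGroup.a 1) by unfold quaternionSign; decide, hmul, hmul] at h3
    simp only [hc, hd, map_smul, ← hP, (hM _).1 hw, smul_neg] at h3
    rw [smul_comm d c, neg_eq_iff_add_eq_zero, ← two_smul k, smul_eq_zero_iff_right two_ne_zero] at h3
    have h4 : ∀ g, ρ g (P v - v) ≠ 0 := fun g h => by
      have h5 := hmul g⁻¹ g (P v - v)
      rw [h, map_zero, inv_mul_cancel, map_one] at h5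
      exact hw0 (Subtype.ext h5)
    rcases smul_eq_zero.1 h3 with h | h
    · exact h4 _ (by rw [hc, h, zero_smul])
    · exact h4 (QuaternionGroup.xa 0) (by rw [hd, h])
  have htop : M = ⊤ := Submodule.eq_top_of_finrank_eq (by rw [hdim]; omega)
  have hb : ∀ b : ZMod 2, b = 0 ∨ b = 1 := by decide
  rcases hb b with rfl | rfl
  · rw [show quaternionSign 0 = 1 by unfold quaternionSign; decide, map_one, ZMod.val_zero, pow_zero,
      one_smul]
  · refine LinearMap.ext fun u => ?_
    have h1 : u ∈ M := htop ▸ Submodule.mem_top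
    rw [← hP, (hM u).1 h1, show (1 : ZMod 2).val = 1 from rfl, pow_one, neg_smul, one_smul]
    rfl

variable {A : Type*} [AddCommGroup A] [Module (ZMod 2) A] (e : Basis (Fin 3) (ZMod 2) A)
  {π : Fin 3 → A →ₗ[ZMod 2] V4}

theorem apply_eq_of_basis (he : ∀ i, π i (e i) = 0) (i : Fin 3) (a : A) :
    π i a = e.repr a (i + 1) • π i (e (i + 1)) + e.repr a (i + 2) • π i (e (i + 2)) := by
  have hsum : ∀ (f : Fin 3 → V4) i, ∑ j, f j = f i + (f (i + 1) + f (i + 2)) := fun f i => by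
    rw [Fin.sum_univ_three]
    fin_cases i
    · change f 0 + f 1 + f 2 = f 0 + (f 1 + f 2); abel
    · change f 0 + f 1 + f 2 = f 1 + (f 2 + f 0); abel
    · change f 0 + f 1 + f 2 = f 2 + (f 0 + f 1); abel
  conv_lhs => rw [← e.sum_repr a]
  rw [map_sum, hsum _ i, map_smul, map_smul, map_smul, he, smul_zero, zero_add]

/-- As `π i` kills `e i`, the other two basis vectors must map to a basis of `(ℤ/2)²`, and a nonzero
determinant modulo two is `1`. -/
theorem detPairing_apply_basis (hπ : ∀ i, Function.Surjective (π i)) (he : ∀ i, π i (e i) = 0)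
    (i : Fin 3) : detPairing (π i (e (i + 1))) (π i (e (i + 2))) = 1 := by
  have h : ∀ u v : V4, (∀ w : V4, ∃ a b : ZMod 2, a • u + b • v = w) → detPairing u v = 1 := by
    unfold detPairing; decide
  refine h _ _ fun w => ?_
  obtain ⟨a, rfl⟩ := hπ i w
  exact ⟨_, _, (apply_eq_of_basis e he i a).symm⟩

theorem detPairing_apply (hπ : ∀ i, Function.Surjective (π i)) (he : ∀ i, π i (e i) = 0)
    (i : Fin 3) (a b : A) : detPairing (π i a) (π i b) =
      e.repr a (i + 1) * e.repr b (i + 2) - e.repr b (i + 1) * e.repr a (i + 2) := by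
  have h := detPairing_apply_basis e hπ he i
  rw [apply_eq_of_basis e he i a, apply_eq_of_basis e he i b]
  rw [detPairing] at h ⊢
  simp only [Prod.fst_add, Prod.smul_fst, Prod.snd_add, Prod.smul_snd, smul_eq_mul]
  linear_combination (e.repr a (i + 1) * e.repr b (i + 2) - e.repr b (i + 1) * e.repr a (i + 2)) * h

theorem eq_zero_of_forall_apply_eq_zero (hπ : ∀ i, Function.Surjective (π i))
    (he : ∀ i, π i (e i) = 0) (a : A) (ha : ∀ i, π i a = 0) : a = 0 := by
  have h : ∀ u v : V4, detPairing u v = 1 → ∀ a b : ZMod 2, a • u + b • v = 0 → a = 0 := by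
    unfold detPairing; decide
  refine e.repr.injective (Finsupp.ext fun j => ?_)
  -- The `j`-th coordinate is the first one seen by `π (j + 2)`, because `j + 2 + 1 = j` in `Fin 3`.
  have h1 := h _ _ (detPairing_apply_basis e hπ he (j + 2)) _ _
    ((apply_eq_of_basis e he (j + 2) a).symm.trans (ha _))
  have h2 : j + 2 + 1 = j := by clear h1; revert j; decide
  rw [h2] at h1
  simpa using h1

/-- The quaternion model maps onto `A`, with kernel `{±1}³`, and its commutators are given by the
minors. -/
theorem exists_quaternionModel_hom (hπ : ∀ i, Function.Surjective (π i))
    (he : ∀ i, π i (e i) = 0) {q : Fin 3 → Q8 →* Multiplicative V4}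
    (hq : ∀ i, Function.Surjective (q i)) :
    ∃ p : quaternionModel π q →* Multiplicative A,
      (∀ (g : quaternionModel π q) i,
        q i ((g : Fin 3 → Q8) i) = Multiplicative.ofAdd (π i (p g).toAdd)) ∧
      Function.Surjective p ∧ p.ker ≤ Subgroup.center (quaternionModel π q) ∧
      ∃ κ : (Fin 3 → ZMod 2) ≃+ Additive p.ker,
        (∀ g h, ((κ fun i => e.repr (p g).toAdd (i + 1) * e.repr (p h).toAdd (i + 2) -
          e.repr (p h).toAdd (i + 1) * e.repr (p g).toAdd (i + 2)).toMul : quaternionModel π q) =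
            g * h * g⁻¹ * h⁻¹) ∧
        ∀ v i, ((κ v).toMul : quaternionModel π q).1 i = quaternionSign (v i) := by
  -- The `π i` are jointly injective, so the element of `A` attached to a triple is unique; this
  -- makes `p` a homomorphism.
  have huniq : ∀ a b : A, (∀ i, π i a = π i b) → a = b := fun a b h =>
    sub_eq_zero.1 (eq_zero_of_forall_apply_eq_zero e hπ he _ fun i => by
      rw [map_sub, h, sub_self])
  choose f hf using fun g : quaternionModel π q => g.2
  let p : quaternionModel π q →* Multiplicative A :=
    MonoidHom.mk' (fun g => Multiplicative.ofAdd (f g)) fun g h =>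
      congrArg Multiplicative.ofAdd (huniq _ _ fun i => Multiplicative.ofAdd.injective (by
        rw [← hf, map_add, ofAdd_add]
        change q i (g.1 i * h.1 i) = Multiplicative.ofAdd (π i (f g)) * Multiplicative.ofAdd (π i (f h))
        rw [map_mul, hf, hf]))
  have hp : ∀ (g : quaternionModel π q) i,
      q i ((g : Fin 3 → Q8) i) = Multiplicative.ofAdd (π i (p g).toAdd) := hf
  have hmem : ∀ g : quaternionModel π q, g ∈ p.ker ↔ ∀ i, ∃ b, g.1 i = quaternionSign b := by
    intro g
    have h1 : ∀ i, (∃ b, g.1 i = quaternionSign b) ↔ π i (p g).toAdd = 0 := fun i => by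
      rw [← quaternion_ker (hq i), hp, ofAdd_eq_one]
    simp only [h1]
    rw [MonoidHom.mem_ker]
    constructor
    · intro h i
      rw [h, toAdd_one, map_zero]
    · intro h
      exact Multiplicative.toAdd.injective (eq_zero_of_forall_apply_eq_zero e hπ he _ h)
  let s : (Fin 3 → ZMod 2) → quaternionModel π q := fun v =>
    ⟨fun i => quaternionSign (v i), 0, fun i => by
      rw [(quaternion_ker (hq i) _).2 ⟨_, rfl⟩, map_zero, ofAdd_zero]⟩
  let κ₀ : (Fin 3 → ZMod 2) →+ Additive p.ker := AddMonoidHom.mk'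
    (fun v => Additive.ofMul ⟨s v, (hmem _).2 fun i => ⟨v i, rfl⟩⟩) fun v w =>
      Additive.toMul.injective (Subtype.ext (Subtype.ext (funext fun i =>
        quaternionSign_add (v i) (w i))))
  have hκ₀ : Function.Bijective κ₀ := by
    constructor
    · intro v w h
      have h1 : s v = s w := congrArg (fun a : Additive p.ker => (a.toMul : quaternionModel π q)) h
      exact funext fun i => quaternionSign_injective (congrFun (congrArg Subtype.val h1) i)
    · intro g
      choose v hv using (hmem g.toMul).1 g.toMul.2
      exact ⟨v, Additive.toMul.injective (Subtype.ext (Subtype.ext (funext fun i => (hv i).symm)))⟩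
  refine ⟨p, hp, fun a => ?_, fun g hg => ?_, AddEquiv.ofBijective κ₀ hκ₀, fun g h => ?_,
    fun v i => rfl⟩
  · choose g hg using fun i => hq i (Multiplicative.ofAdd (π i a.toAdd))
    refine ⟨⟨g, a.toAdd, hg⟩, Multiplicative.toAdd.injective (huniq _ _ fun i => ?_)⟩
    exact Multiplicative.ofAdd.injective ((hp _ i).symm.trans (hg i))
  · rw [Subgroup.mem_center_iff]
    intro h
    refine Subtype.ext (funext fun i => ?_)
    obtain ⟨b, hb⟩ := (hmem g).1 hg i
    change h.1 i * g.1 i = g.1 i * h.1 i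
    rw [hb, quaternionSign_comm]
  · refine Subtype.ext (funext fun i => ?_)
    change quaternionSign _ = g.1 i * h.1 i * (g.1 i)⁻¹ * (h.1 i)⁻¹
    rw [quaternion_commutator (hq i), hp, hp, toAdd_ofAdd, toAdd_ofAdd, detPairing_apply e hπ he]

end Quaternion

end

end FreeCentral

end

theorem mainTheorem6 (k : Type u) [Field k] [IsAlgClosed k] [CharZero k] :
    -- stable rationality of `V / F^c(A)` in the three cases
    (∀ (A : Type v) [AddCommGroup A] [Finite A],
      (IsAddCyclic A ∨
        (∃ ℓ : ℕ, ℓ.Prime ∧ Nonempty (A ≃+ ZMod ℓ × ZMod ℓ)) ∨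
        Nonempty (A ≃+ (Fin 3 → ZMod 2))) →
      ∀ (F : Type x) [Group F] (p : F →* Multiplicative A),
        FreeCentral.IsFreeCentralExtension p →
      ∀ (V : Type w) [AddCommGroup V] [Module k V] [FiniteDimensional k V]
        (ρ : Representation k F V), Function.Injective ρ →
        FreeCentral.IsStablyRational k (FreeCentral.QuotFunField ρ)) ∧
    -- for `A = (ℤ/ℓ)²`, the Heisenberg group is a free central extension
    (∀ ℓ : ℕ, ℓ.Prime →
      ∃ p : FreeCentral.Heisenberg (ZMod ℓ) →* Multiplicative (ZMod ℓ × ZMod ℓ),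
        FreeCentral.IsFreeCentralExtension p) ∧
    -- for `A = (ℤ/2)³`: the quaternion model and the reduction to a monomial action
    (∀ (A : Type v) [AddCommGroup A] [Module (ZMod 2) A] (e : Module.Basis (Fin 3) (ZMod 2) A)
      (π : Fin 3 → A →ₗ[ZMod 2] FreeCentral.V4),
      (∀ i, Function.Surjective (π i)) → (∀ i, π i (e i) = 0) →
      ∀ q : Fin 3 → FreeCentral.Q8 →* Multiplicative FreeCentral.V4,
      (∀ i, Function.Surjective (q i)) →
      ∃ p : FreeCentral.quaternionModel π q →* Multiplicative A,
        (∀ (g : FreeCentral.quaternionModel π q) (i : Fin 3), q i ((g : Fin 3 → FreeCentral.Q8) i) = Multiplicative.ofAdd (π i (p g).toAdd)) ∧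
        FreeCentral.IsFreeCentralExtension p ∧
        ∀ (V : Fin 3 → Type w) [∀ i, AddCommGroup (V i)] [∀ i, Module k (V i)]
          (ρ : ∀ i, Representation k FreeCentral.Q8 (V i)),
          (∀ i, Module.finrank k (V i) = 2) → (∀ i, Function.Injective (ρ i)) →
          Function.Injective (FreeCentral.sumRep ρ (FreeCentral.quaternionModel π q)) ∧
          ∃ (σ : Multiplicative A →* (FreeCentral.RatField 3 k ≃ₐ[k] FreeCentral.RatField 3 k))
            (φ : FreeCentral.RatField 3 k →ₐ[k] FreeCentral.FunField k (∀ i, V i))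
            (y z : ∀ i, Module.Dual k (V i)) (c a : Fin 3 → Multiplicative A → ℤˣ),
            Function.Injective σ ∧
            -- the action is monomial
            (∀ g i, σ g (FreeCentral.ratVar k i) =
              algebraMap k _ ((c i g : ℤ) : k) * FreeCentral.ratVar k i ^ (a i g : ℤ)) ∧
            -- `xᵢ = yᵢ / zᵢ` is a coordinate on `ℙ(Vᵢ)`, equivariantly
            (∀ i, LinearIndependent k ![y i, z i]) ∧
            (∀ i, φ (FreeCentral.ratVar k i) =
              FreeCentral.linForm (y i ∘ₗ LinearMap.proj i) /
                FreeCentral.linForm (z i ∘ₗ LinearMap.proj i)) ∧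
            (∀ g f, φ (σ (p g) f) =
              FreeCentral.funAction
                (FreeCentral.sumRep ρ (FreeCentral.quaternionModel π q)) g (φ f)) ∧
            -- `W / F` is birational to `((ℙ¹)³ / G) × (kˣ)³`
            Nonempty (FreeCentral.QuotFunField
                (FreeCentral.sumRep ρ (FreeCentral.quaternionModel π q)) ≃ₐ[k]
              FreeCentral.RatField 3 (FreeCentral.Invariants σ)) ∧
            FreeCentral.IsRational k (FreeCentral.Invariants σ)) := by
  refine ⟨fun A _ _ hA F _ p hp V _ _ _ ρ hρ => ?_, fun ℓ _ =>
    FreeCentral.exists_isFreeCentralExtension_heisenberg ℓ, fun A _ _ e π hπ he q hq => ?_⟩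
  · rcases hA with hA | ⟨ℓ, hℓ, ⟨f⟩⟩ | ⟨⟨f⟩⟩
    · obtain ⟨_, τ, hτ, hrat⟩ := FreeCentral.exists_rational_of_isAddCyclic k hp
      exact FreeCentral.isStablyRational_quotFunField ρ τ hρ hτ hrat
    · have : Fact ℓ.Prime := ⟨hℓ⟩
      let _ : Module (ZMod ℓ) A := AddCommGroup.zmodModule fun x => f.injective (by
        rw [map_nsmul, map_zero]; ext <;> simp)
      let f' : A ≃ₗ[ZMod ℓ] ZMod ℓ × ZMod ℓ := { f with map_smul' := ZMod.map_smul f }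
      obtain ⟨_, W, _, _, _, τ, hτ, hrat⟩ := FreeCentral.exists_rational_of_basis_two k
        ((Module.Basis.finTwoProd (ZMod ℓ)).map f'.symm) hp
      exact FreeCentral.isStablyRational_quotFunField ρ τ hρ hτ hrat
    · let _ : Module (ZMod 2) A := AddCommGroup.zmodModule fun x => f.injective (by
        rw [map_nsmul, map_zero, ← Nat.cast_smul_eq_nsmul (ZMod 2),
          show ((2 : ℕ) : ZMod 2) = 0 from rfl, zero_smul])
      let f' : A ≃ₗ[ZMod 2] (Fin 3 → ZMod 2) := { f with map_smul' := ZMod.map_smul f }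
      obtain ⟨_, W, _, _, _, τ, hτ, hrat⟩ := FreeCentral.exists_rational_of_basis_three k
        (Module.Basis.ofEquivFun f') hp
      exact FreeCentral.isStablyRational_quotFunField ρ τ hρ hτ hrat
  · obtain ⟨p, hp, hsurj, hcen, κ, hκ, hκs⟩ := FreeCentral.exists_quaternionModel_hom e hπ he hq
    obtain ⟨Θ, hΘ⟩ := FreeCentral.exists_exteriorSquare_addEquiv_three e
    refine ⟨p, hp, (FreeCentral.isFreeCentralExtension_iff Θ _ hΘ).2 ⟨hsurj, hcen, κ, hκ⟩,
      fun V _ _ ρ hdim hρ => ?_⟩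
    exact FreeCentral.exists_monomial_reduction e κ hsurj hκ
      (fun i => (ρ i).comp ((Pi.evalMonoidHom (fun _ => FreeCentral.Q8) i).comp
        (FreeCentral.quaternionModel π q).subtype)) hdim
      (fun v i => (congrArg (ρ i) (hκs v i)).trans
        (FreeCentral.quaternion_apply_sign (hdim i) (ρ i) (hρ i) (v i)))
      (FreeCentral.sumRep ρ (FreeCentral.quaternionModel π q)) (fun _ _ _ => rfl)
      (FreeCentral.isFunField_funField k _) (FreeCentral.funAction _)
      (FreeCentral.funAction_linForm _)
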